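/- A Lie algebra is called $2$-step nilpotent if its derived ideal is nonzero and contained in its center; a Lie group is $2$-step nilpotent if its Lie algebra is. **Theorem.** Let $N$ be a simply connected (real, finite-dimensional) $2$-step nilpotent Lie group endowed with a left-invariant Lorentzian metric $\langle\,,\rangle$ (signature $(1,n-1)=(-,+,\ldots,+)$). Then $\langle\,,\rangle$ is Ricci flat if and only if there exist integers $p,r,q\ge 0$, a real $(2r,p)$-matrix $M_1=(x_i^l)$, a real $(q,p)$-matrix $M_2=(y_i^l)$, real numbers $0<\lambda_1\le\cdots\le\lambda_r$, and vectors $A=(a_i)\in\mathbb R^{2r}$, $B=(b_i)\in\mathbb R^q$ such that $$\operatorname{tr}(M_1{}^tM_1)+\operatorname{tr}(M_2{}^tM_2)=\sum_{i=1}^r\lambda_i^2,\qquad \operatorname{span}\{B,Y_1,\ldots,Y_p\}=\mathbb R^q,$$ and such that $(N,\langle\,,\rangle)$ is isomorphic (by a Lie group isomorphism which is an isometry) to $(\mathbb R^2\times\mathbb R^p\times\mathbb R^{2r}\times\mathbb R^q,\langle\,,\rangle_0)$ with the following group law and metric. Here $X_l,Y_l$ ($1\le l\le p$) denote the columns, and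 $X^i\in\mathbb R^p$ ($1\le i\le 2r$), $Y^i\in\mathbb R^p$ ($1\le i\le q$) the rows, of $M_1$ and $M_2$ respectively, and the dot is the Euclidean product. (a) Group law: $(t^1,\bar t^1,U^1,V^1,W^1)\cdot(t^2,\bar t^2,U^2,V^2,W^2)=(t,\bar t^1+\bar t^2,U,V^1+V^2,W^1+W^2)$, where $$t=t^1+t^2+\tfrac12\sum_{i=1}^r\lambda_i(v_{2i-1}^1v_{2i}^2-v_{2i-1}^2v_{2i}^1)+\tfrac12\sum_{i=1}^{2r}a_i(\bar t^1v_i^2-\bar t^2v_i^1)+\tfrac12\sum_{i=1}^q b_i(\bar t^1w_i^2-\bar t^2w_i^1),$$ $$u_l=u_l^1+u_l^2+\tfrac12\sum_{i=1}^{2r}x_i^l(\bar t^1v_i^2-\bar t^2v_i^1)+\tfrac12\sum_{i=1}^{q}y_i^l(\bar t^1w_i^2-\bar t^2w_i^1),\quad 1\le l\le p.$$ (b) Metric, in the canonical coordinates $(t,\bar t,u_1,\ldots,u_p,v_1,\ldots,v_{2r},w_1,\ldots,w_q)$ (it is symmetric, and the omitted products are zero): $$\langle\partial_t,\partial_{\bar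 t}\rangle_0=\langle\partial_{u_l},\partial_{u_l}\rangle_0=1,\qquad \langle\partial_{\bar t},\partial_{u_l}\rangle_0=\tfrac12(X_l\cdot V+Y_l\cdot W),$$ $$\langle\partial_{\bar t},\partial_{\bar t}\rangle_0=A\cdot V+B\cdot W+\tfrac14\sum_{l=1}^p(X_l\cdot V+Y_l\cdot W)^2,$$ $$\langle\partial_{u_l},\partial_{v_i}\rangle_0=-\tfrac{\bar t}{2}x_i^l,\qquad \langle\partial_{u_l},\partial_{w_j}\rangle_0=-\tfrac{\bar t}{2}y_j^l,$$ $$\langle\partial_{\bar t},\partial_{v_i}\rangle_0=-\tfrac12\bigl((-1)^i\lambda_{\lfloor (i+1)/2\rfloor}v_{i-(-1)^i}+a_i\bar t\bigr)-\tfrac{\bar t}{4}X^i\cdot\Bigl(\sum_{j=1}^{2r}v_jX^j+\sum_{j=1}^q w_jY^j\Bigr),$$ $$\langle\partial_{\bar t},\partial_{w_i}\rangle_0=-\tfrac{\bar t}{2}b_i-\tfrac{\bar t}{4}Y^i\cdot\Bigl(\sum_{j=1}^{2r}v_jX^j+\sum_{j=1}^q w_jY^j\Bigr),$$ $$\langle\partial_{v_i},\partial_{v_j}\rangle_0=\delta_{ij}+\tfrac{\bar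 t^2}{4}X^i\cdot X^j,\quad \langle\partial_{v_i},\partial_{w_j}\rangle_0=\tfrac{\bar t^2}{4}X^i\cdot Y^j,\quad \langle\partial_{w_i},\partial_{w_j}\rangle_0=\delta_{ij}+\tfrac{\bar t^2}{4}Y^i\cdot Y^j.$$ -/

import Mathlib

open scoped Manifold ContDiff Matrix
open Bundle VectorField

noncomputable section

namespace RicciFlatLorentz

/-- A Lie algebra is 2-step nilpotent if its derived ideal is non trivial and is contained in
its center. -/
def IsTwoStepNilpotent (L : Type*) [Bracket L L] [Zero L] : Prop :=
  (∃ u v : L, ⁅u, v⁆ ≠ 0) ∧ ∀ u v w : L, ⁅⁅u, v⁆, w⁆ = 0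

/-- The bilinear form `B` has signature `(1, n - 1) = (-, +, ..., +)`: it has matrix
`diag (-1, 1, ..., 1)` in some basis. -/
def IsLorentzian {V : Type*} [AddCommGroup V] [Module ℝ V] (B : V → V → ℝ) : Prop :=
  ∃ (m : ℕ) (b : Module.Basis (Fin (m + 1)) ℝ V),
    ∀ i j, B (b i) (b j) = if i = j then (if i = 0 then -1 else 1) else 0

section Manifold

variable {E : Type*} [NormedAddCommGroup E] [NormedSpace ℝ E]
  {M : Type*} [TopologicalSpace M] [ChartedSpace E M] [IsManifold 𝓘(ℝ, E) ∞ M]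

variable (E M) in
/-- A (smooth) Lorentzian metric on a manifold `M` modelled on `E`. -/
structure LorentzianMetric where
  /-- The scalar product on each tangent space. -/
  inner (x : M) : TangentSpace 𝓘(ℝ, E) x →L[ℝ] TangentSpace 𝓘(ℝ, E) x →L[ℝ] ℝ
  symm (x : M) (u v : TangentSpace 𝓘(ℝ, E) x) : inner x u v = inner x v u
  lorentzian (x : M) : IsLorentzian fun u v : TangentSpace 𝓘(ℝ, E) x => inner x u v
  contMDiff : ContMDiff 𝓘(ℝ, E) (𝓘(ℝ, E).prod 𝓘(ℝ, E →L[ℝ] E →L[ℝ] ℝ)) ∞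
    (fun x : M => TotalSpace.mk' (E →L[ℝ] E →L[ℝ] ℝ)
      (E := fun x : M => TangentSpace 𝓘(ℝ, E) x →L[ℝ] TangentSpace 𝓘(ℝ, E) x →L[ℝ] ℝ)
      x (inner x))

/-- An affine connection on the manifold `M`. In Mathlib's notation `cov Y x u` is the
derivative `∇_u Y` of the vector field `Y` at `x` in the direction of the tangent vector `u`. -/
abbrev AffineConnection (E M : Type*) [NormedAddCommGroup E] [NormedSpace ℝ E]
    [TopologicalSpace M] [ChartedSpace E M] [IsManifold 𝓘(ℝ, E) ∞ M] :=
  CovariantDerivative 𝓘(ℝ, E) E (fun x : M => TangentSpace 𝓘(ℝ, E) x)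

/-- `cov` is the Levi-Civita connection of `g`: it is torsion free and `g` is parallel. -/
structure IsLeviCivita (g : LorentzianMetric E M) (cov : AffineConnection E M) : Prop where
  torsion_free (X Y : Π x : M, TangentSpace 𝓘(ℝ, E) x) (x : M)
    (hX : MDiffAt (T% X) x) (hY : MDiffAt (T% Y) x) :
    cov Y x (X x) - cov X x (Y x) = mlieBracket 𝓘(ℝ, E) X Y x
  metric_compatible (Y Z : Π x : M, TangentSpace 𝓘(ℝ, E) x) (x : M)
    (hY : MDiffAt (T% Y) x) (hZ : MDiffAt (T% Z) x) (u : TangentSpace 𝓘(ℝ, E) x) :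
    mvfderiv 𝓘(ℝ, E) (fun y => g.inner y (Y y) (Z y)) x u
      = g.inner x (cov Y x u) (Z x) + g.inner x (Y x) (cov Z x u)

/-- `R` is the curvature tensor of the connection `cov`, with the sign convention
`R(X, Y) Z = ∇_[X,Y] Z - ∇_X ∇_Y Z + ∇_Y ∇_X Z`. -/
def IsCurvatureTensor (cov : AffineConnection E M)
    (R : Π x : M, TangentSpace 𝓘(ℝ, E) x →ₗ[ℝ] TangentSpace 𝓘(ℝ, E) x →ₗ[ℝ]
      TangentSpace 𝓘(ℝ, E) x →ₗ[ℝ] TangentSpace 𝓘(ℝ, E) x) : Prop :=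
  ∀ X Y Z : Π x : M, TangentSpace 𝓘(ℝ, E) x,
    CMDiff ∞ (T% X) → CMDiff ∞ (T% Y) → CMDiff ∞ (T% Z) → ∀ x : M,
      R x (X x) (Y x) (Z x) = cov Z x (mlieBracket 𝓘(ℝ, E) X Y x)
        - cov (fun y => cov Z y (Y y)) x (X x) + cov (fun y => cov Z y (X y)) x (Y x)

/-- The Ricci form `r(u, v) = tr (w ↦ R(u, w) v)` of a curvature-like tensor. -/
def ricci (R : Π x : M, TangentSpace 𝓘(ℝ, E) x →ₗ[ℝ] TangentSpace 𝓘(ℝ, E) x →ₗ[ℝ]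
      TangentSpace 𝓘(ℝ, E) x →ₗ[ℝ] TangentSpace 𝓘(ℝ, E) x)
    (x : M) (u v : TangentSpace 𝓘(ℝ, E) x) : ℝ :=
  LinearMap.trace ℝ (TangentSpace 𝓘(ℝ, E) x) ((R x u).flip v)

/-- `g` is Ricci flat: the Ricci form of the curvature of its Levi-Civita connection vanishes. -/
def IsRicciFlat (g : LorentzianMetric E M) : Prop :=
  ∃ cov : AffineConnection E M, IsLeviCivita g cov ∧
    ∃ R, IsCurvatureTensor cov R ∧ ∀ (x : M) (u v : TangentSpace 𝓘(ℝ, E) x), ricci R x u v = 0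

end Manifold

/-- The metric `g` on the Lie group `N` is left invariant. -/
def IsLeftInvariant {E : Type*} [NormedAddCommGroup E] [NormedSpace ℝ E]
    {N : Type*} [TopologicalSpace N] [ChartedSpace E N] [Group N] [LieGroup 𝓘(ℝ, E) ∞ N]
    (g : LorentzianMetric E N) : Prop :=
  ∀ (a x : N) (u v : TangentSpace 𝓘(ℝ, E) x),
    g.inner (a * x) (mfderiv 𝓘(ℝ, E) 𝓘(ℝ, E) (fun y => a * y) x u)
      (mfderiv 𝓘(ℝ, E) 𝓘(ℝ, E) (fun y => a * y) x v) = g.inner x u v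

/-- The space `ℝ² × ℝ^p × ℝ^(2r) × ℝ^q` with canonical coordinates `(t, t̄, u, v, w)`.
The coordinates `v_1, ..., v_(2r)` are indexed by `Fin r × Fin 2`: the pair `(k, 0)` stands for
the odd index `2k - 1` and `(k, 1)` for the even index `2k`, where `k = 1, ..., r`. -/
abbrev Space (p r q : ℕ) : Type :=
  ℝ × ℝ × (Fin p → ℝ) × (Fin r × Fin 2 → ℝ) × (Fin q → ℝ)

namespace Space

variable {p r q : ℕ}

/-- The coordinate `t`. -/
abbrev t (x : Space p r q) : ℝ := x.1
/-- The coordinate `t̄`. -/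
abbrev tb (x : Space p r q) : ℝ := x.2.1
/-- The coordinates `u_1, ..., u_p`. -/
abbrev u (x : Space p r q) : Fin p → ℝ := x.2.2.1
/-- The coordinates `v_1, ..., v_(2r)`. -/
abbrev v (x : Space p r q) : Fin r × Fin 2 → ℝ := x.2.2.2.1
/-- The coordinates `w_1, ..., w_q`. -/
abbrev w (x : Space p r q) : Fin q → ℝ := x.2.2.2.2

end Space

/-- The parameters of the group law and of the metric. -/
structure Params (p r q : ℕ) where
  /-- The matrix `M₁ = (x_i^l)`, with `i = 1, ..., 2r` and `l = 1, ..., p`. -/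
  M₁ : Matrix (Fin r × Fin 2) (Fin p) ℝ
  /-- The matrix `M₂ = (y_i^l)`, with `i = 1, ..., q` and `l = 1, ..., p`. -/
  M₂ : Matrix (Fin q) (Fin p) ℝ
  /-- The numbers `λ_1, ..., λ_r`. -/
  lam : Fin r → ℝ
  /-- The vector `A = (a_1, ..., a_(2r))`. -/
  A : Fin r × Fin 2 → ℝ
  /-- The vector `B = (b_1, ..., b_q)`. -/
  B : Fin q → ℝ

namespace Params

variable {p r q : ℕ} (D : Params p r q)

/-- The group law on `ℝ² × ℝ^p × ℝ^(2r) × ℝ^q`. -/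
def mul (x y : Space p r q) : Space p r q :=
  (x.t + y.t
      + 1 / 2 * ∑ k, D.lam k * (x.v (k, 0) * y.v (k, 1) - y.v (k, 0) * x.v (k, 1))
      + 1 / 2 * ∑ i, D.A i * (x.tb * y.v i - y.tb * x.v i)
      + 1 / 2 * ∑ j, D.B j * (x.tb * y.w j - y.tb * x.w j),
    x.tb + y.tb,
    fun l => x.u l + y.u l
      + 1 / 2 * ∑ i, D.M₁ i l * (x.tb * y.v i - y.tb * x.v i)
      + 1 / 2 * ∑ j, D.M₂ j l * (x.tb * y.w j - y.tb * x.w j),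
    fun i => x.v i + y.v i,
    fun j => x.w j + y.w j)

/-- `X_l · V + Y_l · W`, where `X_l` and `Y_l` are the `l`-th columns of `M₁` and `M₂`. -/
def colDot (x : Space p r q) (l : Fin p) : ℝ :=
  D.M₁.col l ⬝ᵥ x.v + D.M₂.col l ⬝ᵥ x.w

/-- `∑ v_j X^j + ∑ w_j Y^j`, where `X^j` and `Y^j` are the rows of `M₁` and `M₂`. -/
def rowComb (x : Space p r q) : Fin p → ℝ :=
  ∑ j, x.v j • D.M₁.row j + ∑ j, x.w j • D.M₂.row j

/-! The coefficients `⟨∂_a, ∂_b⟩₀` of the metric at the point `x`. -/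

/-- `⟨∂_t̄, ∂_u_l⟩₀` -/
def gTbU (x : Space p r q) (l : Fin p) : ℝ := 1 / 2 * D.colDot x l

/-- `⟨∂_t̄, ∂_t̄⟩₀` -/
def gTbTb (x : Space p r q) : ℝ :=
  D.A ⬝ᵥ x.v + D.B ⬝ᵥ x.w + 1 / 4 * ∑ l, D.colDot x l ^ 2

/-- `⟨∂_u_l, ∂_v_i⟩₀` -/
def gUV (x : Space p r q) (l : Fin p) (i : Fin r × Fin 2) : ℝ := -(x.tb / 2) * D.M₁ i l

/-- `⟨∂_u_l, ∂_w_j⟩₀` -/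
def gUW (x : Space p r q) (l : Fin p) (j : Fin q) : ℝ := -(x.tb / 2) * D.M₂ j l

/-- `⟨∂_t̄, ∂_v_i⟩₀`. The index `i = 2k - 1 + b` (where `b = 0` or `b = 1`) is the pair `(k, b)`,
so that `(-1)^i = (-1)^(b + 1)` and `i - (-1)^i` is the pair `(k, 1 - b)`. -/
def gTbV (x : Space p r q) (i : Fin r × Fin 2) : ℝ :=
  -(1 / 2) * ((-1) ^ ((i.2 : ℕ) + 1) * D.lam i.1 * x.v (i.1, 1 - i.2) + D.A i * x.tb)
    - x.tb / 4 * (D.M₁.row i ⬝ᵥ D.rowComb x)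

/-- `⟨∂_t̄, ∂_w_j⟩₀` -/
def gTbW (x : Space p r q) (j : Fin q) : ℝ :=
  -(x.tb / 2) * D.B j - x.tb / 4 * (D.M₂.row j ⬝ᵥ D.rowComb x)

/-- `⟨∂_v_i, ∂_v_j⟩₀` -/
def gVV (x : Space p r q) (i j : Fin r × Fin 2) : ℝ :=
  (if i = j then 1 else 0) + x.tb ^ 2 / 4 * (D.M₁.row i ⬝ᵥ D.M₁.row j)

/-- `⟨∂_v_i, ∂_w_j⟩₀` -/
def gVW (x : Space p r q) (i : Fin r × Fin 2) (j : Fin q) : ℝ :=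
  x.tb ^ 2 / 4 * (D.M₁.row i ⬝ᵥ D.M₂.row j)

/-- `⟨∂_w_i, ∂_w_j⟩₀` -/
def gWW (x : Space p r q) (i j : Fin q) : ℝ :=
  (if i = j then 1 else 0) + x.tb ^ 2 / 4 * (D.M₂.row i ⬝ᵥ D.M₂.row j)

/-- The metric `⟨ξ, η⟩₀` at the point `x`: the symmetric bilinear form with the coefficients
above, with `⟨∂_t, ∂_t̄⟩₀ = ⟨∂_u_l, ∂_u_l⟩₀ = 1`, all other coefficients being zero. -/
def metric (x ξ η : Space p r q) : ℝ :=
  (ξ.t * η.tb + ξ.tb * η.t)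
    + ∑ l, ξ.u l * η.u l
    + D.gTbTb x * (ξ.tb * η.tb)
    + ∑ l, D.gTbU x l * (ξ.tb * η.u l + ξ.u l * η.tb)
    + ∑ l, ∑ i, D.gUV x l i * (ξ.u l * η.v i + ξ.v i * η.u l)
    + ∑ l, ∑ j, D.gUW x l j * (ξ.u l * η.w j + ξ.w j * η.u l)
    + ∑ i, D.gTbV x i * (ξ.tb * η.v i + ξ.v i * η.tb)
    + ∑ j, D.gTbW x j * (ξ.tb * η.w j + ξ.w j * η.tb)
    + ∑ i, ∑ j, D.gVV x i j * (ξ.v i * η.v j)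
    + ∑ i, ∑ j, D.gVW x i j * (ξ.v i * η.w j + ξ.w j * η.v i)
    + ∑ i, ∑ j, D.gWW x i j * (ξ.w i * η.w j)

/-- The conditions on the parameters: `0 < λ_1 ≤ ... ≤ λ_r`,
`tr (M₁ M₁ᵀ) + tr (M₂ M₂ᵀ) = ∑ λ_i²`, and `B` together with the columns of `M₂` spans `ℝ^q`. -/
structure Admissible : Prop where
  lam_pos : ∀ k, 0 < D.lam k
  lam_mono : Monotone D.lam
  trace_eq : (D.M₁ * D.M₁ᵀ).trace + (D.M₂ * D.M₂ᵀ).trace = ∑ k, D.lam k ^ 2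
  span_eq : Submodule.span ℝ (insert D.B (Set.range D.M₂.col)) = ⊤

/-- The Lie group `N` with the metric `g` is isomorphic to `ℝ² × ℝ^p × ℝ^(2r) × ℝ^q` with the
group law `D.mul` and the metric `D.metric`: there is a diffeomorphism which is compatible with
the group laws and is an isometry. -/
def IsIsomorphic {E : Type*} [NormedAddCommGroup E] [NormedSpace ℝ E]
    {N : Type*} [TopologicalSpace N] [ChartedSpace E N] [Group N] [LieGroup 𝓘(ℝ, E) ∞ N]
    (g : LorentzianMetric E N) : Prop :=
  ∃ φ : Diffeomorph 𝓘(ℝ, E) 𝓘(ℝ, Space p r q) N (Space p r q) ∞,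
    (∀ x y : N, φ (x * y) = D.mul (φ x) (φ y)) ∧
    ∀ (x : N) (ξ η : TangentSpace 𝓘(ℝ, E) x),
      g.inner x ξ η = D.metric (φ x) (mfderiv 𝓘(ℝ, E) 𝓘(ℝ, Space p r q) φ x ξ)
        (mfderiv 𝓘(ℝ, E) 𝓘(ℝ, Space p r q) φ x η)

end Params

end RicciFlatLorentz

end

/-! Left-invariant fields trivialise the tangent bundle, and on them the Levi-Civita connection is a
product on the metric Lie algebra. Ricci flatness is therefore an algebraic condition
(`isRicciFlat_iff`). If the algebra is 2-step nilpotent and b, d are dual bases, the Ricci form is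
-1/2 Σ ⟨[u,b_i],[v,d_i]⟩ + 1/4 ΣΣ ⟨[b_i,b_k],v⟩⟨[d_i,d_k],u⟩ (`IsDual.trace_curv`).

Suppose that it vanishes. For a timelike vector orthogonal to the center, the first term is, up to
sign, a sum of squares of brackets lying in a positive definite space; the vector would be central,
hence orthogonal to itself, which is absurd. If the center were nondegenerate, its orthogonal would
thus be positive definite, and the Ricci form on central vectors, now a sum of squares, would kill
all brackets. So some nonzero null central e is orthogonal to the center (`exists_null_central`).

Complete e to a hyperbolic pair e, e'. The orthogonal of this pair is positive definite and splits
into central vectors z_l and a complement with basis c_i. Vanishing of Ric(z_l,z_l), again a sum of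
squares, puts every [c_i,c_k] in ℝe. The bracket of the c_i is then a skew form, with normal form
given by the λ_k on planes spanned by the v and zero on the w. The other brackets are those of e'
with the c_i: their components along z_l and e are M₁, M₂ and A, B (`exists_isAdaptedBasis`). All of
Ric is now B(x,e)B(y,e) times (Σλ_k² - |M₁|² - |M₂|²)/2, whence the trace equation; the span
condition says that no nonzero combination of the w is central.

On the group side, with θ the Maurer-Cartan form, the logarithm F solves dF = θ + ½[F,θ]. It is
found by integrating two closed forms in succession, and identifies the simply connected group with
its Lie algebra under the law x + y + ½[x,y] (`exists_bch_diffeomorph`). There the left translation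
from 0 to x has derivative ξ ↦ ξ + ½[x,ξ], and the metric of the statement is the constant form
carried along by it (`Params.metric_eq_form`). Conversely, the derivative at 1 of an isometric
isomorphism identifies the metric Lie algebras, the canonical basis of the model is adapted, and the
same Ricci formula applies. -/

open scoped Manifold ContDiff Matrix Topology
open Bundle VectorField

noncomputable section

namespace RicciFlatLorentz

set_option linter.unusedSectionVars false

/-! ### Vector fields, their derivatives and brackets read in charts. -/

section Manifold

variable {E : Type*} [NormedAddCommGroup E] [NormedSpace ℝ E] [FiniteDimensional ℝ E]
  {M : Type*} [TopologicalSpace M] [ChartedSpace E M] [IsManifold 𝓘(ℝ, E) ∞ M]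
  {W : Type*} [NormedAddCommGroup W] [NormedSpace ℝ W]

/-- The derivative of a vector valued function on `M`, where each tangent space is identified
with the model space `E`. -/
def tder (f : M → W) (x : M) : E →L[ℝ] W := mfderiv 𝓘(ℝ, E) 𝓘(ℝ, W) f x

/-- A vector field on `M`, given as a function to `E`, is differentiable at `x`. -/
def VFDiffAt (X : M → E) (x : M) : Prop :=
  MDifferentiableAt 𝓘(ℝ, E) (𝓘(ℝ, E).prod 𝓘(ℝ, E))
    (fun y => (TotalSpace.mk' E y (X y) : TangentBundle 𝓘(ℝ, E) M)) x

/-- The Lie bracket of vector fields given as functions to `E`. -/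
def vfBracket (X Y : M → E) (x : M) : E := mlieBracket 𝓘(ℝ, E) (M := M) X Y x

/-- The derivative at `z` of the inverse of the extended chart around `x`. -/
def chartSymmDer (x : M) (z : E) : E →L[ℝ] E :=
  mfderivWithin 𝓘(ℝ, E) 𝓘(ℝ, E) (extChartAt 𝓘(ℝ, E) x).symm (Set.range 𝓘(ℝ, E)) z

omit [FiniteDimensional ℝ E] in
lemma chartSymmDer_isInvertible (x : M) {z : E} (hz : z ∈ (extChartAt 𝓘(ℝ, E) x).target) :
    (chartSymmDer x z).IsInvertible := 
  have : IsManifold 𝓘(ℝ, E) 1 M := IsManifold.of_le (n := ∞) (by simp)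
  isInvertible_mfderivWithin_extChartAt_symm hz

lemma chartSymmDer_self (x : M) :
    chartSymmDer x (extChartAt 𝓘(ℝ, E) x x) = ContinuousLinearMap.id ℝ E :=
  have : IsManifold 𝓘(ℝ, E) 1 M := IsManifold.of_le (n := ∞) (by simp)
  mfderivWithin_range_extChartAt_symm (I := 𝓘(ℝ, E)) (x := x)

lemma fderiv_comp_extChartAt_symm {f : M → W} (x : M) {z : E}
    (hz : z ∈ (extChartAt 𝓘(ℝ, E) x).target)
    (hf : MDifferentiableAt 𝓘(ℝ, E) 𝓘(ℝ, W) f ((extChartAt 𝓘(ℝ, E) x).symm z)) :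
    HasFDerivAt (f ∘ (extChartAt 𝓘(ℝ, E) x).symm)
      ((tder f ((extChartAt 𝓘(ℝ, E) x).symm z)).comp (chartSymmDer x z)) z := by
  have : IsManifold 𝓘(ℝ, E) 1 M := IsManifold.of_le (n := ∞) (by simp)
  have h1 : MDifferentiableWithinAt 𝓘(ℝ, E) 𝓘(ℝ, E) (extChartAt 𝓘(ℝ, E) x).symm
      (Set.range 𝓘(ℝ, E)) z := 
    mdifferentiableWithinAt_extChartAt_symm hz
  have h2 := hf.hasMFDerivAt.comp_hasMFDerivWithinAt z h1.hasMFDerivWithinAt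
  rw [ModelWithCorners.range_eq_univ, hasMFDerivWithinAt_univ] at h2
  have h3 := h2.hasFDerivAt
  rw [chartSymmDer, ModelWithCorners.range_eq_univ]
  exact h3

lemma tder_eq_fderiv {f : M → W} (x : M) (hf : MDifferentiableAt 𝓘(ℝ, E) 𝓘(ℝ, W) f x) :
    tder f x = fderiv ℝ (f ∘ (extChartAt 𝓘(ℝ, E) x).symm) (extChartAt 𝓘(ℝ, E) x x) := by
  have h := fderiv_comp_extChartAt_symm (f := f) x (mem_extChartAt_target (I := 𝓘(ℝ, E)) x)
    (by simpa using hf)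
  rw [h.fderiv, chartSymmDer_self, ContinuousLinearMap.comp_id, extChartAt_to_inv]

/-- The expression of a vector field in the chart around `x`. -/
def chartField (x : M) (X : M → E) (z : E) : E :=
  (chartSymmDer x z).inverse (X ((extChartAt 𝓘(ℝ, E) x).symm z))

/-- The bracket on the manifold is pulled back from the chart at `x`, and the derivative of that
chart at `x` is the identity. -/
lemma vfBracket_eq (X Y : M → E) (x : M) :
    vfBracket X Y x = lieBracket ℝ (chartField x X) (chartField x Y) (extChartAt 𝓘(ℝ, E) x x) := by
  have : IsManifold 𝓘(ℝ, E) 1 M := IsManifold.of_le (n := ∞) (by simp)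
  let A : E →L[ℝ] E := mfderiv 𝓘(ℝ, E) 𝓘(ℝ, E) (extChartAt 𝓘(ℝ, E) x) x
  let L : E := lieBracketWithin ℝ (chartField x X) (chartField x Y)
      ((extChartAt 𝓘(ℝ, E) x).symm ⁻¹' Set.univ ∩ Set.range 𝓘(ℝ, E)) (extChartAt 𝓘(ℝ, E) x x)
  have hA : A = ContinuousLinearMap.id ℝ E := mfderiv_extChartAt_self (I := 𝓘(ℝ, E)) (x := x)
  have h : vfBracket X Y x = A.inverse L := rfl
  rw [h, hA, ContinuousLinearMap.inverse_id]
  simp only [L, ModelWithCorners.range_eq_univ, Set.preimage_univ, Set.inter_univ,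
    lieBracketWithin_univ]
  rfl

lemma differentiableAt_chartField {X : M → E} {x : M} (hX : VFDiffAt X x) :
    DifferentiableAt ℝ (chartField x X) (extChartAt 𝓘(ℝ, E) x x) := by
  have : IsManifold 𝓘(ℝ, E) 2 M := IsManifold.of_le (n := ∞) (by norm_cast)
  have h := MDifferentiableWithinAt.differentiableWithinAt_mpullbackWithin_vectorField
    (I := 𝓘(ℝ, E)) (M := M) (V := X) (s := Set.univ) (x := x) hX.mdifferentiableWithinAt
  rw [ModelWithCorners.range_eq_univ] at h
  simp only [Set.preimage_univ, Set.inter_univ] at h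
  replace h : DifferentiableWithinAt ℝ (mpullbackWithin 𝓘(ℝ, E) 𝓘(ℝ, E)
    (extChartAt 𝓘(ℝ, E) x).symm X Set.univ : E → E) Set.univ (extChartAt 𝓘(ℝ, E) x x) := h
  have e : chartField x X = (mpullbackWithin 𝓘(ℝ, E) 𝓘(ℝ, E) (extChartAt 𝓘(ℝ, E) x).symm X Set.univ : E → E) := by
    funext z
    rw [chartField, chartSymmDer, ModelWithCorners.range_eq_univ]
    rfl
  refine (differentiableWithinAt_univ (f := chartField x X)).1 ?_
  rw [e]
  exact h

lemma mdifferentiableAt_of_comp_symm {f : M → W} {x x₀ : M}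
    (hx : x ∈ (extChartAt 𝓘(ℝ, E) x₀).source)
    (h : DifferentiableAt ℝ (f ∘ (extChartAt 𝓘(ℝ, E) x₀).symm) (extChartAt 𝓘(ℝ, E) x₀ x)) :
    MDifferentiableAt 𝓘(ℝ, E) 𝓘(ℝ, W) f x := by
  have : IsManifold 𝓘(ℝ, E) 1 M := IsManifold.of_le (n := ∞) (by simp)
  have h1 : MDifferentiableAt 𝓘(ℝ, E) 𝓘(ℝ, E) (extChartAt 𝓘(ℝ, E) x₀) x :=
    mdifferentiableAt_extChartAt (by simpa using hx)
  refine (h.mdifferentiableAt.comp x h1).congr_of_eventuallyEq ?_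
  filter_upwards [(isOpen_extChartAt_source x₀).mem_nhds hx] with y hy
  simp only [Function.comp_apply]
  rw [(extChartAt 𝓘(ℝ, E) x₀).left_inv hy]

lemma contMDiffAt_of_comp_symm {n : ℕ∞} {f : M → W} {x x₀ : M}
    (hx : x ∈ (extChartAt 𝓘(ℝ, E) x₀).source)
    (h : ContDiffAt ℝ n (f ∘ (extChartAt 𝓘(ℝ, E) x₀).symm) (extChartAt 𝓘(ℝ, E) x₀ x)) :
    ContMDiffAt 𝓘(ℝ, E) 𝓘(ℝ, W) n f x := by
  have : IsManifold 𝓘(ℝ, E) n M := IsManifold.of_le (n := ∞) (by norm_cast; exact le_top)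
  have h1 : ContMDiffAt 𝓘(ℝ, E) 𝓘(ℝ, E) n (extChartAt 𝓘(ℝ, E) x₀) x :=
    contMDiffAt_extChartAt' (by simpa using hx)
  refine (h.contMDiffAt.comp x h1).congr_of_eventuallyEq ?_
  filter_upwards [(isOpen_extChartAt_source x₀).mem_nhds hx] with y hy
  simp only [Function.comp_apply]
  rw [(extChartAt 𝓘(ℝ, E) x₀).left_inv hy]

lemma contDiffAt_comp_symm {n : ℕ∞} {f : M → W} {x₀ : M} {z : E}
    (hz : z ∈ (extChartAt 𝓘(ℝ, E) x₀).target)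
    (h : ContMDiffAt 𝓘(ℝ, E) 𝓘(ℝ, W) n f ((extChartAt 𝓘(ℝ, E) x₀).symm z)) :
    ContDiffAt ℝ n (f ∘ (extChartAt 𝓘(ℝ, E) x₀).symm) z := by
  have : IsManifold 𝓘(ℝ, E) n M := IsManifold.of_le (n := ∞) (by norm_cast; exact le_top)
  have h1 : ContMDiffAt 𝓘(ℝ, E) 𝓘(ℝ, E) n (extChartAt 𝓘(ℝ, E) x₀).symm z := by
    have := contMDiffWithinAt_extChartAt_symm_range (I := 𝓘(ℝ, E)) (n := n) x₀ hz
    rwa [ModelWithCorners.range_eq_univ] at this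
  exact (h.comp z h1).contDiffAt

lemma extChartAt_target_mem_nhds_self (x : M) :
    (extChartAt 𝓘(ℝ, E) x).target ∈ 𝓝 (extChartAt 𝓘(ℝ, E) x x) :=
  extChartAt_target_mem_nhds x

/-- The inverse in `chartField` cancels the derivative produced by the chain rule. Equality near the
base point is enough to differentiate once more there. -/
lemma tder_comp_symm_eventuallyEq {f : M → W} {x : M}
    (hf : ContMDiffAt 𝓘(ℝ, E) 𝓘(ℝ, W) 2 f x) (Y : M → E) :
    (fun y => tder f y (Y y)) ∘ (extChartAt 𝓘(ℝ, E) x).symm =ᶠ[𝓝 (extChartAt 𝓘(ℝ, E) x x)]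
      fun z => fderiv ℝ (f ∘ (extChartAt 𝓘(ℝ, E) x).symm) z (chartField x Y z) := by
  have : IsManifold 𝓘(ℝ, E) 2 M := IsManifold.of_le (n := ∞) (by norm_cast)
  have h1 : ∀ᶠ y in 𝓝 x, ContMDiffAt 𝓘(ℝ, E) 𝓘(ℝ, W) 2 f y :=
    (contMDiffAt_iff_contMDiffAt_nhds (by simp)).1 hf
  have h2 : ∀ᶠ z in 𝓝 (extChartAt 𝓘(ℝ, E) x x),
      ContMDiffAt 𝓘(ℝ, E) 𝓘(ℝ, W) 2 f ((extChartAt 𝓘(ℝ, E) x).symm z) :=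
    (continuousAt_extChartAt_symm (I := 𝓘(ℝ, E)) x).eventually (by simpa using h1)
  filter_upwards [extChartAt_target_mem_nhds_self x, h2] with z hz hfz
  rw [(fderiv_comp_extChartAt_symm x hz (hfz.mdifferentiableAt two_ne_zero)).fderiv]
  simp only [Function.comp_apply, chartField, ContinuousLinearMap.comp_apply]
  obtain ⟨e, he⟩ := chartSymmDer_isInvertible x hz
  rw [← he, ContinuousLinearMap.inverse_equiv]
  simp

lemma chartField_self (X : M → E) (x : M) :
    chartField x X (extChartAt 𝓘(ℝ, E) x x) = X x := by
  rw [chartField, chartSymmDer_self, ContinuousLinearMap.inverse_id, extChartAt_to_inv]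
  rfl

lemma hasFDerivAt_fderiv_chartField {f : M → W} {x : M}
    (hf : ContMDiffAt 𝓘(ℝ, E) 𝓘(ℝ, W) 2 f x) {Y : M → E} (hY : VFDiffAt Y x) :
    HasFDerivAt (fun z => fderiv ℝ (f ∘ (extChartAt 𝓘(ℝ, E) x).symm) z (chartField x Y z))
      ((fderiv ℝ (f ∘ (extChartAt 𝓘(ℝ, E) x).symm) (extChartAt 𝓘(ℝ, E) x x)).comp
        (fderiv ℝ (chartField x Y) (extChartAt 𝓘(ℝ, E) x x)) +
       (fderiv ℝ (fderiv ℝ (f ∘ (extChartAt 𝓘(ℝ, E) x).symm)) (extChartAt 𝓘(ℝ, E) x x)).flip (Y x))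
      (extChartAt 𝓘(ℝ, E) x x) := by
  have hg : ContDiffAt ℝ 2 (f ∘ (extChartAt 𝓘(ℝ, E) x).symm) (extChartAt 𝓘(ℝ, E) x x) :=
    contDiffAt_comp_symm (n := 2) (mem_extChartAt_target x) (by simpa using hf)
  have hg' : DifferentiableAt ℝ (fderiv ℝ (f ∘ (extChartAt 𝓘(ℝ, E) x).symm))
      (extChartAt 𝓘(ℝ, E) x x) :=
    (hg.fderiv_right (m := 1) (by norm_num)).differentiableAt one_ne_zero
  have := hg'.hasFDerivAt.clm_apply (differentiableAt_chartField hY).hasFDerivAt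
  rwa [chartField_self] at this

lemma mdifferentiableAt_tder_apply {f : M → W} {x : M}
    (hf : ContMDiffAt 𝓘(ℝ, E) 𝓘(ℝ, W) 2 f x) {Y : M → E} (hY : VFDiffAt Y x) :
    MDifferentiableAt 𝓘(ℝ, E) 𝓘(ℝ, W) (fun y => tder f y (Y y)) x :=
  mdifferentiableAt_of_comp_symm (mem_extChartAt_source x)
    ((hasFDerivAt_fderiv_chartField hf hY).congr_of_eventuallyEq
      (tder_comp_symm_eventuallyEq hf Y)).differentiableAt

lemma tder_tder_apply {f : M → W} {x : M}
    (hf : ContMDiffAt 𝓘(ℝ, E) 𝓘(ℝ, W) 2 f x) {Y : M → E} (hY : VFDiffAt Y x) :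
    tder (fun y => tder f y (Y y)) x =
      (tder f x).comp (fderiv ℝ (chartField x Y) (extChartAt 𝓘(ℝ, E) x x)) +
       (fderiv ℝ (fderiv ℝ (f ∘ (extChartAt 𝓘(ℝ, E) x).symm))
          (extChartAt 𝓘(ℝ, E) x x)).flip (Y x) := by
  rw [tder_eq_fderiv x (mdifferentiableAt_tder_apply hf hY),
    tder_eq_fderiv x (hf.mdifferentiableAt two_ne_zero)]
  exact ((hasFDerivAt_fderiv_chartField hf hY).congr_of_eventuallyEq
      (tder_comp_symm_eventuallyEq hf Y)).fderiv

/-- `[X, Y] f = X (Y f) - Y (X f)`. -/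
lemma tder_vfBracket {f : M → W} {x : M} (hf : ContMDiffAt 𝓘(ℝ, E) 𝓘(ℝ, W) 2 f x)
    {X Y : M → E} (hX : VFDiffAt X x) (hY : VFDiffAt Y x) :
    tder f x (vfBracket X Y x) =
      tder (fun y => tder f y (Y y)) x (X x) - tder (fun y => tder f y (X y)) x (Y x) := by
  have hg : ContDiffAt ℝ 2 (f ∘ (extChartAt 𝓘(ℝ, E) x).symm) (extChartAt 𝓘(ℝ, E) x x) :=
    contDiffAt_comp_symm (n := 2) (mem_extChartAt_target x) (by simpa using hf)
  -- The second derivatives of `f` cancel by symmetry, which leaves the bracket of the chart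
  -- expressions.
  have hsymm := hg.isSymmSndFDerivAt (by simp)
  rw [tder_tder_apply hf hX, tder_tder_apply hf hY, vfBracket_eq, lieBracket_eq]
  simp only [_root_.add_apply, ContinuousLinearMap.comp_apply,
    ContinuousLinearMap.flip_apply, map_sub, chartField_self]
  rw [hsymm.eq (X x) (Y x)]
  abel

end Manifold


/-! ### The left-invariant frame and the Maurer-Cartan form. -/

section LieGroup

variable {E : Type*} [NormedAddCommGroup E] [NormedSpace ℝ E] [FiniteDimensional ℝ E]
  {N : Type*} [TopologicalSpace N] [ChartedSpace E N] [Group N] [LieGroup 𝓘(ℝ, E) ∞ N]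
  {W : Type*} [NormedAddCommGroup W] [NormedSpace ℝ W]

lemma lieGroup_minSmoothness : LieGroup 𝓘(ℝ, E) (minSmoothness ℝ 3) N :=
  LieGroup.of_le (n := ∞) (by rw [minSmoothness_of_isRCLikeNormedField]; norm_cast)

/-- The tangent vector at `x` given by a vector of the model space. -/
abbrev mkTangent (x : N) (v : E) : TangentBundle 𝓘(ℝ, E) N := TotalSpace.mk' E x v

/-- The derivative at `x` of the left multiplication by `a`, where the tangent spaces are
identified with the model space. -/
def leftDer (a x : N) : E →L[ℝ] E := mfderiv 𝓘(ℝ, E) 𝓘(ℝ, E) (fun y : N => a * y) x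

lemma mdifferentiableAt_mul_left' (a x : N) :
    MDifferentiableAt 𝓘(ℝ, E) 𝓘(ℝ, E) (fun y : N => a * y) x :=
  (contMDiff_mul_left (I := 𝓘(ℝ, E)) (n := ∞) (a := a)).mdifferentiableAt (by simp)

lemma leftDer_comp (a b x : N) (v : E) :
    leftDer (E := E) a (b * x) (leftDer b x v) = leftDer (a * b) x v := by
  have h := mfderiv_comp x (mdifferentiableAt_mul_left' (E := E) a (b * x))
    (mdifferentiableAt_mul_left' b x)
  have h' : leftDer (E := E) (a * b) x = (leftDer a (b * x)).comp (leftDer b x) := by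
    refine Eq.trans ?_ h
    have : (fun y : N => a * b * y) = (fun y => a * y) ∘ fun y => b * y := by
      ext y; simp [mul_assoc]
    unfold leftDer
    rw [this]
  rw [h']
  rfl

lemma leftDer_one (x : N) (v : E) : leftDer (E := E) (1 : N) x v = v := by
  have : (fun y : N => 1 * y) = id := by ext y; simp
  unfold leftDer
  rw [this, mfderiv_id]
  rfl

/-- The left invariant vector field with value `v` at `1`. -/
def frame (x : N) : E →L[ℝ] E := leftDer x 1

/-- The left Maurer-Cartan form. -/
def maurerCartan (x : N) : E →L[ℝ] E := leftDer x⁻¹ x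

@[simp] lemma maurerCartan_frame (x : N) (v : E) : maurerCartan x (frame x v) = v := by
  have h := leftDer_comp x⁻¹ x 1 v
  rw [mul_one, inv_mul_cancel, leftDer_one] at h
  exact h

@[simp] lemma frame_maurerCartan (x : N) (v : E) : frame x (maurerCartan x v) = v := by
  have h := leftDer_comp x x⁻¹ x v
  rw [inv_mul_cancel, mul_inv_cancel, leftDer_one] at h
  exact h

lemma maurerCartan_leftDer (a x : N) (v : E) :
    maurerCartan (a * x) (leftDer a x v) = maurerCartan x v := by
  have h := leftDer_comp (a * x)⁻¹ a x v
  rw [mul_inv_rev, inv_mul_cancel_right] at h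
  rw [maurerCartan, mul_inv_rev, h, maurerCartan]

lemma frame_one (v : E) : frame (1 : N) v = v := leftDer_one 1 v

/-- A vector field on `M`, given as a function to `E`, is of class `C^n` at `x`. -/
def VFContAt {M : Type*} [TopologicalSpace M] [ChartedSpace E M] [IsManifold 𝓘(ℝ, E) ∞ M]
    (n : ℕ∞) (X : M → E) (x : M) : Prop :=
  ContMDiffAt 𝓘(ℝ, E) (𝓘(ℝ, E).prod 𝓘(ℝ, E)) n
    (fun y => (TotalSpace.mk' E y (X y) : TangentBundle 𝓘(ℝ, E) M)) x

/-- The partial derivative, with respect to the second variable, of a map `N × N → N`, as a map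
of tangent bundles. -/
def tangentSnd (P : N × N → N) (p : TangentBundle 𝓘(ℝ, E) N × TangentBundle 𝓘(ℝ, E) N) :
    TangentBundle 𝓘(ℝ, E) N :=
  tangentMap (𝓘(ℝ, E).prod 𝓘(ℝ, E)) 𝓘(ℝ, E) P
    ((equivTangentBundleProd 𝓘(ℝ, E) N 𝓘(ℝ, E) N).symm p)

lemma contMDiff_tangentSnd {P : N × N → N}
    (hP : ContMDiff (𝓘(ℝ, E).prod 𝓘(ℝ, E)) 𝓘(ℝ, E) ∞ P) :
    ContMDiff ((𝓘(ℝ, E).prod 𝓘(ℝ, E)).prod (𝓘(ℝ, E).prod 𝓘(ℝ, E))) (𝓘(ℝ, E).prod 𝓘(ℝ, E)) ∞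
      (tangentSnd (E := E) P) :=
  (hP.contMDiff_tangentMap (m := ∞) (by simp)).comp contMDiff_equivTangentBundleProd_symm

/-- The partial derivative of a map `N × N → N` with respect to the second variable. -/
def sndDer (P : N × N → N) (x y : N) : E →L[ℝ] E :=
  mfderiv 𝓘(ℝ, E) 𝓘(ℝ, E) (fun z => P (x, z)) y

lemma tangentSnd_apply {P : N × N → N}
    (hP : ContMDiff (𝓘(ℝ, E).prod 𝓘(ℝ, E)) 𝓘(ℝ, E) ∞ P) (x y : N) (v : E) :
    tangentSnd (E := E) P (mkTangent x (0 : E), mkTangent y v) =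
      mkTangent (P (x, y)) (sndDer P x y v) := by
  have h := mfderiv_prod_eq_add_apply (I := 𝓘(ℝ, E)) (I' := 𝓘(ℝ, E)) (p := (x, y))
    (v := ((0 : E), v)) (hP.mdifferentiableAt (by simp))
  let L₁ : E →L[ℝ] E := mfderiv 𝓘(ℝ, E) 𝓘(ℝ, E) (fun z => P (z, y)) x
  let L₂ : E →L[ℝ] E := mfderiv 𝓘(ℝ, E) 𝓘(ℝ, E) (fun z => P (x, z)) y
  have h2 : L₁ 0 + L₂ v = L₂ v := by rw [map_zero, zero_add]
  exact congrArg (mkTangent (E := E) (P (x, y))) (h.trans h2)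

/-- On the fibre over `1` the trivialization at `1` is the identity, so a map into this fibre is as
regular as the underlying map to `E`. -/
lemma contMDiffAt_one_mk {n : ℕ∞} {f : N → E} {x : N} :
    ContMDiffAt 𝓘(ℝ, E) (𝓘(ℝ, E).prod 𝓘(ℝ, E)) n
      (fun y => (mkTangent (1 : N) (f y))) x ↔
    ContMDiffAt 𝓘(ℝ, E) 𝓘(ℝ, E) n f x := by
  rw [contMDiffAt_totalSpace]
  have : (fun y => (trivializationAt E (TangentSpace 𝓘(ℝ, E) (M := N)) (1 : N)
      (mkTangent (1 : N) (f y))).2) = f := by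
    funext y
    exact (tangentBundleCore 𝓘(ℝ, E) N).coordChange_self (achart E 1) 1 (mem_chart_source E 1) _
  refine ⟨fun h => ?_, fun h => ⟨contMDiffAt_const, ?_⟩⟩
  · rw [← this]; exact h.2
  · rw [← this] at h; exact h

lemma mdifferentiableAt_one_mk {f : N → E} {x : N} :
    MDifferentiableAt 𝓘(ℝ, E) (𝓘(ℝ, E).prod 𝓘(ℝ, E))
      (fun y => (mkTangent (1 : N) (f y))) x ↔
    MDifferentiableAt 𝓘(ℝ, E) 𝓘(ℝ, E) f x := by
  rw [mdifferentiableAt_totalSpace]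
  have : (fun y => (trivializationAt E (TangentSpace 𝓘(ℝ, E) (M := N)) (1 : N)
      (mkTangent (1 : N) (f y))).2) = f := by
    funext y
    exact (tangentBundleCore 𝓘(ℝ, E) N).coordChange_self (achart E 1) 1 (mem_chart_source E 1) _
  refine ⟨fun h => ?_, fun h => ⟨mdifferentiableAt_const, ?_⟩⟩
  · rw [← this]; exact h.2
  · rw [← this] at h; exact h

variable (E N) in
lemma contMDiff_zeroVF : ContMDiff 𝓘(ℝ, E) (𝓘(ℝ, E).prod 𝓘(ℝ, E)) ∞
    (fun y : N => mkTangent y (0 : E)) :=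
  contMDiff_zeroSection ℝ (TangentSpace 𝓘(ℝ, E) (M := N))

variable (E N) in
lemma contMDiff_inv_mul : ContMDiff (𝓘(ℝ, E).prod 𝓘(ℝ, E)) 𝓘(ℝ, E) ∞
    (fun p : N × N => p.1⁻¹ * p.2) :=
  (contMDiff_fst.inv).mul contMDiff_snd

/-- The form at `y` is the partial derivative of (a, b) ↦ a⁻¹b in `b` at (y, y). As part of the
tangent map of one smooth map, it depends smoothly on `y`. -/
lemma mk_maurerCartan (X : N → E) :
    (fun y => (mkTangent (1 : N) (maurerCartan y (X y)))) =
    fun y => tangentSnd (E := E) (fun p : N × N => p.1⁻¹ * p.2)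
        (mkTangent y (0 : E), mkTangent y (X y)) := by
  funext y
  rw [tangentSnd_apply (contMDiff_inv_mul E N)]
  have : (1 : N) = y⁻¹ * y := by simp
  change (mkTangent (1 : N) (maurerCartan y (X y))) =
    mkTangent (y⁻¹ * y) (maurerCartan y (X y))
  -- The base points `y⁻¹ * y` and `1` are equal only propositionally; the vector is made opaque so
  -- that the base point alone is rewritten.
  generalize maurerCartan y (X y) = v
  rw [← this]

lemma mk_frame (f : N → E) :
    (fun y => (mkTangent y (frame y (f y)))) =
    fun y => tangentSnd (E := E) (fun p : N × N => p.1 * p.2)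
        (mkTangent y (0 : E), mkTangent (1 : N) (f y)) := by
  funext y
  rw [tangentSnd_apply (contMDiff_mul 𝓘(ℝ, E) ∞)]
  have : y = y * 1 := by simp
  change (mkTangent y (frame y (f y))) =
    mkTangent (y * 1) (frame y (f y))
  generalize frame y (f y) = v
  rw [← this]

lemma vfDiffAt_frame {f : N → E} {x : N} (hf : MDifferentiableAt 𝓘(ℝ, E) 𝓘(ℝ, E) f x) :
    VFDiffAt (fun y => frame y (f y)) x := by
  unfold VFDiffAt
  rw [mk_frame f]
  exact ((contMDiff_tangentSnd (contMDiff_mul 𝓘(ℝ, E) ∞)).mdifferentiable (by simp) _).comp x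
    (((contMDiff_zeroVF E N).mdifferentiable (by simp) x).prodMk
      (mdifferentiableAt_one_mk.2 hf))

lemma vfContAt_frame {n : ℕ∞} {f : N → E} {x : N} (hf : ContMDiffAt 𝓘(ℝ, E) 𝓘(ℝ, E) n f x) :
    VFContAt n (fun y => frame y (f y)) x := by
  unfold VFContAt
  rw [mk_frame f]
  exact ((contMDiff_tangentSnd (contMDiff_mul 𝓘(ℝ, E) ∞)).of_le (by norm_cast; exact le_top) _).comp x
    (((contMDiff_zeroVF E N).of_le (by norm_cast; exact le_top) x).prodMk
      (contMDiffAt_one_mk.2 hf))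

lemma mdifferentiableAt_maurerCartan {X : N → E} {x : N} (hX : VFDiffAt X x) :
    MDifferentiableAt 𝓘(ℝ, E) 𝓘(ℝ, E) (fun y => maurerCartan y (X y)) x := by
  rw [← mdifferentiableAt_one_mk, mk_maurerCartan X]
  exact ((contMDiff_tangentSnd (contMDiff_inv_mul E N)).mdifferentiable (by simp) _).comp x
    (((contMDiff_zeroVF E N).mdifferentiable (by simp) x).prodMk hX)

lemma contMDiffAt_maurerCartan {n : ℕ∞} {X : N → E} {x : N} (hX : VFContAt n X x) :
    ContMDiffAt 𝓘(ℝ, E) 𝓘(ℝ, E) n (fun y => maurerCartan y (X y)) x := by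
  rw [← contMDiffAt_one_mk, mk_maurerCartan X]
  exact ((contMDiff_tangentSnd (contMDiff_inv_mul E N)).of_le (by norm_cast; exact le_top) _).comp x
    (((contMDiff_zeroVF E N).of_le (by norm_cast; exact le_top) x).prodMk hX)

end LieGroup

/-! ### Calculus in the left-invariant frame and the Maurer-Cartan equation. -/

section LieGroup

variable {E : Type*} [NormedAddCommGroup E] [NormedSpace ℝ E] [FiniteDimensional ℝ E]
  {N : Type*} [TopologicalSpace N] [ChartedSpace E N] [Group N] [LieGroup 𝓘(ℝ, E) ∞ N]
  {W : Type*} [NormedAddCommGroup W] [NormedSpace ℝ W]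

section
variable {M : Type*} [TopologicalSpace M] [ChartedSpace E M] [IsManifold 𝓘(ℝ, E) ∞ M]

lemma vfBracket_swap (X Y : M → E) (x : M) : vfBracket X Y x = -vfBracket Y X x :=
  mlieBracket_swap_apply (I := 𝓘(ℝ, E)) (M := M) (V := X) (W := Y)

lemma vfBracket_add_right {X Y Z : M → E} {x : M} (hY : VFDiffAt Y x) (hZ : VFDiffAt Z x) :
    vfBracket X (fun y => Y y + Z y) x = vfBracket X Y x + vfBracket X Z x := by
  have : IsManifold 𝓘(ℝ, E) 2 M := IsManifold.of_le (n := ∞) (by norm_cast)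
  have : CompleteSpace E := FiniteDimensional.complete ℝ E
  exact mlieBracket_add_right (I := 𝓘(ℝ, E)) (M := M) (V := X) (W := Y) (W₁ := Z) hY hZ

lemma vfBracket_smul_right {X Y : M → E} {φ : M → ℝ} {x : M}
    (hφ : MDifferentiableAt 𝓘(ℝ, E) 𝓘(ℝ, ℝ) φ x) (hY : VFDiffAt Y x) :
    vfBracket X (fun y => φ y • Y y) x = tder φ x (X x) • Y x + φ x • vfBracket X Y x := by
  have : IsManifold 𝓘(ℝ, E) 2 M := IsManifold.of_le (n := ∞) (by norm_cast)
  have : CompleteSpace E := FiniteDimensional.complete ℝ E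
  exact mlieBracket_smul_right (I := 𝓘(ℝ, E)) (M := M) (V := X) (W := Y) hφ hY

lemma vfBracket_add_left {X Y Z : M → E} {x : M} (hX : VFDiffAt X x) (hY : VFDiffAt Y x) :
    vfBracket (fun y => X y + Y y) Z x = vfBracket X Z x + vfBracket Y Z x := by
  rw [vfBracket_swap, vfBracket_add_right hX hY, vfBracket_swap X, vfBracket_swap Y]
  abel

lemma vfBracket_smul_left {X Y : M → E} {φ : M → ℝ} {x : M}
    (hφ : MDifferentiableAt 𝓘(ℝ, E) 𝓘(ℝ, ℝ) φ x) (hX : VFDiffAt X x) :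
    vfBracket (fun y => φ y • X y) Y x = -(tder φ x (Y x) • X x) + φ x • vfBracket X Y x := by
  rw [vfBracket_swap, vfBracket_smul_right hφ hX, vfBracket_swap X Y, smul_neg]
  abel

lemma tder_const (v : W) (x : M) : tder (E := E) (fun _ : M => v) x = 0 :=
  mfderiv_const

lemma tder_add {f g : M → W} {x : M} (hf : MDifferentiableAt 𝓘(ℝ, E) 𝓘(ℝ, W) f x)
    (hg : MDifferentiableAt 𝓘(ℝ, E) 𝓘(ℝ, W) g x) :
    tder (E := E) (fun y => f y + g y) x = tder f x + tder g x :=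
  mfderiv_add hf hg

lemma tder_sub {f g : M → W} {x : M} (hf : MDifferentiableAt 𝓘(ℝ, E) 𝓘(ℝ, W) f x)
    (hg : MDifferentiableAt 𝓘(ℝ, E) 𝓘(ℝ, W) g x) :
    tder (E := E) (fun y => f y - g y) x = tder f x - tder g x :=
  mfderiv_sub hf hg

lemma hasMFDerivAt_comp {W' : Type*} [NormedAddCommGroup W'] [NormedSpace ℝ W'] {G : W → W'}
    {f : M → W} {x : M} {G' : W →L[ℝ] W'} (hG : HasFDerivAt G G' (f x))
    (hf : MDifferentiableAt 𝓘(ℝ, E) 𝓘(ℝ, W) f x) :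
    HasMFDerivAt 𝓘(ℝ, E) 𝓘(ℝ, W') (fun y => G (f y)) x (G'.comp (tder (E := E) f x)) :=
  hG.hasMFDerivAt.comp x hf.hasMFDerivAt

lemma tder_comp {W' : Type*} [NormedAddCommGroup W'] [NormedSpace ℝ W'] {G : W → W'}
    {f : M → W} {x : M} {G' : W →L[ℝ] W'} (hG : HasFDerivAt G G' (f x))
    (hf : MDifferentiableAt 𝓘(ℝ, E) 𝓘(ℝ, W) f x) :
    tder (E := E) (fun y => G (f y)) x = G'.comp (tder (E := E) f x) :=
  (hasMFDerivAt_comp hG hf).mfderiv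

lemma tder_clm_comp {W' : Type*} [NormedAddCommGroup W'] [NormedSpace ℝ W'] (L : W →L[ℝ] W')
    {f : M → W} {x : M} (hf : MDifferentiableAt 𝓘(ℝ, E) 𝓘(ℝ, W) f x) :
    tder (E := E) (fun y => L (f y)) x = L.comp (tder f x) :=
  tder_comp L.hasFDerivAt hf

lemma mdifferentiableAt_clm_comp {W' : Type*} [NormedAddCommGroup W'] [NormedSpace ℝ W']
    (L : W →L[ℝ] W')
    {f : M → W} {x : M} (hf : MDifferentiableAt 𝓘(ℝ, E) 𝓘(ℝ, W) f x) :
    MDifferentiableAt 𝓘(ℝ, E) 𝓘(ℝ, W') (fun y => L (f y)) x :=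
  (hasMFDerivAt_comp L.hasFDerivAt hf).mdifferentiableAt

section Bilinear

variable {W₁ W₂ : Type*} [NormedAddCommGroup W₁] [NormedSpace ℝ W₁]
    [NormedAddCommGroup W₂] [NormedSpace ℝ W₂]

lemma tder_prodMk {f : M → W₁} {g : M → W₂} {x : M}
    (hf : MDifferentiableAt 𝓘(ℝ, E) 𝓘(ℝ, W₁) f x)
    (hg : MDifferentiableAt 𝓘(ℝ, E) 𝓘(ℝ, W₂) g x) :
    tder (E := E) (fun y => (f y, g y)) x = (tder f x).prod (tder g x) := by
  have h : HasMFDerivAt 𝓘(ℝ, E) 𝓘(ℝ, W₁ × W₂) (fun y => (f y, g y)) x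
      ((tder (E := E) f x).prod (tder g x)) :=
    ⟨hf.continuousAt.prodMk hg.continuousAt, hf.hasMFDerivAt.2.prodMk hg.hasMFDerivAt.2⟩
  exact h.mfderiv

lemma hasFDerivAt_bilin (L : W₁ →L[ℝ] W₂ →L[ℝ] W) (p : W₁ × W₂) :
    HasFDerivAt (fun p : W₁ × W₂ => L p.1 p.2) (L.deriv₂ p) p :=
  L.isBoundedBilinearMap.hasFDerivAt p

lemma mdifferentiableAt_bilin (L : W₁ →L[ℝ] W₂ →L[ℝ] W) {f : M → W₁} {g : M → W₂} {x : M}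
    (hf : MDifferentiableAt 𝓘(ℝ, E) 𝓘(ℝ, W₁) f x)
    (hg : MDifferentiableAt 𝓘(ℝ, E) 𝓘(ℝ, W₂) g x) :
    MDifferentiableAt 𝓘(ℝ, E) 𝓘(ℝ, W) (fun y => L (f y) (g y)) x :=
  (hasMFDerivAt_comp (f := fun y => (f y, g y)) (hasFDerivAt_bilin L _)
    (hf.prodMk_space hg)).mdifferentiableAt

/-- The product rule for a continuous bilinear map. -/
lemma tder_bilin (L : W₁ →L[ℝ] W₂ →L[ℝ] W)
    {f : M → W₁} {g : M → W₂} {x : M} (hf : MDifferentiableAt 𝓘(ℝ, E) 𝓘(ℝ, W₁) f x)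
    (hg : MDifferentiableAt 𝓘(ℝ, E) 𝓘(ℝ, W₂) g x) (v : E) :
    tder (fun y => L (f y) (g y)) x v = L (f x) (tder g x v) + L (tder f x v) (g x) := by
  rw [tder_comp (f := fun y => (f y, g y)) (hasFDerivAt_bilin L _) (hf.prodMk_space hg),
    tder_prodMk hf hg]
  simp

end Bilinear

/-- Coordinates in a basis of `E` write every differentiable map as a finite sum of terms `φ y • v`.
This extends bracket formulas from left-invariant fields to all differentiable ones. -/
lemma mdifferentiableAt_induction {x : M} {P : (M → E) → Prop}
    (hadd : ∀ f g : M → E, MDifferentiableAt 𝓘(ℝ, E) 𝓘(ℝ, E) f x →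
      MDifferentiableAt 𝓘(ℝ, E) 𝓘(ℝ, E) g x → P f → P g → P fun y => f y + g y)
    (hsmul : ∀ (φ : M → ℝ) (v : E), MDifferentiableAt 𝓘(ℝ, E) 𝓘(ℝ, ℝ) φ x → P fun y => φ y • v)
    {f : M → E} (hf : MDifferentiableAt 𝓘(ℝ, E) 𝓘(ℝ, E) f x) : P f := by
  let b := Module.finBasis ℝ E
  have hcoord (i) : MDifferentiableAt 𝓘(ℝ, E) 𝓘(ℝ, ℝ) (fun y => b.coord i (f y)) x :=
    mdifferentiableAt_clm_comp (LinearMap.toContinuousLinearMap (b.coord i)) hf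
  have hterm (i) : MDifferentiableAt 𝓘(ℝ, E) 𝓘(ℝ, E) (fun y => b.coord i (f y) • b i) x :=
    mdifferentiableAt_clm_comp
      ((ContinuousLinearMap.id ℝ ℝ).smulRight (b i)) (hcoord i)
  have key (s : Finset (Fin (Module.finrank ℝ E))) :
      MDifferentiableAt 𝓘(ℝ, E) 𝓘(ℝ, E) (fun y => ∑ i ∈ s, b.coord i (f y) • b i) x ∧
      P fun y => ∑ i ∈ s, b.coord i (f y) • b i := by
    induction s using Finset.induction_on with
    | empty =>
      refine ⟨by simpa using mdifferentiableAt_const, ?_⟩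
      simpa using hsmul (fun _ => 0) 0 mdifferentiableAt_const
    | insert i s hi ih =>
      simp only [Finset.sum_insert hi]
      exact ⟨(hterm i).add ih.1, hadd _ _ (hterm i) ih.1 (hsmul _ _ (hcoord i)) ih.2⟩
  have h := (key Finset.univ).2
  have e : (fun y => ∑ i, b.coord i (f y) • b i) = f := by
    funext y
    exact b.sum_repr (f y)
  rwa [e] at h

end

lemma vfDiffAt_frame_const (v : E) (x : N) : VFDiffAt (fun y => frame y v) x :=
  vfDiffAt_frame mdifferentiableAt_const

variable (E N) in
/-- The bracket of the Lie algebra of `N`. -/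
def lieBr : E →ₗ[ℝ] E →ₗ[ℝ] E :=
  LinearMap.mk₂ ℝ (fun v w => vfBracket (fun y : N => frame y v) (fun y => frame y w) 1)
    (fun v v' w => by
      simp only [map_add]
      exact vfBracket_add_left (vfDiffAt_frame_const v 1) (vfDiffAt_frame_const v' 1))
    (fun c v w => by
      simp only [map_smul]
      rw [vfBracket_smul_left mdifferentiableAt_const (vfDiffAt_frame_const v 1), tder_const]
      simp)
    (fun v w w' => by
      simp only [map_add]
      exact vfBracket_add_right (vfDiffAt_frame_const w 1) (vfDiffAt_frame_const w' 1))
    (fun c v w => by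
      simp only [map_smul]
      rw [vfBracket_smul_right mdifferentiableAt_const (vfDiffAt_frame_const w 1), tder_const]
      simp)

lemma lieBr_swap (v w : E) : lieBr E N v w = -lieBr E N w v := vfBracket_swap _ _ _

lemma vfBracket_frame_const (v w : E) (x : N) :
    vfBracket (fun y : N => frame y v) (fun y => frame y w) x = frame x (lieBr E N v w) := by
  have : LieGroup 𝓘(ℝ, E) (minSmoothness ℝ 3) N := lieGroup_minSmoothness
  have : CompleteSpace E := FiniteDimensional.complete ℝ E
  have h := mulInvariantVector_mlieBracket (I := 𝓘(ℝ, E)) (G := N) v w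
  exact (congrFun h x).symm

lemma tder_smul_const {φ : N → ℝ} {x : N} (hφ : MDifferentiableAt 𝓘(ℝ, E) 𝓘(ℝ, ℝ) φ x) (w : W)
    (v : E) : tder (fun y => φ y • w) x v = tder φ x v • w := by
  have := tder_clm_comp ((ContinuousLinearMap.id ℝ ℝ).smulRight w) hφ
  exact congrArg (fun A : E →L[ℝ] W => A v) this

/-- The bracket of vector fields in the left invariant frame. -/
theorem vfBracket_frame {f h : N → E} {x : N} (hf : MDifferentiableAt 𝓘(ℝ, E) 𝓘(ℝ, E) f x)
    (hh : MDifferentiableAt 𝓘(ℝ, E) 𝓘(ℝ, E) h x) :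
    vfBracket (fun y => frame y (f y)) (fun y => frame y (h y)) x =
      frame x (tder h x (frame x (f x)) - tder f x (frame x (h x)) + lieBr E N (f x) (h x)) := by
  -- The coefficients are freed one argument at a time: the first field is still left-invariant
  -- here.
  have step (v : E) : vfBracket (fun y => frame y v) (fun y => frame y (h y)) x =
      frame x (tder h x (frame x v) + lieBr E N v (h x)) := by
    refine mdifferentiableAt_induction (P := fun h =>
      vfBracket (fun y => frame y v) (fun y => frame y (h y)) x =
      frame x (tder h x (frame x v) + lieBr E N v (h x))) ?_ ?_ hh
    · intro f g hf hg h1 h2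
      simp only [map_add]
      rw [vfBracket_add_right (vfDiffAt_frame hf) (vfDiffAt_frame hg), h1, h2, tder_add hf hg]
      simp only [_root_.add_apply, map_add]
      abel
    · intro φ w hφ
      simp only [map_smul]
      rw [vfBracket_smul_right hφ (vfDiffAt_frame_const w x), vfBracket_frame_const,
        tder_smul_const hφ]
      simp
  refine mdifferentiableAt_induction (P := fun f =>
      vfBracket (fun y => frame y (f y)) (fun y => frame y (h y)) x =
      frame x (tder h x (frame x (f x)) - tder f x (frame x (h x)) + lieBr E N (f x) (h x))) ?_ ?_ hf
  · intro f g hf hg h1 h2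
    simp only [map_add]
    rw [vfBracket_add_left (vfDiffAt_frame hf) (vfDiffAt_frame hg), h1, h2, tder_add hf hg]
    simp only [_root_.add_apply, map_add, map_sub, LinearMap.add_apply]
    abel
  · intro φ w hφ
    simp only [map_smul]
    rw [vfBracket_smul_left hφ (vfDiffAt_frame_const w x), step, tder_smul_const hφ]
    simp only [map_add, map_smul, map_sub, LinearMap.smul_apply, smul_add]
    abel

/-- The Maurer-Cartan equation. -/
theorem maurerCartan_vfBracket {X Y : N → E} {x : N} (hX : VFDiffAt X x) (hY : VFDiffAt Y x) :
    maurerCartan x (vfBracket X Y x) =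
      tder (fun y => maurerCartan y (Y y)) x (X x) - tder (fun y => maurerCartan y (X y)) x (Y x)
        + lieBr E N (maurerCartan x (X x)) (maurerCartan x (Y x)) := by
  have h := vfBracket_frame (mdifferentiableAt_maurerCartan hX) (mdifferentiableAt_maurerCartan hY)
  simp only [frame_maurerCartan] at h
  have e : ∀ X : N → E, (fun y => X y) = X := fun _ => rfl
  rw [h, maurerCartan_frame]

end LieGroup

/-! ### The Levi-Civita product of a Lie algebra with a scalar product. -/

section Koszul

variable {V : Type*} [AddCommGroup V] [Module ℝ V]

/-- A symmetric, nondegenerate bilinear form. -/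
structure IsScalarProduct (B : V →ₗ[ℝ] V →ₗ[ℝ] ℝ) : Prop where
  symm (u v : V) : B u v = B v u
  nondegenerate (u : V) (h : ∀ v, B u v = 0) : u = 0

/-- `pr` is the Levi-Civita product of the bracket `br` and the scalar product `B`. -/
def IsKoszul (B : V →ₗ[ℝ] V →ₗ[ℝ] ℝ) (br pr : V →ₗ[ℝ] V →ₗ[ℝ] V) : Prop :=
  ∀ u v w, 2 * B (pr u v) w = B (br u v) w - B (br v w) u + B (br w u) v

/-- The curvature of a product, in the sign convention of `IsCurvatureTensor`: the linear map
`w ↦ R(u, w) v`. -/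
def curv (br pr : V →ₗ[ℝ] V →ₗ[ℝ] V) (u v : V) : V →ₗ[ℝ] V :=
  (pr.flip v) ∘ₗ (br u) - (pr u) ∘ₗ (pr.flip v) + pr.flip (pr u v)

lemma curv_apply (br pr : V →ₗ[ℝ] V →ₗ[ℝ] V) (u v w : V) :
    curv br pr u v w = pr (br u w) v - pr u (pr w v) + pr w (pr u v) := rfl

variable {B : V →ₗ[ℝ] V →ₗ[ℝ] ℝ} {br pr : V →ₗ[ℝ] V →ₗ[ℝ] V}

lemma IsScalarProduct.eq_of_forall (hB : IsScalarProduct B) {u u' : V}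
    (h : ∀ v, B u v = B u' v) : u = u' :=
  sub_eq_zero.1 (hB.nondegenerate _ fun v => by rw [map_sub, LinearMap.sub_apply, h, sub_self])

/-- The fundamental lemma, uniqueness. -/
lemma IsKoszul.eq_of_torsion_of_metric (hB : IsScalarProduct B) (h : IsKoszul B br pr)
    {c : V → V → V} (ht : ∀ u v, c u v - c v u = br u v)
    (hm : ∀ u v w, B (c u v) w + B v (c u w) = 0) (u v : V) : c u v = pr u v := by
  refine hB.eq_of_forall fun w => ?_
  have := h u v w
  rw [← ht u v, ← ht v w, ← ht w u] at this
  simp only [map_sub, LinearMap.sub_apply] at this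
  have h1 := hm u v w
  have h2 := hm v w u
  have h3 := hm w u v
  rw [hB.symm v] at h1
  rw [hB.symm w] at h2
  rw [hB.symm u] at h3
  linarith

lemma IsKoszul.torsion (hB : IsScalarProduct B) (hbr : ∀ u v, br u v = -br v u)
    (h : IsKoszul B br pr) (u v : V) : pr u v - pr v u = br u v := by
  refine hB.eq_of_forall fun w => ?_
  have h1 := h u v w
  have h2 := h v u w
  rw [hbr v u, hbr u w, hbr w v] at h2
  simp only [map_neg, LinearMap.neg_apply] at h2
  rw [map_sub, LinearMap.sub_apply]
  linarith

lemma IsKoszul.metric (hB : IsScalarProduct B) (hbr : ∀ u v, br u v = -br v u)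
    (h : IsKoszul B br pr) (u v w : V) : B (pr u v) w + B v (pr u w) = 0 := by
  have h1 := h u v w
  have h2 := h u w v
  rw [hbr u w, hbr w v, hbr v u] at h2
  simp only [map_neg, LinearMap.neg_apply] at h2
  rw [hB.symm v]
  linarith

/-- The fundamental lemma, existence. -/
lemma exists_isKoszul [FiniteDimensional ℝ V] (hB : IsScalarProduct B) (br : V →ₗ[ℝ] V →ₗ[ℝ] V) :
    ∃ pr : V →ₗ[ℝ] V →ₗ[ℝ] V, IsKoszul B br pr := by
  have hinj : Function.Injective B := by
    rw [injective_iff_map_eq_zero]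
    exact fun u hu => hB.nondegenerate u fun v => by rw [hu, LinearMap.zero_apply]
  let e : V ≃ₗ[ℝ] (V →ₗ[ℝ] ℝ) :=
    LinearMap.linearEquivOfInjective B hinj Subspace.dual_finrank_eq.symm
  have he (f : V →ₗ[ℝ] ℝ) (v : V) : B (e.symm f) v = f v := by
    change e (e.symm f) v = f v
    rw [LinearEquiv.apply_symm_apply]
  -- `F u v` is half of the right-hand side of the Koszul identity, as a linear form in `w`;
  -- nondegeneracy of `B` represents it by a vector.
  let F : V →ₗ[ℝ] V →ₗ[ℝ] (V →ₗ[ℝ] ℝ) :=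
    LinearMap.mk₂ ℝ (fun u v => (1 / 2 : ℝ) • (B (br u v) - (B.flip u) ∘ₗ br v + (B.flip v) ∘ₗ br.flip u))
      (fun u u' v => by ext w; simp; ring) (fun c u v => by ext w; simp; ring)
      (fun u v v' => by ext w; simp; ring) (fun c u v => by ext w; simp; ring)
  refine ⟨F.compr₂ e.symm.toLinearMap, fun u v w => ?_⟩
  change 2 * B (e.symm (F u v)) w = _
  rw [he]
  simp [F]
  ring

end Koszul

/-! ### Ricci flatness of a left-invariant metric read on the Lie algebra. -/

section LieGroup

variable {E : Type*} [NormedAddCommGroup E] [NormedSpace ℝ E] [FiniteDimensional ℝ E]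
  {N : Type*} [TopologicalSpace N] [ChartedSpace E N] [Group N] [LieGroup 𝓘(ℝ, E) ∞ N]
  {W : Type*} [NormedAddCommGroup W] [NormedSpace ℝ W]

/-- A bilinear map on a finite dimensional space, as a continuous bilinear map. -/
def toBilinCLM (f : E →ₗ[ℝ] E →ₗ[ℝ] W) : E →L[ℝ] E →L[ℝ] W :=
  LinearMap.toContinuousLinearMap
    ((LinearMap.toContinuousLinearMap (𝕜 := ℝ) (E := E) (F' := W)).toLinearMap ∘ₗ f)

@[simp] lemma toBilinCLM_apply (f : E →ₗ[ℝ] E →ₗ[ℝ] W) (u v : E) : toBilinCLM f u v = f u v := rfl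

/-- The scalar product defined by a metric on the Lie algebra. -/
def metricAtOne (g : LorentzianMetric E N) : E →ₗ[ℝ] E →ₗ[ℝ] ℝ :=
  LinearMap.mk₂ ℝ (fun u v => g.inner 1 u v)
    (fun u u' v => by
      exact congrArg (fun A : E →L[ℝ] ℝ => A v) ((g.inner 1).map_add u u'))
    (fun c u v => congrArg (fun A : E →L[ℝ] ℝ => A v) ((g.inner 1).map_smul c u))
    (fun u v v' => (g.inner 1 u).map_add v v')
    (fun c u v => (g.inner 1 u).map_smul c v)

lemma metricAtOne_isScalarProduct (g : LorentzianMetric E N) :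
    IsScalarProduct (metricAtOne g) where
  symm u v := g.symm 1 u v
  nondegenerate u h := by
    obtain ⟨m, b, hb⟩ := g.lorentzian 1
    let b' : Module.Basis (Fin (m + 1)) ℝ E := b
    have hb' : ∀ i j, metricAtOne g (b' i) (b' j) =
      if i = j then (if i = 0 then -1 else 1) else 0 := hb
    refine b'.ext_elem fun i => ?_
    have h1 := h (b' i)
    rw [← b'.sum_repr u] at h1
    simp only [map_sum, map_smul, LinearMap.sum_apply, LinearMap.smul_apply, hb', smul_eq_mul,
      mul_ite, mul_zero, Finset.sum_ite_eq', Finset.mem_univ, if_true] at h1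
    rw [map_zero, Finsupp.zero_apply]
    split_ifs at h1 <;> linarith

/-- The metric, as a function of vectors of the model space. -/
def innerVF (g : LorentzianMetric E N) (x : N) (u v : E) : ℝ := g.inner x u v

/-- The left invariant vector field defined by `v`. -/
abbrev invVF (v : E) : N → E := fun y => frame y v

lemma inner_eq_metricAtOne {g : LorentzianMetric E N} (hg : IsLeftInvariant g) (x : N) (u v : E) :
    innerVF g x u v = metricAtOne g (maurerCartan x u) (maurerCartan x v) := by
  have h := hg x⁻¹ x u v
  change _ = innerVF g x u v at h
  have key : ∀ y : N, y = 1 → ∀ a b : E, innerVF g y a b = metricAtOne g a b := by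
    rintro y rfl a b
    rfl
  rw [← h]
  exact key _ (inv_mul_cancel x) _ _

lemma tder_const_apply {M : Type*} [TopologicalSpace M] [ChartedSpace E M] (c : W) (x : M) (v : E) :
    tder (fun _ : M => c) x v = 0 :=
  congrArg (fun A : E →L[ℝ] W => A v) (mfderiv_const)

section Necessity

variable {g : LorentzianMetric E N} (hg : IsLeftInvariant g) {cov : AffineConnection E N}
  (hcov : IsLeviCivita g cov)

/-- The covariant derivative of vector fields given as functions to `E`. -/
def covVF (cov : AffineConnection E N) (Y : N → E) (x : N) (u : E) : E := cov Y x u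

include hg hcov in
-- The scalar product of two left-invariant fields is constant, so at each point metric
-- compatibility becomes skewness of the product read in the frame. Together with vanishing torsion,
-- the uniqueness half of the fundamental lemma identifies it with `pr`, whichever Levi-Civita
-- connection was given.
lemma covVF_frame {pr : E →ₗ[ℝ] E →ₗ[ℝ] E}
    (hpr : IsKoszul (metricAtOne g) (lieBr E N) pr) (u v : E) (x : N) :
    covVF cov (fun y => frame y v) x (frame x u) = frame x (pr u v) := by
  let c (u v : E) : E := maurerCartan x (covVF cov (fun y => frame y v) x (frame x u))
  have hc : c u v = pr u v := by
    refine hpr.eq_of_torsion_of_metric (metricAtOne_isScalarProduct g) ?_ ?_ u v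
    · intro u v
      have h := hcov.torsion_free (invVF (N := N) u) (invVF (N := N) v) x
        (vfDiffAt_frame_const u x) (vfDiffAt_frame_const v x)
      have h' : covVF cov (fun y => frame y v) x (frame x u) -
          covVF cov (fun y => frame y u) x (frame x v) =
          vfBracket (fun y : N => frame y u) (fun y => frame y v) x := h
      rw [vfBracket_frame_const] at h'
      simp only [c]
      rw [← map_sub, h', maurerCartan_frame]
    · intro u v w
      have h := hcov.metric_compatible (invVF (N := N) v) (invVF (N := N) w) x
        (vfDiffAt_frame_const v x) (vfDiffAt_frame_const w x) (invVF (E := E) (N := N) u x)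
      have h' : tder (fun y : N => innerVF g y (frame y v) (frame y w)) x (frame x u) =
        innerVF g x (covVF cov (fun y => frame y v) x (frame x u)) (frame x w) +
        innerVF g x (frame x v) (covVF cov (fun y => frame y w) x (frame x u)) := h
      rw [inner_eq_metricAtOne hg, inner_eq_metricAtOne hg] at h'
      have e : (fun y : N => innerVF g y (frame y v) (frame y w)) =
          fun _ => metricAtOne g v w := by
        funext y
        rw [inner_eq_metricAtOne hg]
        simp
      rw [e, tder_const_apply] at h'
      simpa [c] using h'.symm
  rw [← hc]
  simp [c]

include hg in
-- Left-invariant fields are smooth, and their covariant derivatives along each other are again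
-- left-invariant; testing the curvature on them at `1` therefore yields `curv`.
theorem trace_curv_eq_zero_of_isRicciFlat (hflat : IsRicciFlat g) {pr : E →ₗ[ℝ] E →ₗ[ℝ] E}
    (hpr : IsKoszul (metricAtOne g) (lieBr E N) pr) (u v : E) :
    LinearMap.trace ℝ E (curv (lieBr E N) pr u v) = 0 := by
  obtain ⟨cov, hcov, R, hR, hric⟩ := hflat
  have hE' (v : E) (x : N) : VFContAt ⊤ (fun y : N => frame y v) x := vfContAt_frame contMDiffAt_const
  let R' : E →ₗ[ℝ] E →ₗ[ℝ] E →ₗ[ℝ] E := R 1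
  have hw (w : E) : R' u w v = curv (lieBr E N) pr u v w := by
    have h := hR (invVF (N := N) u) (invVF (N := N) w) (invVF (N := N) v)
      (fun x => hE' u x) (fun x => hE' w x) (fun x => hE' v x) 1
    have h' : R' (frame (1 : N) u) (frame (1 : N) w) (frame (1 : N) v) =
      covVF cov (fun y => frame y v) 1
        (vfBracket (fun y : N => frame y u) (fun y => frame y w) 1) -
      covVF cov (fun y => covVF cov (fun y => frame y v) y (frame y w)) 1 (frame (1 : N) u) +
      covVF cov (fun y => covVF cov (fun y => frame y v) y (frame y u)) 1 (frame (1 : N) w) := h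
    rw [frame_one, frame_one, frame_one] at h'
    have e (w : E) : (fun y : N => covVF cov (fun y => frame y v) y (frame y w)) =
        fun y => frame y (pr w v) := by
      funext y
      exact covVF_frame hg hcov hpr w v y
    rw [h', e, e, vfBracket_frame_const, covVF_frame hg hcov hpr]
    have h2 := covVF_frame hg hcov hpr u (pr w v) 1
    have h3 := covVF_frame hg hcov hpr w (pr u v) 1
    simp only [frame_one] at h2 h3 ⊢
    rw [h2, h3, curv_apply]
  have h := hric 1 u v
  have e : (R' u).flip v = curv (lieBr E N) pr u v := LinearMap.ext hw
  rw [← e]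
  exact h

end Necessity

section Sufficiency

variable {g : LorentzianMetric E N} {pr : E →ₗ[ℝ] E →ₗ[ℝ] E}

/-- The covariant derivative of a vector field in the left invariant frame, defined by the product
`pr` of left invariant vector fields. -/
def frameCov (pr : E →ₗ[ℝ] E →ₗ[ℝ] E) (Y : N → E) (x : N) : E →L[ℝ] E :=
  (frame x).comp (tder (fun y => maurerCartan y (Y y)) x +
    ((toBilinCLM pr).flip (maurerCartan x (Y x))).comp (maurerCartan x))

lemma frameCov_apply (pr : E →ₗ[ℝ] E →ₗ[ℝ] E) (Y : N → E) (x : N) (u : E) :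
    frameCov pr Y x u = frame x (tder (fun y => maurerCartan y (Y y)) x u +
      pr (maurerCartan x u) (maurerCartan x (Y x))) := rfl

lemma maurerCartan_frameCov (pr : E →ₗ[ℝ] E →ₗ[ℝ] E) (Y : N → E) (x : N) (u : E) :
    maurerCartan x (frameCov pr Y x u) = tder (fun y => maurerCartan y (Y y)) x u +
      pr (maurerCartan x u) (maurerCartan x (Y x)) := by
  rw [frameCov_apply, maurerCartan_frame]

lemma frameCov_add {Y Z : N → E} {x : N} (hY : VFDiffAt Y x) (hZ : VFDiffAt Z x) :
    frameCov pr (fun y => Y y + Z y) x = frameCov pr Y x + frameCov pr Z x := by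
  ext u
  simp only [_root_.add_apply, frameCov_apply, map_add]
  rw [tder_add (mdifferentiableAt_maurerCartan hY) (mdifferentiableAt_maurerCartan hZ)]
  simp only [_root_.add_apply, map_add]
  abel

lemma frameCov_smul {Y : N → E} {φ : N → ℝ} {x : N} (hY : VFDiffAt Y x)
    (hφ : MDifferentiableAt 𝓘(ℝ, E) 𝓘(ℝ, ℝ) φ x) :
    frameCov pr (fun y => φ y • Y y) x = φ x • frameCov pr Y x + (tder φ x).smulRight (Y x) := by
  ext u
  simp only [_root_.add_apply, _root_.smul_apply, ContinuousLinearMap.smulRight_apply,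
    frameCov_apply, map_smul]
  have h := tder_bilin (ContinuousLinearMap.lsmul ℝ ℝ) hφ (mdifferentiableAt_maurerCartan hY) u
  simp only [ContinuousLinearMap.lsmul_apply] at h
  rw [h]
  simp only [map_add, map_smul, frame_maurerCartan]
  module

/-- `frameCov` as an affine connection. -/
def frameConnection (N : Type*) [TopologicalSpace N] [ChartedSpace E N] [Group N]
    [LieGroup 𝓘(ℝ, E) ∞ N] (pr : E →ₗ[ℝ] E →ₗ[ℝ] E) : AffineConnection E N where
  toFun Y := frameCov pr Y
  isCovariantDerivativeOnUniv :=
    { add := fun hY hZ _ => frameCov_add hY hZ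
      leibniz := fun hY hφ _ => frameCov_smul hY hφ }

lemma mdifferentiableAt_of_cMDiff {X : N → E} {x : N} (hX : VFContAt ⊤ X x) : VFDiffAt X x :=
  ContMDiffAt.mdifferentiableAt hX (by simp)

/-- In the frame, torsion-freeness is the Maurer-Cartan equation plus the torsion identity of `pr`.
Metric compatibility is the product rule for the constant form `metricAtOne g` plus skewness of
`pr`. -/
lemma frameConnection_isLeviCivita (hg : IsLeftInvariant g)
    (hpr : IsKoszul (metricAtOne g) (lieBr E N) pr) :
    IsLeviCivita g (frameConnection N pr) where
  torsion_free X Y x hX hY := by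
    have h : ∀ X Y : N → E, VFDiffAt X x → VFDiffAt Y x →
        frameCov pr Y x (X x) - frameCov pr X x (Y x) = vfBracket X Y x := by
      intro X Y hX hY
      have h1 := maurerCartan_vfBracket hX hY
      rw [← hpr.torsion (metricAtOne_isScalarProduct g) lieBr_swap] at h1
      rw [← frame_maurerCartan x (vfBracket X Y x), h1, frameCov_apply, frameCov_apply, ← map_sub]
      congr 1
      abel
    exact h X Y hX hY
  metric_compatible Y Z x hY hZ u := by
    have h : ∀ (Y Z : N → E) (u : E), VFDiffAt Y x → VFDiffAt Z x →
        tder (fun y => innerVF g y (Y y) (Z y)) x u =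
          innerVF g x (frameCov pr Y x u) (Z x) + innerVF g x (Y x) (frameCov pr Z x u) := by
      intro Y Z u hY hZ
      simp only [inner_eq_metricAtOne hg, maurerCartan_frameCov]
      have h1 := tder_bilin (toBilinCLM (metricAtOne g)) (mdifferentiableAt_maurerCartan hY)
        (mdifferentiableAt_maurerCartan hZ) u
      simp only [toBilinCLM_apply] at h1
      rw [h1]
      have h2 := hpr.metric (metricAtOne_isScalarProduct g) lieBr_swap (maurerCartan x u)
        (maurerCartan x (Y x)) (maurerCartan x (Z x))
      simp only [map_add, LinearMap.add_apply]
      linarith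
    exact h Y Z u hY hZ

variable (N) in
/-- The curvature tensor of the connection `frameConnection N pr`. -/
def frameCurv (pr : E →ₗ[ℝ] E →ₗ[ℝ] E) (x : N) : E →ₗ[ℝ] E →ₗ[ℝ] E →ₗ[ℝ] E :=
  LinearMap.mk₂ ℝ (fun u w => (frame x).toLinearMap ∘ₗ
      (pr (lieBr E N (maurerCartan x u) (maurerCartan x w)) - pr (maurerCartan x u) ∘ₗ
        pr (maurerCartan x w) + pr (maurerCartan x w) ∘ₗ pr (maurerCartan x u)) ∘ₗ
          (maurerCartan x).toLinearMap)
    (fun u u' v => by ext w; simp; abel) (fun c u v => by ext w; simp [smul_sub, smul_add])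
    (fun u v v' => by ext w; simp; abel) (fun c u v => by ext w; simp [smul_sub, smul_add])

lemma frameCurv_apply (pr : E →ₗ[ℝ] E →ₗ[ℝ] E) (x : N) (u w v : E) :
    frameCurv N pr x u w v =
      frame x (curv (lieBr E N) pr (maurerCartan x u) (maurerCartan x v) (maurerCartan x w)) := rfl

/-- Second derivatives of the components of Z are absorbed by [X,Y], and the mixed first-order terms
are symmetric in X and Y. The derivatives of the components of X and Y drop out by the Maurer-Cartan
equation, so only the algebraic curvature remains. -/
lemma frameCurv_vf {X Y Z : N → E} (hX : ∀ x, VFContAt ⊤ X x) (hY : ∀ x, VFContAt ⊤ Y x)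
    (hZ : ∀ x, VFContAt ⊤ Z x) (x : N) :
    frameCurv N pr x (X x) (Y x) (Z x) =
      frameCov pr Z x (vfBracket X Y x) - frameCov pr (fun y => frameCov pr Z y (Y y)) x (X x)
        + frameCov pr (fun y => frameCov pr Z y (X y)) x (Y x) := by
  have hX' := fun x => mdifferentiableAt_of_cMDiff (hX x)
  have hY' := fun x => mdifferentiableAt_of_cMDiff (hY x)
  have hZ' := fun x => mdifferentiableAt_of_cMDiff (hZ x)
  have hFZ : ContMDiffAt 𝓘(ℝ, E) 𝓘(ℝ, E) 2 (fun y => maurerCartan y (Z y)) x :=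
    (contMDiffAt_maurerCartan (hZ x)).of_le (by norm_cast)
  have key : ∀ X Y : N → E, VFDiffAt X x → VFDiffAt Y x →
      frameCov pr (fun y => frameCov pr Z y (Y y)) x (X x) =
      frame x (tder (fun y => tder (fun y => maurerCartan y (Z y)) y (Y y)) x (X x)
        + pr (maurerCartan x (Y x)) (tder (fun y => maurerCartan y (Z y)) x (X x))
        + pr (tder (fun y => maurerCartan y (Y y)) x (X x)) (maurerCartan x (Z x))
        + pr (maurerCartan x (X x)) (tder (fun y => maurerCartan y (Z y)) x (Y x))
        + pr (maurerCartan x (X x)) (pr (maurerCartan x (Y x)) (maurerCartan x (Z x)))) := by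
    intro X Y hX hY
    have hb := tder_bilin (toBilinCLM pr) (mdifferentiableAt_maurerCartan hY)
      (mdifferentiableAt_maurerCartan (hZ' x)) (X x)
    have hbd := mdifferentiableAt_bilin (toBilinCLM pr) (mdifferentiableAt_maurerCartan hY)
      (mdifferentiableAt_maurerCartan (hZ' x))
    simp only [toBilinCLM_apply] at hb hbd
    rw [frameCov_apply]
    simp only [maurerCartan_frameCov]
    rw [tder_add (mdifferentiableAt_tder_apply hFZ hY) hbd, _root_.add_apply, hb]
    simp only [map_add]
    abel
  rw [key X Y (hX' x) (hY' x), key Y X (hY' x) (hX' x), frameCov_apply,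
    tder_vfBracket hFZ (hX' x) (hY' x), maurerCartan_vfBracket (hX' x) (hY' x), frameCurv_apply,
    curv_apply]
  simp only [map_add, map_sub, LinearMap.add_apply, LinearMap.sub_apply]
  abel

theorem isRicciFlat_of_trace_curv_eq_zero (hg : IsLeftInvariant g)
    (hpr : IsKoszul (metricAtOne g) (lieBr E N) pr)
    (h : ∀ u v, LinearMap.trace ℝ E (curv (lieBr E N) pr u v) = 0) : IsRicciFlat g := by
  refine ⟨frameConnection N pr, frameConnection_isLeviCivita hg hpr, frameCurv N pr,
    fun X Y Z hX hY hZ x => frameCurv_vf (fun x => hX x) (fun x => hY x) (fun x => hZ x) x,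
    fun x u v => ?_⟩
  have key : ∀ u v : E, LinearMap.trace ℝ E ((frameCurv N pr x u).flip v) = 0 := by
    intro u v
    have e : (frameCurv N pr x u).flip v = ((frame x).toLinearMap ∘ₗ
      curv (lieBr E N) pr (maurerCartan x u) (maurerCartan x v)) ∘ₗ
        (maurerCartan x).toLinearMap := rfl
    -- The Ricci endomorphism at `x` is conjugate, by the frame, to the one on the Lie algebra; the
    -- trace does not see the conjugation.
    have e2 : (maurerCartan (E := E) x).toLinearMap ∘ₗ (frame x).toLinearMap = LinearMap.id :=
      LinearMap.ext fun v => maurerCartan_frame x v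
    rw [e, LinearMap.trace_comp_comm', ← LinearMap.comp_assoc, e2, LinearMap.id_comp, h]
  exact key u v

end Sufficiency

/-- Ricci flatness is a property of the metric Lie algebra. -/
theorem isRicciFlat_iff {g : LorentzianMetric E N} (hg : IsLeftInvariant g)
    {pr : E →ₗ[ℝ] E →ₗ[ℝ] E} (hpr : IsKoszul (metricAtOne g) (lieBr E N) pr) :
    IsRicciFlat g ↔ ∀ u v, LinearMap.trace ℝ E (curv (lieBr E N) pr u v) = 0 :=
  ⟨fun h u v => trace_curv_eq_zero_of_isRicciFlat hg h hpr u v,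
    isRicciFlat_of_trace_curv_eq_zero hg hpr⟩

end LieGroup

/-! ### Closed vector-valued 1-forms and the Poincaré lemma. -/

section ClosedForms

variable {E : Type*} [NormedAddCommGroup E] [NormedSpace ℝ E] [FiniteDimensional ℝ E]
  {M : Type*} [TopologicalSpace M] [ChartedSpace E M] [IsManifold 𝓘(ℝ, E) ∞ M]
  {W : Type*} [NormedAddCommGroup W] [NormedSpace ℝ W]

/-- The coordinate vector field with constant value `a` in the chart around `x₀`. -/
def coordField (x₀ : M) (a : E) (y : M) : E := chartSymmDer x₀ (extChartAt 𝓘(ℝ, E) x₀ y) a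

lemma tder_extChartAt_comp (x₀ : M) {y : M} (hy : y ∈ (extChartAt 𝓘(ℝ, E) x₀).source) :
    (tder (extChartAt 𝓘(ℝ, E) x₀) y).comp (chartSymmDer x₀ (extChartAt 𝓘(ℝ, E) x₀ y)) =
      ContinuousLinearMap.id ℝ E := by
  have : IsManifold 𝓘(ℝ, E) 1 M := IsManifold.of_le (n := ∞) (by simp)
  have h := mfderiv_extChartAt_comp_mfderivWithin_extChartAt_symm (I := 𝓘(ℝ, E)) (x := x₀)
    ((extChartAt 𝓘(ℝ, E) x₀).map_source hy)
  have e := (extChartAt 𝓘(ℝ, E) x₀).left_inv hy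
  have h' : (tder (extChartAt 𝓘(ℝ, E) x₀) ((extChartAt 𝓘(ℝ, E) x₀).symm
    (extChartAt 𝓘(ℝ, E) x₀ y))).comp (chartSymmDer x₀ (extChartAt 𝓘(ℝ, E) x₀ y)) =
      ContinuousLinearMap.id ℝ E := h
  rwa [e] at h'

lemma tder_extChartAt_coordField (x₀ : M) {y : M} (hy : y ∈ (extChartAt 𝓘(ℝ, E) x₀).source)
    (a : E) : tder (extChartAt 𝓘(ℝ, E) x₀) y (coordField x₀ a y) = a :=
  congrArg (fun L : E →L[ℝ] E => L a) (tder_extChartAt_comp x₀ hy)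

lemma tder_extChartAt_isInvertible (x₀ : M) {y : M}
    (hy : y ∈ (extChartAt 𝓘(ℝ, E) x₀).source) :
    (tder (extChartAt 𝓘(ℝ, E) x₀) y : E →L[ℝ] E).IsInvertible :=
  have : IsManifold 𝓘(ℝ, E) 1 M := IsManifold.of_le (n := ∞) (by simp)
  isInvertible_mfderiv_extChartAt hy

lemma contMDiffAt_extChartAt_source (x₀ : M) {y : M}
    (hy : y ∈ (extChartAt 𝓘(ℝ, E) x₀).source) :
    ContMDiffAt 𝓘(ℝ, E) 𝓘(ℝ, E) ∞ (extChartAt 𝓘(ℝ, E) x₀) y :=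
  contMDiffAt_extChartAt' (by simpa using hy)

/-- On the chart domain the coordinate field is the pullback of a constant field by the chart. -/
lemma vfContAt_coordField (x₀ : M) {y : M} (hy : y ∈ (extChartAt 𝓘(ℝ, E) x₀).source) (a : E) :
    VFContAt ⊤ (coordField x₀ a) y := by
  have : CompleteSpace E := FiniteDimensional.complete ℝ E
  have hV : ContMDiffAt 𝓘(ℝ, E) (𝓘(ℝ, E).prod 𝓘(ℝ, E)) ((⊤ : ℕ∞) : WithTop ℕ∞)
      (fun z : E => (TotalSpace.mk' E z a : TangentBundle 𝓘(ℝ, E) E))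
      (extChartAt 𝓘(ℝ, E) x₀ y) :=
    contMDiffAt_vectorSpace_iff_contDiffAt.2 contDiffAt_const
  have hi := tder_extChartAt_isInvertible x₀ hy
  have h := ContMDiffAt.mpullback_vectorField_preimage (I := 𝓘(ℝ, E)) (I' := 𝓘(ℝ, E))
    (V := fun _ : E => a) (m := ∞) (n := ∞)
    hV (contMDiffAt_extChartAt_source x₀ hy) hi le_rfl
  refine ContMDiffAt.congr_of_eventuallyEq h ?_
  filter_upwards [(isOpen_extChartAt_source x₀).mem_nhds hy] with z hz
  have : coordField x₀ a z = (tder (extChartAt 𝓘(ℝ, E) x₀) z).inverse a := by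
    obtain ⟨e, he⟩ := tder_extChartAt_isInvertible x₀ hz
    have h1 := tder_extChartAt_coordField x₀ hz a
    rw [← he] at h1 ⊢
    rw [ContinuousLinearMap.inverse_equiv]
    exact e.injective (by simpa using h1)
  exact congrArg (fun v : E => (TotalSpace.mk' E z v : TangentBundle 𝓘(ℝ, E) M)) this

lemma vfDiffAt_of_vfContAt {X : M → E} {x : M} (h : VFContAt ⊤ X x) : VFDiffAt X x :=
  ContMDiffAt.mdifferentiableAt h (by simp)

/-- The chart, taken as the test function in `tder_vfBracket`, has constant derivative along each
coordinate field; its own derivative is injective, so the bracket vanishes. -/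
lemma vfBracket_coordField (x₀ : M) {y : M} (hy : y ∈ (extChartAt 𝓘(ℝ, E) x₀).source) (a b : E) :
    vfBracket (coordField x₀ a) (coordField x₀ b) y = 0 := by
  have key : ∀ c d : E, tder (fun z => tder (extChartAt 𝓘(ℝ, E) x₀) z (coordField x₀ c z)) y d
      = 0 := by
    intro c d
    have : (fun z => tder (extChartAt 𝓘(ℝ, E) x₀) z (coordField x₀ c z)) =ᶠ[𝓝 y]
        fun _ => c := by
      filter_upwards [(isOpen_extChartAt_source x₀).mem_nhds hy] with z hz
      exact tder_extChartAt_coordField x₀ hz c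
    have h2 : tder (fun z => tder (extChartAt 𝓘(ℝ, E) x₀) z (coordField x₀ c z)) y =
        tder (E := E) (fun _ => c) y := this.mfderiv_eq
    rw [h2, tder_const, _root_.zero_apply]
  have h := tder_vfBracket (f := extChartAt 𝓘(ℝ, E) x₀)
    ((contMDiffAt_extChartAt_source x₀ hy).of_le (by norm_cast))
    (vfDiffAt_of_vfContAt (vfContAt_coordField x₀ hy a))
    (vfDiffAt_of_vfContAt (vfContAt_coordField x₀ hy b))
  rw [key, key, sub_zero] at h
  obtain ⟨e, he⟩ := tder_extChartAt_isInvertible x₀ hy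
  rw [← he] at h
  exact (map_eq_zero_iff e e.injective).1 h

/-- The 1-form `α` is smooth. -/
def IsSmoothForm (α : M → E →L[ℝ] W) : Prop :=
  ∀ (x : M) (X : M → E), VFContAt ⊤ X x → ContMDiffAt 𝓘(ℝ, E) 𝓘(ℝ, W) ∞ (fun y => α y (X y)) x

/-- The 1-form `α` is closed. -/
def IsClosedForm (α : M → E →L[ℝ] W) : Prop :=
  ∀ (x : M) (X Y : M → E), VFContAt ⊤ X x → VFContAt ⊤ Y x →
    tder (fun y => α y (Y y)) x (X x) - tder (fun y => α y (X y)) x (Y x) = α x (vfBracket X Y x)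

/-- The expression of a 1-form in the chart around `x₀`. -/
def chartForm (α : M → E →L[ℝ] W) (x₀ : M) (z : E) : E →L[ℝ] W :=
  (α ((extChartAt 𝓘(ℝ, E) x₀).symm z)).comp (chartSymmDer x₀ z)

lemma chartForm_apply {α : M → E →L[ℝ] W} (x₀ : M) (a : E) {z : E}
    (hz : z ∈ (extChartAt 𝓘(ℝ, E) x₀).target) :
    chartForm α x₀ z a = ((fun y => α y (coordField x₀ a y)) ∘ (extChartAt 𝓘(ℝ, E) x₀).symm) z := by
  simp only [chartForm, coordField, Function.comp_apply, ContinuousLinearMap.comp_apply]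
  rw [(extChartAt 𝓘(ℝ, E) x₀).right_inv hz]

lemma contDiffOn_chartForm {α : M → E →L[ℝ] W} (hα : IsSmoothForm α) (x₀ : M) :
    ContDiffOn ℝ ∞ (chartForm α x₀) (extChartAt 𝓘(ℝ, E) x₀).target := by
  rw [contDiffOn_clm_apply]
  intro a z hz
  have h1 := hα _ _ (vfContAt_coordField x₀ ((extChartAt 𝓘(ℝ, E) x₀).map_target hz) a)
  exact (contDiffAt_comp_symm (n := ⊤) hz h1).contDiffWithinAt.congr
    (fun w hw => chartForm_apply x₀ a hw) (chartForm_apply x₀ a hz)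

lemma fderiv_chartForm {α : M → E →L[ℝ] W} (hα : IsSmoothForm α) (x₀ : M) (a b : E) {z : E}
    (hz : z ∈ (extChartAt 𝓘(ℝ, E) x₀).target) :
    fderiv ℝ (chartForm α x₀) z a b =
      tder (fun y => α y (coordField x₀ b y)) ((extChartAt 𝓘(ℝ, E) x₀).symm z)
        (coordField x₀ a ((extChartAt 𝓘(ℝ, E) x₀).symm z)) := by
  have hn := (isOpen_extChartAt_target (I := 𝓘(ℝ, E)) x₀).mem_nhds hz
  have hd : DifferentiableAt ℝ (chartForm α x₀) z :=
    ((contDiffOn_chartForm hα x₀).contDiffAt hn).differentiableAt (by simp)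
  have h1 : HasFDerivAt (fun w => chartForm α x₀ w b) ((fderiv ℝ (chartForm α x₀) z).flip b) z := by
    simpa using! hd.hasFDerivAt.clm_apply (hasFDerivAt_const b z)
  have h2 := fderiv_comp_extChartAt_symm (f := fun y => α y (coordField x₀ b y)) x₀ hz
    ((hα _ _ (vfContAt_coordField x₀ ((extChartAt 𝓘(ℝ, E) x₀).map_target hz) b)).mdifferentiableAt
      (by simp))
  have h3 := h1.unique (h2.congr_of_eventuallyEq
    (Filter.eventually_of_mem hn fun w hw => chartForm_apply x₀ b hw))
  have h4 := congrArg (fun L : E →L[ℝ] W => L a) h3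
  simp only [ContinuousLinearMap.flip_apply, ContinuousLinearMap.comp_apply] at h4
  rw [h4, coordField, (extChartAt 𝓘(ℝ, E) x₀).right_inv hz]

/-- Closedness tested on commuting coordinate fields loses its bracket term, which is exactly the
symmetry needed for the Poincaré lemma on a ball. -/
lemma fderiv_chartForm_symm {α : M → E →L[ℝ] W} (hα : IsSmoothForm α) (hc : IsClosedForm α)
    (x₀ : M) (a b : E) {z : E} (hz : z ∈ (extChartAt 𝓘(ℝ, E) x₀).target) :
    fderiv ℝ (chartForm α x₀) z a b = fderiv ℝ (chartForm α x₀) z b a := by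
  have hy := (extChartAt 𝓘(ℝ, E) x₀).map_target hz
  rw [fderiv_chartForm hα x₀ a b hz, fderiv_chartForm hα x₀ b a hz, ← sub_eq_zero,
    hc _ _ _ (vfContAt_coordField x₀ hy a) (vfContAt_coordField x₀ hy b),
    vfBracket_coordField x₀ hy, map_zero]

lemma contDiffOn_of_hasFDerivAt {f : E → W} {A : E → E →L[ℝ] W} {s : Set E} (hs : IsOpen s)
    (hA : ContDiffOn ℝ ∞ A s) (hf : ∀ z ∈ s, HasFDerivAt f (A z) z) : ContDiffOn ℝ ∞ f s := by
  rw [contDiffOn_infty_iff_fderiv_of_isOpen hs]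
  exact ⟨fun z hz => (hf z hz).differentiableAt.differentiableWithinAt,
    hA.congr fun z hz => (hf z hz).fderiv⟩

/-- The Poincaré lemma. -/
lemma exists_local_primitive [CompleteSpace W] {α : M → E →L[ℝ] W} (hα : IsSmoothForm α)
    (hc : IsClosedForm α) (x₀ : M) :
    ∃ (U : Set M) (f : M → W), IsOpen U ∧ x₀ ∈ U ∧
      ∀ x ∈ U, ContMDiffAt 𝓘(ℝ, E) 𝓘(ℝ, W) ∞ f x ∧ tder f x = α x := by
  obtain ⟨ε, hε, hb⟩ := Metric.mem_nhds_iff.1 (extChartAt_target_mem_nhds_self (E := E) x₀)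
  obtain ⟨f₀, hf₀⟩ := (convex_ball (extChartAt 𝓘(ℝ, E) x₀ x₀) ε).exists_forall_hasFDerivAt_of_fderiv_symmetric
    Metric.isOpen_ball (((contDiffOn_chartForm hα x₀).differentiableOn (by simp)).mono hb)
    (fun z hz a b => fderiv_chartForm_symm hα hc x₀ a b (hb hz))
  have hs := contDiffOn_of_hasFDerivAt Metric.isOpen_ball ((contDiffOn_chartForm hα x₀).mono hb) hf₀
  refine ⟨(extChartAt 𝓘(ℝ, E) x₀).source ∩ extChartAt 𝓘(ℝ, E) x₀ ⁻¹' Metric.ball (extChartAt 𝓘(ℝ, E) x₀ x₀) ε,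
    f₀ ∘ extChartAt 𝓘(ℝ, E) x₀, isOpen_extChartAt_preimage' x₀ Metric.isOpen_ball,
    ⟨mem_extChartAt_source x₀, Metric.mem_ball_self hε⟩, ?_⟩
  rintro x ⟨hx, hxb⟩
  have hx' := (extChartAt 𝓘(ℝ, E) x₀).map_source hx
  have hev : (f₀ ∘ extChartAt 𝓘(ℝ, E) x₀) ∘ (extChartAt 𝓘(ℝ, E) x₀).symm
      =ᶠ[𝓝 (extChartAt 𝓘(ℝ, E) x₀ x)] f₀ := by
    filter_upwards [(isOpen_extChartAt_target (I := 𝓘(ℝ, E)) x₀).mem_nhds hx'] with z hz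
    simp only [Function.comp_apply]
    rw [(extChartAt 𝓘(ℝ, E) x₀).right_inv hz]
  have h1 : ContMDiffAt 𝓘(ℝ, E) 𝓘(ℝ, W) ∞ (f₀ ∘ extChartAt 𝓘(ℝ, E) x₀) x :=
    contMDiffAt_of_comp_symm (n := ⊤) hx
      ((hs.contDiffAt (Metric.isOpen_ball.mem_nhds hxb)).congr_of_eventuallyEq hev)
  refine ⟨h1, ?_⟩
  have h2 := fderiv_comp_extChartAt_symm (f := f₀ ∘ extChartAt 𝓘(ℝ, E) x₀) x₀ hx'
    (by rw [(extChartAt 𝓘(ℝ, E) x₀).left_inv hx]; exact h1.mdifferentiableAt (by simp))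
  have h3 := h2.unique ((hf₀ _ hxb).congr_of_eventuallyEq hev)
  rw [chartForm, (extChartAt 𝓘(ℝ, E) x₀).left_inv hx] at h3
  obtain ⟨e, he⟩ := chartSymmDer_isInvertible x₀ hx'
  rw [← he] at h3
  ext v
  have := congrArg (fun L : E →L[ℝ] W => L (e.symm v)) h3
  simpa using this

lemma eventually_eq_of_tder_eq_zero {f : M → W} {x₀ : M}
    (h : ∀ᶠ x in 𝓝 x₀, MDifferentiableAt 𝓘(ℝ, E) 𝓘(ℝ, W) f x ∧ tder (E := E) f x = 0) :
    ∀ᶠ x in 𝓝 x₀, f x = f x₀ := by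
  have h1 : ∀ᶠ z in 𝓝 (extChartAt 𝓘(ℝ, E) x₀ x₀),
      HasFDerivAt (f ∘ (extChartAt 𝓘(ℝ, E) x₀).symm) (0 : E →L[ℝ] W) z := by
    have h' := h
    rw [← extChartAt_to_inv (I := 𝓘(ℝ, E)) x₀] at h'
    have h2 := (continuousAt_extChartAt_symm (I := 𝓘(ℝ, E)) x₀).eventually h'
    filter_upwards [h2, extChartAt_target_mem_nhds_self (E := E) x₀] with z hz hzt
    have := fderiv_comp_extChartAt_symm x₀ hzt hz.1
    rwa [hz.2, ContinuousLinearMap.zero_comp] at this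
  obtain ⟨ε, hε, hb⟩ := Metric.mem_nhds_iff.1 h1
  have h3 : ∀ z ∈ Metric.ball (extChartAt 𝓘(ℝ, E) x₀ x₀) ε,
      (f ∘ (extChartAt 𝓘(ℝ, E) x₀).symm) z = f x₀ := by
    intro z hz
    have := (convex_ball (extChartAt 𝓘(ℝ, E) x₀ x₀) ε).is_const_of_fderivWithin_eq_zero (𝕜 := ℝ)
      (f := f ∘ (extChartAt 𝓘(ℝ, E) x₀).symm)
      (fun w hw => (hb hw).differentiableAt.differentiableWithinAt)
      (fun w hw => (hb hw).hasFDerivWithinAt.fderivWithin (Metric.isOpen_ball.uniqueDiffWithinAt hw))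
      hz (Metric.mem_ball_self hε)
    simpa using this
  filter_upwards [(isOpen_extChartAt_source (I := 𝓘(ℝ, E)) x₀).mem_nhds (mem_extChartAt_source x₀),
    (continuousAt_extChartAt (I := 𝓘(ℝ, E)) x₀).preimage_mem_nhds (Metric.ball_mem_nhds _ hε)] with x hx hx2
  have := h3 _ hx2
  rwa [Function.comp_apply, (extChartAt 𝓘(ℝ, E) x₀).left_inv hx] at this

lemma eq_of_tder_eq_zero [PreconnectedSpace M] {f : M → W}
    (hf : ∀ x, MDifferentiableAt 𝓘(ℝ, E) 𝓘(ℝ, W) f x) (h : ∀ x, tder (E := E) f x = 0) (x y : M) :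
    f x = f y := by
  have : IsLocallyConstant f := (IsLocallyConstant.iff_eventually_eq f).2 fun x =>
    eventually_eq_of_tder_eq_zero (Filter.Eventually.of_forall fun x => ⟨hf x, h x⟩)
  exact this.apply_eq_of_preconnectedSpace x y

end ClosedForms


/-! ### Closed 1-forms on a simply connected manifold are exact. -/

section Primitive

/-- The type `W` with the discrete topology. -/
def DiscreteCopy (W : Type*) : Type _ := W

instance (W : Type*) : TopologicalSpace (DiscreteCopy W) := ⊥

instance (W : Type*) : DiscreteTopology (DiscreteCopy W) := ⟨rfl⟩

/-- The covering of `M` whose points over `x` are the germs at `x` of the functions which differ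
from the `f i` by a constant. -/
def germCore {M W : Type*} [TopologicalSpace M] [AddCommGroup W] (U : M → Set M) (f : M → M → W)
    (hU : ∀ i, IsOpen (U i)) (hmem : ∀ i, i ∈ U i)
    (hf : ∀ i j, ∀ x ∈ U i ∩ U j, ∀ᶠ y in 𝓝 x, f i y - f j y = f i x - f j x) :
    FiberBundleCore M M (DiscreteCopy W) where
  baseSet := U
  isOpen_baseSet := hU
  indexAt := id
  mem_baseSet_at := hmem
  -- The coordinate `v` in the chart `i` stands for the germ of `f i + v`; the change of coordinate
  -- is locally constant by `hf`.
  coordChange i j x v := (show W from v) + (f i x - f j x)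
  coordChange_self i x _ v := by
    rw [sub_self]
    exact add_zero (show W from v)
  continuousOn_coordChange i j := by
    rintro ⟨x, v⟩ ⟨hx, -⟩
    refine ContinuousAt.continuousWithinAt ?_
    refine (continuousAt_const (Y := DiscreteCopy W) (y := ((show W from v) + (f i x - f j x) : W))).congr ?_
    have h1 : ∀ᶠ p : M × DiscreteCopy W in 𝓝 (x, v), f i p.1 - f j p.1 = f i x - f j x :=
      (continuousAt_fst (p := (x, v))).eventually (hf i j x hx)
    have h2 : ∀ᶠ p : M × DiscreteCopy W in 𝓝 (x, v), p.2 = v :=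
      (continuousAt_snd (p := (x, v))).eventually (p := fun w => w = v)
        (by rw [nhds_discrete]; exact Filter.eventually_pure.2 rfl)
    filter_upwards [h1, h2] with p hp hp2
    rw [hp, hp2]
  coordChange_comp i j k x _ v := by
    change (show W from v) + (f i x - f j x) + (f j x - f k x) = (show W from v) + (f i x - f k x)
    abel

/-- Simple connectedness lifts the identity of `M` to the covering of germs, and such a lift is a
coherent choice of the additive constants. -/
lemma exists_glue {M W : Type*} [TopologicalSpace M] [SimplyConnectedSpace M]
    [LocallyPathConnectedSpace M] [AddCommGroup W] (U : M → Set M) (f : M → M → W)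
    (hU : ∀ i, IsOpen (U i)) (hmem : ∀ i, i ∈ U i)
    (hf : ∀ i j, ∀ x ∈ U i ∩ U j, ∀ᶠ y in 𝓝 x, f i y - f j y = f i x - f j x) :
    ∃ F : M → W, ∀ i, ∀ᶠ y in 𝓝 i, F y - f i y = F i - f i i := by
  obtain ⟨x₀⟩ : Nonempty M := inferInstance
  let Z := germCore U f hU hmem hf
  have hcov : IsCoveringMap Z.proj := FiberBundle.isCoveringMap (F := DiscreteCopy W) (E := Z.Fiber)
  obtain ⟨s, ⟨-, hs⟩, -⟩ := hcov.existsUnique_continuousMap_lifts (ContinuousMap.id M) x₀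
    (⟨x₀, (0 : W)⟩ : Z.TotalSpace) rfl
  have hs' : ∀ y, (s y).1 = y := fun y => congrFun hs y
  let S : M → W := fun y => (s y).2
  -- Since `indexAt` is `id`, the coordinate `S y` is relative to `f y`; the sum is the value at `y`
  -- of the chosen germ.
  refine ⟨fun y => S y + f y y, fun i => ?_⟩
  have h1 : ContinuousAt (fun y => (Z.localTriv i (s y)).2) i := by
    refine continuousAt_snd.comp ?_
    refine ContinuousAt.comp (f := fun y => s y) (g := Z.localTriv i) ?_ s.continuous.continuousAt
    refine (Z.localTriv i).continuousAt ?_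
    rw [(Z.localTriv i).mem_source]
    change (s i).1 ∈ U i
    rw [hs']
    exact hmem i
  have h2 : ∀ y, (Z.localTriv i (s y)).2 = S y + (f y y - f i y) := by
    intro y
    change S y + (f (s y).1 (s y).1 - f i (s y).1) = _
    rw [hs']
  have h3 : ∀ᶠ y in 𝓝 i, (Z.localTriv i (s y)).2 = (Z.localTriv i (s i)).2 := by
    have h4 := ContinuousAt.tendsto h1
    rw [nhds_discrete (DiscreteCopy W)] at h4
    exact Filter.tendsto_pure.1 h4
  filter_upwards [h3] with y hy
  have hy' : S y + (f y y - f i y) = S i + (f i i - f i i) := by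
    rw [← h2, ← h2]
    exact hy
  rw [add_sub_assoc, add_sub_assoc, hy']

variable {E : Type*} [NormedAddCommGroup E] [NormedSpace ℝ E] [FiniteDimensional ℝ E]
  {M : Type*} [TopologicalSpace M] [ChartedSpace E M] [IsManifold 𝓘(ℝ, E) ∞ M]
  {W : Type*} [NormedAddCommGroup W] [NormedSpace ℝ W]

/-- A closed 1-form on a simply connected manifold is exact. -/
theorem exists_primitive [SimplyConnectedSpace M] [CompleteSpace W] {α : M → E →L[ℝ] W}
    (hα : IsSmoothForm α) (hc : IsClosedForm α) :
    ∃ F : M → W, ContMDiff 𝓘(ℝ, E) 𝓘(ℝ, W) ∞ F ∧ ∀ x, tder F x = α x := by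
  have : LocallyPathConnectedSpace M := ChartedSpace.locallyPathConnectedSpace E M
  choose U f hU hmem hf using exists_local_primitive hα hc
  obtain ⟨F, hF⟩ := exists_glue U f hU hmem (by
    rintro i j x ⟨hi, hj⟩
    refine eventually_eq_of_tder_eq_zero (E := E) (f := fun y => f i y - f j y) ?_
    filter_upwards [(hU i).mem_nhds hi, (hU j).mem_nhds hj] with y hyi hyj
    have h1 := ((hf i y hyi).1.mdifferentiableAt (by simp))
    have h2 := ((hf j y hyj).1.mdifferentiableAt (by simp))
    refine ⟨h1.sub h2, ?_⟩
    rw [tder_sub h1 h2, (hf i y hyi).2, (hf j y hyj).2, sub_self])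
  have key : ∀ x, F =ᶠ[𝓝 x] fun y => f x y + (F x - f x x) := by
    intro x
    filter_upwards [hF x] with y hy
    rw [← hy]; abel
  refine ⟨F, fun x => ?_, fun x => ?_⟩
  · exact ((hf x x (hmem x)).1.add contMDiffAt_const).congr_of_eventuallyEq (key x)
  · have h1 := ((hf x x (hmem x)).1.mdifferentiableAt (by simp))
    have h2 : tder (E := E) F x = tder (fun y => f x y + (F x - f x x)) x := (key x).mfderiv_eq
    rw [h2, tder_add h1 mdifferentiableAt_const, tder_const, add_zero, (hf x x (hmem x)).2]

end Primitive


/-! ### The inverse function theorem on manifolds. -/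

section InverseFunction

variable {E : Type*} [NormedAddCommGroup E] [NormedSpace ℝ E] [FiniteDimensional ℝ E]
  {M : Type*} [TopologicalSpace M] [ChartedSpace E M] [IsManifold 𝓘(ℝ, E) ∞ M]
  {W : Type*} [NormedAddCommGroup W] [NormedSpace ℝ W]

/-- The inverse function theorem. -/
lemma exists_local_inverse {f : M → W} {x : M} (hf : ContMDiffAt 𝓘(ℝ, E) 𝓘(ℝ, W) ∞ f x)
    (e : E ≃L[ℝ] W) (he : tder f x = (e : E →L[ℝ] W)) :
    Filter.map f (𝓝 x) = 𝓝 (f x) ∧ ∃ h : W → M, (∀ᶠ y in 𝓝 x, h (f y) = y) ∧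
      ContMDiffAt 𝓘(ℝ, W) 𝓘(ℝ, E) ∞ h (f x) := by
  have : CompleteSpace E := FiniteDimensional.complete ℝ E
  have h1 : ContDiffAt ℝ ∞ (f ∘ (extChartAt 𝓘(ℝ, E) x).symm) (extChartAt 𝓘(ℝ, E) x x) :=
    contDiffAt_comp_symm (n := ⊤) (mem_extChartAt_target x) (by simpa using hf)
  have h2 : HasFDerivAt (f ∘ (extChartAt 𝓘(ℝ, E) x).symm) (e : E →L[ℝ] W)
      (extChartAt 𝓘(ℝ, E) x x) := by
    rw [← he, tder_eq_fderiv x (hf.mdifferentiableAt (by simp))]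
    exact (h1.differentiableAt (by simp)).hasFDerivAt
  have h3 := h1.hasStrictFDerivAt' h2 (by simp)
  have hval : (f ∘ (extChartAt 𝓘(ℝ, E) x).symm) (extChartAt 𝓘(ℝ, E) x x) = f x := by simp
  have hev : f =ᶠ[𝓝 x] (f ∘ (extChartAt 𝓘(ℝ, E) x).symm) ∘ extChartAt 𝓘(ℝ, E) x := by
    filter_upwards [(isOpen_extChartAt_source (I := 𝓘(ℝ, E)) x).mem_nhds
      (mem_extChartAt_source x)] with y hy
    simp only [Function.comp_apply]
    rw [(extChartAt 𝓘(ℝ, E) x).left_inv hy]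
  constructor
  · rw [Filter.map_congr hev, ← Filter.map_map, map_extChartAt_nhds,
      ModelWithCorners.range_eq_univ, nhdsWithin_univ, h3.map_nhds_eq_of_equiv, hval]
  · refine ⟨(extChartAt 𝓘(ℝ, E) x).symm ∘ h1.localInverse h2 (by simp), ?_, ?_⟩
    · have h4 := (continuousAt_extChartAt (I := 𝓘(ℝ, E)) x).eventually h3.eventually_left_inverse
      filter_upwards [(isOpen_extChartAt_source (I := 𝓘(ℝ, E)) x).mem_nhds
        (mem_extChartAt_source x), h4, hev] with y hy hy4 hye
      rw [hye, Function.comp_apply, Function.comp_apply]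
      refine Eq.trans ?_ ((extChartAt 𝓘(ℝ, E) x).left_inv hy)
      exact congrArg _ hy4
    · have h5 := (h1.to_localInverse h2 (by simp)).contMDiffAt
      rw [hval] at h5
      have h6 : h1.localInverse h2 (by simp) (f x) = extChartAt 𝓘(ℝ, E) x x := by
        have := h1.localInverse_apply_image h2 (by simp)
        rwa [hval] at this
      refine ContMDiffAt.comp (f x) ?_ h5
      rw [h6]
      have := contMDiffWithinAt_extChartAt_symm_range (I := 𝓘(ℝ, E)) (n := ∞) x
        (mem_extChartAt_target x)
      rwa [ModelWithCorners.range_eq_univ] at this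

/-- A smooth bijection with invertible derivatives is a diffeomorphism. -/
lemma exists_diffeomorph {f : M → W} (hf : ContMDiff 𝓘(ℝ, E) 𝓘(ℝ, W) ∞ f)
    (hd : ∀ x, ∃ e : E ≃L[ℝ] W, tder f x = (e : E →L[ℝ] W)) (hb : Function.Bijective f) :
    ∃ F : Diffeomorph 𝓘(ℝ, E) 𝓘(ℝ, W) M W ∞, ⇑F = f := by
  let e := Equiv.ofBijective f hb
  refine ⟨⟨e, hf, fun w => ?_⟩, rfl⟩
  obtain ⟨x, rfl⟩ := hb.2 w
  obtain ⟨e', he'⟩ := hd x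
  obtain ⟨h1, h, h2, h3⟩ := exists_local_inverse (hf x) e' he'
  refine h3.congr_of_eventuallyEq ?_
  have h4 : ∀ᶠ w in 𝓝 (f x), h w = e.symm w := by
    rw [← h1, Filter.eventually_map]
    filter_upwards [h2] with y hy
    rw [hy]
    exact (e.symm_apply_apply y).symm
  filter_upwards [h4] with w hw
  exact hw.symm

end InverseFunction

/-! ### Construction of the logarithm of a 2-step nilpotent group. -/

section BCH

variable {E : Type*} [NormedAddCommGroup E] [NormedSpace ℝ E] [FiniteDimensional ℝ E]
  {N : Type*} [TopologicalSpace N] [ChartedSpace E N] [Group N] [LieGroup 𝓘(ℝ, E) ∞ N]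

/-- The group law given by the Baker-Campbell-Hausdorff formula for a bracket which is
2-step nilpotent. -/
abbrev bchGroup (β : E →ₗ[ℝ] E →ₗ[ℝ] E) (hs : ∀ u v, β u v = -β v u)
    (h2 : ∀ u v w, β (β u v) w = 0) : Group E where
  mul x y := x + y + (2⁻¹ : ℝ) • β x y
  mul_assoc x y z := by
    change (x + y + (2⁻¹ : ℝ) • β x y) + z + (2⁻¹ : ℝ) • β (x + y + (2⁻¹ : ℝ) • β x y) z =
      x + (y + z + (2⁻¹ : ℝ) • β y z) + (2⁻¹ : ℝ) • β x (y + z + (2⁻¹ : ℝ) • β y z)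
    simp only [map_add, map_smul, LinearMap.add_apply, LinearMap.smul_apply, h2]
    rw [hs x (β y z), h2]
    simp only [neg_zero, smul_zero, add_zero, smul_add]
    abel
  one := 0
  one_mul x := by
    change 0 + x + (2⁻¹ : ℝ) • β 0 x = x
    simp
  mul_one x := by
    change x + 0 + (2⁻¹ : ℝ) • β x 0 = x
    simp
  inv x := -x
  inv_mul_cancel x := by
    change -x + x + (2⁻¹ : ℝ) • β (-x) x = 0
    have : β x x = 0 := by
      have h := hs x x
      rwa [eq_neg_iff_add_eq_zero, ← two_smul ℝ, smul_eq_zero_iff_right two_ne_zero] at h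
    simp [this]

/-- There is a projection along the center. -/
lemma exists_center_projection (β : E →ₗ[ℝ] E →ₗ[ℝ] E) (h2 : ∀ u v w, β (β u v) w = 0) :
    ∃ P : E →L[ℝ] E, (∀ u v, β (P u) v = β u v) ∧ ∀ u v, P (β u v) = 0 := by
  obtain ⟨Q, hQ⟩ := (LinearMap.ker β).exists_isCompl
  let P := Q.projection (LinearMap.ker β) hQ.symm
  refine ⟨LinearMap.toContinuousLinearMap P, fun u v => ?_, fun u v => ?_⟩
  · have h : u - P u ∈ LinearMap.ker β := by
      rw [← Submodule.ker_projection hQ.symm, LinearMap.mem_ker, map_sub, sub_eq_zero]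
      exact (LinearMap.congr_fun (Submodule.isIdempotentElem_projection hQ.symm) u).symm
    rw [LinearMap.mem_ker, map_sub, sub_eq_zero] at h
    exact (congrArg (fun L : E →ₗ[ℝ] E => L v) h).symm
  · have h : β u v ∈ LinearMap.ker β := LinearMap.ext fun w => h2 u v w
    rw [← Submodule.ker_projection hQ.symm, LinearMap.mem_ker] at h
    exact h

/-- The Maurer-Cartan equation expresses the exterior derivative of θ by brackets, and `P` kills
brackets, so Pθ is closed. -/
lemma exists_primitive_projection [SimplyConnectedSpace N] {P : E →L[ℝ] E}
    (hP : ∀ u v, P (lieBr E N u v) = 0) :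
    ∃ F : N → E, ContMDiff 𝓘(ℝ, E) 𝓘(ℝ, E) ∞ F ∧
      ∀ x, tder F x = P.comp (maurerCartan x) := by
  have : CompleteSpace E := FiniteDimensional.complete ℝ E
  refine exists_primitive (α := fun x : N => P.comp (maurerCartan x)) ?_ ?_
  · exact fun x X hX => P.contMDiff.contMDiffAt.comp x (contMDiffAt_maurerCartan hX)
  · intro x X Y hX hY
    have hX' := mdifferentiableAt_maurerCartan (vfDiffAt_of_vfContAt hX)
    have hY' := mdifferentiableAt_maurerCartan (vfDiffAt_of_vfContAt hY)
    simp only [ContinuousLinearMap.comp_apply]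
    rw [tder_clm_comp P hX', tder_clm_comp P hY', maurerCartan_vfBracket
      (vfDiffAt_of_vfContAt hX) (vfDiffAt_of_vfContAt hY), map_add, hP, map_sub, add_zero]
    rfl

/-- The equation dF = θ + ½[F,θ] involves F only modulo the center, that is, through PF, which is a
primitive of Pθ. With it inserted, the right-hand side is an explicit closed form: the derivative of
½[PF,θ] supplies [θ,θ] and cancels the Maurer-Cartan term. -/
lemma exists_primitive_bch [SimplyConnectedSpace N]
    (h2 : ∀ u v w, lieBr E N (lieBr E N u v) w = 0) :
    ∃ F : N → E, ContMDiff 𝓘(ℝ, E) 𝓘(ℝ, E) ∞ F ∧ F 1 = 0 ∧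
      ∀ x v, tder F x v = maurerCartan x v + (2⁻¹ : ℝ) • lieBr E N (F x) (maurerCartan x v) := by
  have : CompleteSpace E := FiniteDimensional.complete ℝ E
  obtain ⟨P, hP, hP2⟩ := exists_center_projection (lieBr E N) h2
  obtain ⟨F₁, hF₁, hd₁⟩ := exists_primitive_projection (N := N) hP2
  have hF₁' : ∀ x, MDifferentiableAt 𝓘(ℝ, E) 𝓘(ℝ, E) F₁ x := fun x =>
    (hF₁ x).mdifferentiableAt (by simp)
  let F₂ : N → E := fun x => F₁ x - F₁ 1
  have hF₂ : ContMDiff 𝓘(ℝ, E) 𝓘(ℝ, E) ∞ F₂ := hF₁.sub contMDiff_const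
  have hF₂' : ∀ x, MDifferentiableAt 𝓘(ℝ, E) 𝓘(ℝ, E) F₂ x := fun x =>
    (hF₂ x).mdifferentiableAt (by simp)
  have hd₂ : ∀ x, tder F₂ x = P.comp (maurerCartan x) := fun x => by
    rw [tder_sub (hF₁' x) mdifferentiableAt_const, tder_const, sub_zero, hd₁]
  let L := (2⁻¹ : ℝ) • toBilinCLM (lieBr E N)
  have hL : ∀ u v, L u v = (2⁻¹ : ℝ) • lieBr E N u v := fun _ _ => rfl
  let α : N → E →L[ℝ] E := fun x => maurerCartan x + (L (F₂ x)).comp (maurerCartan x)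
  have hαap : ∀ (X : N → E), (fun y => α y (X y)) =
      fun y => maurerCartan y (X y) + L (F₂ y) (maurerCartan y (X y)) := fun X => rfl
  obtain ⟨F₃, hF₃, hd₃⟩ := exists_primitive (α := α) (by
      intro x X hX
      rw [hαap]
      refine (contMDiffAt_maurerCartan hX).add ?_
      exact (L.contMDiff.contMDiffAt.comp x (hF₂ x)).clm_apply (contMDiffAt_maurerCartan hX)) (by
      intro x X Y hX hY
      have hX' := mdifferentiableAt_maurerCartan (vfDiffAt_of_vfContAt hX)
      have hY' := mdifferentiableAt_maurerCartan (vfDiffAt_of_vfContAt hY)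
      have e1 := tder_bilin L (hF₂' x) hX' (Y x)
      have e2 := tder_bilin L (hF₂' x) hY' (X x)
      rw [hαap, hαap, tder_add hX' (mdifferentiableAt_bilin L (hF₂' x) hX'),
        tder_add hY' (mdifferentiableAt_bilin L (hF₂' x) hY'), _root_.add_apply,
        _root_.add_apply, e1, e2, hd₂]
      have h3 : ∀ v, α x v = maurerCartan x v + L (F₂ x) (maurerCartan x v) := fun _ => rfl
      rw [h3, maurerCartan_vfBracket (vfDiffAt_of_vfContAt hX) (vfDiffAt_of_vfContAt hY)]
      simp only [ContinuousLinearMap.comp_apply, hL, hP, map_add, map_sub]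
      rw [lieBr_swap (maurerCartan x (Y x)) (maurerCartan x (X x)),
        lieBr_swap (F₂ x) (lieBr E N (maurerCartan x (X x)) (maurerCartan x (Y x))), h2]
      module)
  have hF₃' : ∀ x, MDifferentiableAt 𝓘(ℝ, E) 𝓘(ℝ, E) F₃ x := fun x =>
    (hF₃ x).mdifferentiableAt (by simp)
  let F : N → E := fun x => F₃ x - F₃ 1
  have hF : ContMDiff 𝓘(ℝ, E) 𝓘(ℝ, E) ∞ F := hF₃.sub contMDiff_const
  have hF' : ∀ x, MDifferentiableAt 𝓘(ℝ, E) 𝓘(ℝ, E) F x := fun x =>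
    (hF x).mdifferentiableAt (by simp)
  have hd : ∀ x, tder F x = α x := fun x => by
    rw [tder_sub (hF₃' x) mdifferentiableAt_const, tder_const, sub_zero, hd₃]
  -- Both sides have derivative Pθ and vanish at `1`; hence `F₂` may be replaced by `F` inside the
  -- bracket.
  have hPF : ∀ x, P (F x) = F₂ x := by
    intro x
    have h3 : ∀ x, MDifferentiableAt 𝓘(ℝ, E) 𝓘(ℝ, E) (fun y => P (F y)) x := fun x =>
      mdifferentiableAt_clm_comp P (hF' x)
    have h4 := eq_of_tder_eq_zero (E := E) (f := fun y => P (F y) - F₂ y)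
      (fun x => (h3 x).sub (hF₂' x)) (fun x => by
        rw [tder_sub (h3 x) (hF₂' x), tder_clm_comp P (hF' x), hd, hd₂]
        ext v
        simp [α, hL, hP2]) x 1
    simp only [F, F₂, sub_self, map_zero] at h4
    exact sub_eq_zero.1 h4
  refine ⟨F, hF, sub_self _, fun x v => ?_⟩
  rw [hd, ← hP (F x), hPF]
  rfl

end BCH


/-! ### The logarithm is an isomorphism onto the Baker-Campbell-Hausdorff group. -/

section LieSecond

variable {E : Type*} [NormedAddCommGroup E] [NormedSpace ℝ E] [FiniteDimensional ℝ E]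
  {N : Type*} [TopologicalSpace N] [ChartedSpace E N] [Group N] [LieGroup 𝓘(ℝ, E) ∞ N]

lemma tder_comp_mul_left {W : Type*} [NormedAddCommGroup W] [NormedSpace ℝ W] {F : N → W}
    (hF : ContMDiff 𝓘(ℝ, E) 𝓘(ℝ, W) ∞ F) (a x : N) (v : E) :
    tder (fun y => F (a * y)) x v = tder F (a * x) (leftDer a x v) := by
  have h := mfderiv_comp x ((hF (a * x)).mdifferentiableAt (by simp))
    (mdifferentiableAt_mul_left' (E := E) a x)
  have h' : tder (fun y => F (a * y)) x = (tder F (a * x)).comp (leftDer (E := E) a x) := h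
  rw [h']
  rfl

/-- The defect K(y) = F(ay) - F(y) - ½[F(a),F(y)] is shown to be constant, first modulo the center
and then fully; K(1) = F(a) gives the law. The left invariance of θ is what makes the derivative of
F(ay) computable. -/
lemma bch_mul [PreconnectedSpace N] {F : N → E} (h2 : ∀ u v w, lieBr E N (lieBr E N u v) w = 0)
    (hF : ContMDiff 𝓘(ℝ, E) 𝓘(ℝ, E) ∞ F) (h1 : F 1 = 0)
    (hd : ∀ x v, tder F x v = maurerCartan x v + (2⁻¹ : ℝ) • lieBr E N (F x) (maurerCartan x v))
    (a x : N) : F (a * x) = F a + F x + (2⁻¹ : ℝ) • lieBr E N (F a) (F x) := by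
  obtain ⟨P, hP, hP2⟩ := exists_center_projection (lieBr E N) h2
  have hF' : ∀ x, MDifferentiableAt 𝓘(ℝ, E) 𝓘(ℝ, E) F x := fun x =>
    (hF x).mdifferentiableAt (by simp)
  have hG : ∀ x, MDifferentiableAt 𝓘(ℝ, E) 𝓘(ℝ, E) (fun y => F (a * y)) x := fun x =>
    (hF.comp (contMDiff_mul_left (I := 𝓘(ℝ, E)) (n := ∞) (a := a)) x).mdifferentiableAt (by simp)
  let C : E →L[ℝ] E := (2⁻¹ : ℝ) • toBilinCLM (lieBr E N) (F a)
  have hC : ∀ u, C u = (2⁻¹ : ℝ) • lieBr E N (F a) u := fun _ => rfl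
  let K : N → E := fun y => F (a * y) - (F y + C (F y))
  have hCF : ∀ x, MDifferentiableAt 𝓘(ℝ, E) 𝓘(ℝ, E) (fun y => C (F y)) x := fun x =>
    mdifferentiableAt_clm_comp C (hF' x)
  have hK : ∀ x, MDifferentiableAt 𝓘(ℝ, E) 𝓘(ℝ, E) K x := fun x =>
    (hG x).sub ((hF' x).add (hCF x))
  have h2' : ∀ u v w, lieBr E N w (lieBr E N u v) = 0 := fun u v w => by
    rw [lieBr_swap, h2, neg_zero]
  have hdK : ∀ (x : N) (v : E), tder K x v =
      (2⁻¹ : ℝ) • lieBr E N (F (a * x) - F x - F a) (maurerCartan x v) := by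
    intro x v
    have e1 : tder (E := E) K x = tder (fun y => F (a * y)) x - (tder F x + C.comp (tder F x)) := by
      rw [← tder_clm_comp C (hF' x), ← tder_add (hF' x) (hCF x)]
      exact tder_sub (hG x) ((hF' x).add (hCF x))
    have e2 : tder K x v = tder (fun y => F (a * y)) x v - (tder F x v + C (tder F x v)) := by
      rw [e1]; rfl
    rw [e2, tder_comp_mul_left hF, hd, hd, maurerCartan_leftDer]
    simp only [hC, map_add, map_smul, map_sub, LinearMap.sub_apply, h2']
    module
  -- The derivative of `K` is a bracket, so it is killed by `P`. Once PK is known, the bracket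
  -- expressing that derivative has a central first entry and vanishes.
  have hPK : ∀ x, P (K x) = P (F a) := by
    intro x
    have h3 := eq_of_tder_eq_zero (E := E) (f := fun y => P (K y))
      (fun x => mdifferentiableAt_clm_comp P (hK x)) (fun x => by
        rw [tder_clm_comp P (hK x)]
        ext v
        rw [ContinuousLinearMap.comp_apply, hdK, map_smul, hP2, smul_zero]
        rfl) x 1
    simpa [K, h1, hC] using h3
  have hKa : ∀ x, tder (E := E) K x = 0 := by
    intro x
    ext v
    have e : F (a * x) - F x - F a = K x - F a + C (F x) := by
      simp only [K]; abel
    rw [hdK, e, map_add, LinearMap.add_apply, ← hP (K x - F a), map_sub, hPK, sub_self, hC]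
    simp [h2]
  have h3 := eq_of_tder_eq_zero hK hKa x 1
  simp only [K, mul_one, h1, map_zero, add_zero, sub_zero, smul_zero, hC] at h3
  rw [sub_eq_iff_eq_add] at h3
  rw [h3]
  abel

/-- The derivative is (1 + ½ ad F) ∘ θ, where θ is invertible and (ad F)² = 0. -/
lemma bch_tder_equiv {F : N → E} (h2 : ∀ u v w, lieBr E N (lieBr E N u v) w = 0)
    (hd : ∀ x v, tder F x v = maurerCartan x v + (2⁻¹ : ℝ) • lieBr E N (F x) (maurerCartan x v))
    (x : N) : ∃ e : E ≃L[ℝ] E, tder F x = (e : E →L[ℝ] E) := by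
  have hinj : Function.Injective (tder F x : E →L[ℝ] E).toLinearMap := by
    rw [injective_iff_map_eq_zero]
    intro v hv
    have hv' : tder F x v = 0 := hv
    have h3 : lieBr E N (F x) (maurerCartan x v) = 0 := by
      have h4 := congrArg (lieBr E N (F x)) (hd x v)
      rw [hv', map_zero, map_add, map_smul, lieBr_swap _ (lieBr E N _ _), h2, neg_zero,
        smul_zero, add_zero] at h4
      exact h4.symm
    rw [hd, h3, smul_zero, add_zero] at hv'
    rw [← frame_maurerCartan x v, hv', map_zero]
  refine ⟨(LinearEquiv.ofInjectiveEndo _ hinj).toContinuousLinearEquiv, ?_⟩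
  ext v
  rfl

/-- A simply connected 2-step nilpotent Lie group is isomorphic to its Lie algebra with the group
law given by the Baker-Campbell-Hausdorff formula. -/
theorem exists_bch_diffeomorph [T2Space N] [SimplyConnectedSpace N]
    (h2 : ∀ u v w, lieBr E N (lieBr E N u v) w = 0) :
    ∃ F : Diffeomorph 𝓘(ℝ, E) 𝓘(ℝ, E) N E ∞,
      (∀ x y, F (x * y) = F x + F y + (2⁻¹ : ℝ) • lieBr E N (F x) (F y)) ∧
      ∀ x v, tder F x v = maurerCartan x v + (2⁻¹ : ℝ) • lieBr E N (F x) (maurerCartan x v) := by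
  obtain ⟨F, hF, h1, hd⟩ := exists_primitive_bch (N := N) h2
  have hmul := bch_mul h2 hF h1 hd
  have hopen : IsOpenMap F := isOpenMap_iff_nhds_le.2 fun x => by
    obtain ⟨e, he⟩ := bch_tder_equiv h2 hd x
    exact (exists_local_inverse (hF x) e he).1.ge
  have hself : ∀ u, lieBr E N u u = 0 := fun u => by
    have h := lieBr_swap (N := N) u u
    rwa [eq_neg_iff_add_eq_zero, ← two_smul ℝ, smul_eq_zero_iff_right two_ne_zero] at h
  have hpow : ∀ (x : N) (n : ℕ), F (x ^ n) = (n : ℝ) • F x := by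
    intro x n
    induction n with
    | zero => simp [h1]
    | succ n ih =>
      rw [pow_succ, hmul, ih, map_smul, LinearMap.smul_apply, hself, smul_zero, smul_zero,
        add_zero]
      push_cast
      module
  -- The image contains a neighbourhood of 0 and is stable under multiples, because F(xⁿ) = nF(x):
  -- divide `v` by a large `n`, then take the n-th power.
  have hsurj : Function.Surjective F := by
    intro v
    have h3 : Set.range F ∈ 𝓝 (0 : E) := hopen.isOpen_range.mem_nhds ⟨1, h1⟩
    have h4 : Filter.Tendsto (fun n : ℕ => ((n : ℝ)⁻¹) • v) Filter.atTop (𝓝 0) := by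
      have := (tendsto_inv_atTop_nhds_zero_nat (𝕜 := ℝ)).smul_const v
      rwa [zero_smul] at this
    obtain ⟨n, ⟨x, hx⟩, hn⟩ := ((h4.eventually_mem h3).and (Filter.eventually_gt_atTop 0)).exists
    refine ⟨x ^ n, ?_⟩
    rw [hpow, hx, smul_smul, mul_inv_cancel₀ (by positivity), one_smul]
  have hinj : Function.Injective F := by
    let _ : Group E := bchGroup (lieBr E N) lieBr_swap h2
    have : IsTopologicalGroup N := topologicalGroup_of_lieGroup 𝓘(ℝ, E) ∞
    let Fh : N →* E := { toFun := F, map_one' := h1, map_mul' := hmul }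
    have hq : Topology.IsQuotientMap Fh := hopen.isQuotientMap hF.continuous hsurj
    -- The local inverse of `F` separates a kernel point from its neighbours, so `F` is the quotient
    -- by a discrete subgroup and hence a covering.
    have hdisc : IsDiscrete (Fh.ker : Set N) := by
      refine IsDiscrete.of_nhdsWithin fun x hx => ?_
      obtain ⟨e, he⟩ := bch_tder_equiv h2 hd x
      obtain ⟨-, h, h3, -⟩ := exists_local_inverse (hF x) e he
      rw [Filter.le_pure_iff]
      have hx' : F x = 0 := hx
      filter_upwards [mem_nhdsWithin_of_mem_nhds h3, self_mem_nhdsWithin] with y hy hyk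
      have hy' : F y = 0 := hyk
      have h4 := h3.self_of_nhds
      change y = x
      rw [← hy, ← h4, hx', hy']
    have hcov : IsCoveringMap F :=
      (hq.isQuotientCoveringMap_of_isDiscrete_ker_monoidHom hdisc).isCoveringMap
    -- The vector space is simply connected, so the covering has a section through `1`; by
    -- uniqueness of lifts it is also a left inverse of `F`.
    obtain ⟨s, ⟨hs0, hs⟩, -⟩ := hcov.existsUnique_continuousMap_lifts (ContinuousMap.id E) 0 1 h1
    have h3 : s ∘ F = id := by
      refine hcov.eq_of_comp_eq (s.continuous.comp hF.continuous) continuous_id ?_ (1 : N) ?_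
      · rw [← Function.comp_assoc, hs]; rfl
      · simp [h1, hs0]
    exact Function.LeftInverse.injective (congrFun h3)
  obtain ⟨Φ, hΦ⟩ := exists_diffeomorph hF (bch_tder_equiv h2 hd) ⟨hinj, hsurj⟩
  refine ⟨Φ, ?_, ?_⟩
  · rw [hΦ]; exact hmul
  · rw [hΦ]; exact hd

end LieSecond


/-! ### The Ricci form of a 2-step nilpotent metric Lie algebra. -/

section RicciFormula

variable {V : Type*} [AddCommGroup V] [Module ℝ V]
  {B : V →ₗ[ℝ] V →ₗ[ℝ] ℝ} {br pr : V →ₗ[ℝ] V →ₗ[ℝ] V} {ι : Type*} [Fintype ι] {b d : ι → V}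

/-- The families `b` and `d` are dual to each other with respect to `B`. -/
def IsDual (B : V →ₗ[ℝ] V →ₗ[ℝ] ℝ) (b d : ι → V) : Prop :=
  ∀ x y, ∑ i, B x (b i) * B (d i) y = B x y

lemma IsDual.sum_smul (hB : IsScalarProduct B) (h : IsDual B b d) (x : V) :
    ∑ i, B x (b i) • d i = x := by
  refine hB.eq_of_forall fun y => ?_
  simpa using h x y

lemma IsDual.symm (hB : IsScalarProduct B) (h : IsDual B b d) : IsDual B d b := by
  intro x y
  rw [hB.symm x y, ← h y x]
  refine Finset.sum_congr rfl fun i _ => ?_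
  rw [hB.symm x, hB.symm y, mul_comm]

lemma IsDual.sum_mul (hB : IsScalarProduct B) (h : IsDual B b d) (x : V) (f : V →ₗ[ℝ] ℝ) :
    ∑ i, B x (b i) * f (d i) = f x := by
  conv_rhs => rw [← h.sum_smul hB x]
  simp

lemma IsDual.trace_eq [FiniteDimensional ℝ V] (hB : IsScalarProduct B) (h : IsDual B b d)
    (T : V →ₗ[ℝ] V) : LinearMap.trace ℝ V T = ∑ i, B (T (b i)) (d i) := by
  have e : T = ∑ i, (B.flip (d i)).smulRight (T (b i)) := by
    ext x
    conv_lhs => rw [← (h.symm hB).sum_smul hB x]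
    simp
  conv_lhs => rw [e]
  simp only [map_sum, LinearMap.trace_smulRight]
  exact Finset.sum_congr rfl fun i _ => rfl

/-- The tensor Σ b_i ⊗ d_i is the inverse of the symmetric form `B`, hence symmetric. Antisymmetric
expressions in a dual pair therefore sum to zero. -/
lemma IsDual.sum_comm_bilin (hB : IsScalarProduct B) (h : IsDual B b d)
    (f : V →ₗ[ℝ] V →ₗ[ℝ] ℝ) : ∑ i, f (b i) (d i) = ∑ i, f (d i) (b i) := by
  have e1 : ∀ i, f (b i) (d i) = ∑ k, B (d i) (d k) * f (b i) (b k) := fun i =>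
    ((h.symm hB).sum_mul hB (d i) (f (b i))).symm
  have e2 : ∀ k, ∑ i, B (d k) (d i) * f (b i) (b k) = f (d k) (b k) := fun k =>
    (h.symm hB).sum_mul hB (d k) (f.flip (b k))
  simp only [e1]
  rw [Finset.sum_comm]
  refine Finset.sum_congr rfl fun k _ => ?_
  rw [← e2 k]
  exact Finset.sum_congr rfl fun i _ => by rw [hB.symm]

lemma trace_bracket_eq_zero (h2 : ∀ u v w, br (br u v) w = 0) (hbr : ∀ u v, br u v = -br v u)
    (x : V) : LinearMap.trace ℝ V (br x) = 0 := by
  have hn : IsNilpotent (br x) := ⟨2, by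
    ext w
    rw [pow_two, Module.End.mul_apply, hbr, h2]
    simp⟩
  exact (LinearMap.isNilpotent_trace_of_isNilpotent hn).eq_zero

/-- Expanding both products by the Koszul identity gives nine double sums. Contractions that create
a bracket within a bracket vanish, the two equal to -Σ⟨[v,b_i],[u,d_i]⟩ enter with opposite signs,
and a single one survives. -/
lemma IsDual.sum_nabla (hB : IsScalarProduct B) (h : IsDual B b d)
    (hbr : ∀ u v, br u v = -br v u) (h2 : ∀ u v w, br (br u v) w = 0) (hpr : IsKoszul B br pr)
    (u v : V) : ∑ i, B (pr (b i) v) (pr u (d i)) =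
      (1 / 4) * ∑ i, ∑ k, B (br (b i) (b k)) v * B (br (d i) (d k)) u := by
  have h2' : ∀ u v w, br w (br u v) = 0 := fun u v w => by rw [hbr, h2, neg_zero]
  have hd := h.symm hB
  have e0 : ∀ i, B (pr (b i) v) (pr u (d i)) = (1 / 4) * ∑ k,
      (B (br (b i) v) (b k) - B (br v (b k)) (b i) + B (br (b k) (b i)) v) *
      (B (br u (d i)) (d k) - B (br (d i) (d k)) u + B (br (d k) u) (d i)) := by
    intro i
    rw [← h, Finset.mul_sum]
    refine Finset.sum_congr rfl fun k _ => ?_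
    rw [← hpr, ← hpr, hB.symm (d k)]
    ring
  have s11 : ∑ i, ∑ k, B (br (b i) v) (b k) * B (br u (d i)) (d k) =
      -∑ i, B (br v (b i)) (br u (d i)) := by
    rw [← Finset.sum_neg_distrib]
    refine Finset.sum_congr rfl fun i _ => ?_
    rw [h.sum_mul hB (br (b i) v) (B (br u (d i))), hB.symm, hbr (b i)]
    simp
  have s12 : ∑ i, ∑ k, B (br (b i) v) (b k) * B (br (d i) (d k)) u = 0 := by
    refine Finset.sum_eq_zero fun i _ => ?_
    refine (h.sum_mul hB (br (b i) v) (B.flip u ∘ₗ br (d i))).trans ?_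
    simp [h2']
  have s13 : ∑ i, ∑ k, B (br (b i) v) (b k) * B (br (d k) u) (d i) = 0 := by
    refine Finset.sum_eq_zero fun i _ => ?_
    refine (h.sum_mul hB (br (b i) v) (B.flip (d i) ∘ₗ br.flip u)).trans ?_
    simp [h2]
  have s21 : ∑ i, ∑ k, B (br v (b k)) (b i) * B (br u (d i)) (d k) = 0 := by
    rw [Finset.sum_comm]
    refine Finset.sum_eq_zero fun k _ => ?_
    refine (h.sum_mul hB (br v (b k)) (B.flip (d k) ∘ₗ br u)).trans ?_
    simp [h2']
  have s22 : ∑ i, ∑ k, B (br v (b k)) (b i) * B (br (d i) (d k)) u = 0 := by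
    rw [Finset.sum_comm]
    refine Finset.sum_eq_zero fun k _ => ?_
    refine (h.sum_mul hB (br v (b k)) (B.flip u ∘ₗ br.flip (d k))).trans ?_
    simp [h2]
  have s23 : ∑ i, ∑ k, B (br v (b k)) (b i) * B (br (d k) u) (d i) =
      -∑ i, B (br v (b i)) (br u (d i)) := by
    rw [Finset.sum_comm, ← Finset.sum_neg_distrib]
    refine Finset.sum_congr rfl fun k _ => ?_
    rw [h.sum_mul hB (br v (b k)) (B (br (d k) u)), hB.symm, hbr (d k)]
    simp
  have s31 : ∑ i, ∑ k, B (br (b k) (b i)) v * B (br u (d i)) (d k) = 0 := by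
    refine Finset.sum_eq_zero fun i _ => ?_
    have := hd.sum_mul hB (br u (d i)) (B.flip v ∘ₗ br.flip (b i))
    simp only [LinearMap.comp_apply, LinearMap.flip_apply, h2, map_zero]
      at this
    rw [← this]
    exact Finset.sum_congr rfl fun k _ => mul_comm _ _
  have s33 : ∑ i, ∑ k, B (br (b k) (b i)) v * B (br (d k) u) (d i) = 0 := by
    rw [Finset.sum_comm]
    refine Finset.sum_eq_zero fun k _ => ?_
    have := hd.sum_mul hB (br (d k) u) (B.flip v ∘ₗ br (b k))
    simp only [LinearMap.comp_apply, LinearMap.flip_apply, h2', map_zero]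
      at this
    rw [← this]
    exact Finset.sum_congr rfl fun k _ => mul_comm _ _
  have s32 : ∑ i, ∑ k, B (br (b k) (b i)) v * B (br (d i) (d k)) u =
      -∑ i, ∑ k, B (br (b i) (b k)) v * B (br (d i) (d k)) u := by
    simp only [← Finset.sum_neg_distrib]
    refine Finset.sum_congr rfl fun i _ => Finset.sum_congr rfl fun k _ => ?_
    rw [hbr (b k)]
    simp
  simp only [e0]
  rw [← Finset.mul_sum]
  congr 1
  simp only [add_mul, sub_mul, mul_add, mul_sub, Finset.sum_add_distrib, Finset.sum_sub_distrib]
  rw [s11, s12, s13, s21, s22, s23, s31, s33, s32]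
  ring

/-- The Ricci form of a metric 2-step nilpotent Lie algebra. -/
theorem IsDual.trace_curv [FiniteDimensional ℝ V] (hB : IsScalarProduct B) (h : IsDual B b d)
    (hbr : ∀ u v, br u v = -br v u) (h2 : ∀ u v w, br (br u v) w = 0) (hpr : IsKoszul B br pr)
    (u v : V) : LinearMap.trace ℝ V (curv br pr u v) =
      -(1 / 2) * ∑ i, B (br u (b i)) (br v (d i)) +
      (1 / 4) * ∑ i, ∑ k, B (br (b i) (b k)) v * B (br (d i) (d k)) u := by
  have h2' : ∀ u v w, br w (br u v) = 0 := fun u v w => by rw [hbr, h2, neg_zero]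
  have hm := hpr.metric hB hbr
  have tA : ∀ i, B (pr (br u (b i)) v) (d i) = -(1 / 2) * B (br u (b i)) (br v (d i)) := by
    intro i
    have e := hpr (br u (b i)) v (d i)
    rw [h2, h2', map_zero, LinearMap.zero_apply, LinearMap.zero_apply,
      hB.symm (br v (d i))] at e
    linarith
  have tB : ∀ i, B (pr u (pr (b i) v)) (d i) = -B (pr (b i) v) (pr u (d i)) := fun i => by
    linarith [hm u (pr (b i) v) (d i)]
  -- This is Σ ∇_{b_i} d_i = 0, a consequence of unimodularity: each ad x squares to zero and so has
  -- trace zero.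
  have tC : ∑ i, B (pr (b i) (pr u v)) (d i) = 0 := by
    have e1 : ∀ x, ∑ i, B x (pr (b i) (d i)) = 0 := by
      intro x
      have s1 : ∑ i, B (br (b i) (d i)) x = 0 := by
        have := h.sum_comm_bilin hB (br.compr₂ (B.flip x))
        simp only [LinearMap.compr₂_apply, LinearMap.flip_apply] at this
        have e : ∀ i, B (br (d i) (b i)) x = -B (br (b i) (d i)) x := fun i => by
          rw [hbr]; simp
        simp only [e, Finset.sum_neg_distrib] at this
        linarith
      have s2 : ∑ i, B (br x (b i)) (d i) = 0 := by
        rw [← h.trace_eq hB, trace_bracket_eq_zero h2 hbr]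
      have s3 : ∑ i, B (br (d i) x) (b i) = 0 := by
        have e : ∀ i, B (br (d i) x) (b i) = -B (br x (d i)) (b i) := fun i => by
          rw [hbr]; simp
        simp only [e, Finset.sum_neg_distrib]
        rw [← (h.symm hB).trace_eq hB, trace_bracket_eq_zero h2 hbr, neg_zero]
      have e : ∀ i, B x (pr (b i) (d i)) =
          1 / 2 * (B (br (b i) (d i)) x - B (br (d i) x) (b i) + B (br x (b i)) (d i)) := by
        intro i
        rw [← hpr, hB.symm]
        ring
      simp only [e]
      rw [← Finset.mul_sum, Finset.sum_add_distrib, Finset.sum_sub_distrib, s1, s2, s3]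
      simp
    have e2 : ∀ i, B (pr (b i) (pr u v)) (d i) = -B (pr u v) (pr (b i) (d i)) := fun i => by
      linarith [hm (b i) (pr u v) (d i)]
    simp only [e2, Finset.sum_neg_distrib, e1, neg_zero]
  rw [h.trace_eq hB]
  simp only [curv_apply, map_add, map_sub, LinearMap.add_apply, LinearMap.sub_apply,
    Finset.sum_add_distrib, Finset.sum_sub_distrib, tA, tB, tC, Finset.sum_neg_distrib]
  rw [h.sum_nabla hB hbr h2 hpr, ← Finset.mul_sum]
  ring

end RicciFormula


/-! ### Positivity in Lorentzian vector spaces. -/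

section Lorentz

variable {V : Type*} [AddCommGroup V] [Module ℝ V] {B : V →ₗ[ℝ] V →ₗ[ℝ] ℝ}

lemma bilin_eq_of_orthonormal {m : ℕ} (b : Module.Basis (Fin (m + 1)) ℝ V)
    (hb : ∀ i j, B (b i) (b j) = if i = j then (if i = 0 then -1 else 1) else 0) (x y : V) :
    B x y = -(b.repr x 0 * b.repr y 0) + ∑ i : Fin m, b.repr x i.succ * b.repr y i.succ := by
  conv_lhs => rw [← b.sum_repr x, ← b.sum_repr y]
  simp only [map_sum, map_smul, LinearMap.sum_apply, LinearMap.smul_apply, hb, smul_eq_mul,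
    mul_ite, mul_zero, Finset.sum_ite_eq', Finset.mem_univ, if_true]
  rw [Fin.sum_univ_succ]
  simp [Fin.succ_ne_zero, mul_comm]

/-- In a Lorentzian vector space, the orthogonal of a timelike vector is positive definite. -/
lemma IsLorentzian.pos_of_timelike (hL : IsLorentzian fun u v => B u v) {x y : V}
    (hx : B x x < 0) (hxy : B x y = 0) (hy : y ≠ 0) : 0 < B y y := by
  obtain ⟨m, b, hb⟩ := hL
  have e := bilin_eq_of_orthonormal b hb
  rw [e] at hx hxy ⊢
  -- Cauchy-Schwarz on the spacelike components. Orthogonality gives p = x₀y₀ and timelikeness X <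
  -- x₀², hence x₀²y₀² ≤ XY < x₀²Y as soon as Y > 0.
  have hcs := Finset.sum_mul_sq_le_sq_mul_sq Finset.univ (fun i : Fin m => b.repr x i.succ)
    (fun i => b.repr y i.succ)
  simp only [← pow_two] at hx ⊢
  set x₀ := b.repr x 0
  set y₀ := b.repr y 0
  set p := ∑ i : Fin m, b.repr x i.succ * b.repr y i.succ
  set X := ∑ i : Fin m, b.repr x i.succ ^ 2 with hX
  set Y := ∑ i : Fin m, b.repr y i.succ ^ 2 with hY
  have hX0 : 0 ≤ X := Finset.sum_nonneg fun _ _ => sq_nonneg _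
  have hY0 : 0 ≤ Y := Finset.sum_nonneg fun _ _ => sq_nonneg _
  have hp : p = x₀ * y₀ := by linarith
  rw [hp] at hcs
  have hx0 : 0 < x₀ ^ 2 := by linarith
  have hYpos : 0 < Y := by
    rcases hY0.lt_or_eq with h | h
    · exact h
    · exfalso
      apply hy
      have h1 : ∀ i : Fin m, b.repr y i.succ = 0 := fun i => by
        have := (Finset.sum_eq_zero_iff_of_nonneg fun (i : Fin m) _ =>
          sq_nonneg (b.repr y i.succ)).1 h.symm i (Finset.mem_univ i)
        exact pow_eq_zero_iff two_ne_zero |>.1 this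
      have h2 : y₀ = 0 := by
        rw [← h, mul_zero, mul_pow] at hcs
        have h3 : y₀ ^ 2 ≤ 0 := by
          by_contra h4
          push Not at h4
          exact absurd hcs (not_le.2 (mul_pos hx0 h4))
        exact pow_eq_zero_iff two_ne_zero |>.1 (le_antisymm h3 (sq_nonneg _))
      refine b.ext_elem fun i => ?_
      refine Fin.cases ?_ (fun j => ?_) i
      · simpa using h2
      · simpa using h1 j
  have h5 : x₀ ^ 2 * y₀ ^ 2 < x₀ ^ 2 * Y := by
    rw [← mul_pow]
    exact lt_of_le_of_lt hcs (mul_lt_mul_of_pos_right (by linarith) hYpos)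
  have := lt_of_mul_lt_mul_left h5 hx0.le
  linarith

/-- A finite orthonormal family `c` of elements of the submodule `U` which spans `U`. -/
structure IsOrthonormalFamily (B : V →ₗ[ℝ] V →ₗ[ℝ] ℝ) (U : Submodule ℝ V) {ι : Type*} [Fintype ι]
    [DecidableEq ι] (c : ι → V) : Prop where
  mem (i : ι) : c i ∈ U
  orthonormal (i j : ι) : B (c i) (c j) = if i = j then 1 else 0
  sum_smul (x : V) (hx : x ∈ U) : ∑ i, B x (c i) • c i = x

lemma exists_isOrthonormalFamily [FiniteDimensional ℝ V] (hs : ∀ u v, B u v = B v u)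
    (U : Submodule ℝ V) (hU : ∀ x ∈ U, x ≠ 0 → 0 < B x x) :
    ∃ (n : ℕ) (c : Fin n → V), IsOrthonormalFamily B U c := by
  obtain ⟨v, hv⟩ := LinearMap.BilinForm.exists_orthogonal_basis
    (B := (B.domRestrict₁₂ U U : LinearMap.BilinForm ℝ U)) ⟨fun x y => hs _ _⟩
  have hpos : ∀ i, 0 < B (v i) (v i) := fun i =>
    hU _ (v i).2 fun h => v.ne_zero i (Subtype.ext h)
  have horth : ∀ i j, i ≠ j → B (v i) (v j) = 0 := fun i j hij => hv hij
  refine ⟨_, fun i => (√(B (v i) (v i)))⁻¹ • (v i : V), fun i => U.smul_mem _ (v i).2, ?_, ?_⟩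
  · intro i j
    split_ifs with h
    · subst h
      simp only [map_smul, LinearMap.smul_apply, smul_eq_mul]
      rw [← mul_assoc, ← mul_inv, Real.mul_self_sqrt (hpos i).le, inv_mul_cancel₀ (hpos i).ne']
    · simp [horth i j h]
  · intro x hx
    have e : ∀ y : U, ∑ i, B y ((√(B (v i) (v i)))⁻¹ • (v i : V)) • ((√(B (v i) (v i)))⁻¹ • (v i : V))
        = y := by
      intro y
      conv_rhs => rw [← v.sum_repr y]
      rw [AddSubmonoidClass.coe_finsetSum]
      refine Finset.sum_congr rfl fun i _ => ?_
      have h1 : B y (v i) = v.repr y i * B (v i) (v i) := by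
        conv_lhs => rw [← v.sum_repr y]
        rw [AddSubmonoidClass.coe_finsetSum, map_sum, LinearMap.sum_apply,
          Finset.sum_eq_single i]
        · simp
        · intro j _ hj
          simp [horth j i hj]
        · simp
      rw [map_smul, h1, smul_smul, smul_eq_mul, Submodule.coe_smul]
      congr 1
      have h2 := Real.mul_self_sqrt (hpos i).le
      have h3 := (Real.sqrt_pos.2 (hpos i)).ne'
      field_simp
      linear_combination (-(v.repr y i)) * h2
    exact e ⟨x, hx⟩

end Lorentz

/-! ### Normal form of skew-symmetric operators and bilinear forms. -/

section Skew

open scoped InnerProductSpace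

variable {F : Type*} [NormedAddCommGroup F] [InnerProductSpace ℝ F] [FiniteDimensional ℝ F]
  {A : F →ₗ[ℝ] F}

/-- The operator -A² is symmetric on U. An eigenvector x of it with Ax ≠ 0 has eigenvalue |Ax|², so
x and y = Ax/|Ax| span an invariant plane with l = |Ax|. -/
lemma exists_skew_pair (hA : ∀ x y, ⟪A x, y⟫_ℝ = -⟪x, A y⟫_ℝ) (U : Submodule ℝ F)
    (hU : ∀ x ∈ U, A x ∈ U) (h : ∃ x ∈ U, A x ≠ 0) :
    ∃ x ∈ U, ∃ y ∈ U, ∃ l : ℝ, 0 < l ∧ ⟪x, x⟫_ℝ = 1 ∧ ⟪y, y⟫_ℝ = 1 ∧ ⟪x, y⟫_ℝ = 0 ∧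
      A x = l • y ∧ A y = -l • x := by
  let T : U →ₗ[ℝ] U := A.restrict hU
  have hT : ∀ x y : U, ⟪T x, y⟫_ℝ = -⟪x, T y⟫_ℝ := fun x y => hA x y
  have hS : (-(T ∘ₗ T)).IsSymmetric := by
    intro x y
    simp [hT]
  let b := hS.eigenvectorBasis rfl
  obtain ⟨i, hi⟩ : ∃ i, T (b i) ≠ 0 := by
    by_contra! hc
    obtain ⟨x, hx, hAx⟩ := h
    have : T = 0 := b.toBasis.ext fun i => by simpa using hc i
    apply hAx
    have h2 := LinearMap.congr_fun this ⟨x, hx⟩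
    exact congrArg Subtype.val h2
  have h1 : T (T (b i)) = -(hS.eigenvalues rfl i) • b i := by
    have := hS.apply_eigenvectorBasis rfl i
    simp only [LinearMap.neg_apply, LinearMap.comp_apply] at this
    rw [neg_eq_iff_eq_neg] at this
    rw [this, neg_smul]
    rfl
  have hb1 : ⟪b i, b i⟫_ℝ = 1 := by
    rw [real_inner_self_eq_norm_sq, b.norm_eq_one, one_pow]
  have hmu : hS.eigenvalues rfl i = ‖T (b i)‖ ^ 2 := by
    rw [← real_inner_self_eq_norm_sq, hT, h1, inner_smul_right, hb1]
    ring
  have hl : 0 < ‖T (b i)‖ := norm_pos_iff.2 hi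
  have hxy : ⟪b i, T (b i)⟫_ℝ = 0 := by
    have := hT (b i) (b i)
    rw [real_inner_comm] at this
    linarith
  refine ⟨b i, (b i).2, ((‖T (b i)‖⁻¹ • T (b i) : U) : F), Subtype.mem _, ‖T (b i)‖, hl,
    hb1, ?_, ?_, ?_, ?_⟩
  · have : ⟪‖T (b i)‖⁻¹ • T (b i), ‖T (b i)‖⁻¹ • T (b i)⟫_ℝ = 1 := by
      rw [inner_smul_left, inner_smul_right, real_inner_self_eq_norm_sq]
      simp only [conj_trivial]
      field_simp
    exact this
  · have : ⟪b i, ‖T (b i)‖⁻¹ • T (b i)⟫_ℝ = 0 := by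
      rw [inner_smul_right, hxy, mul_zero]
    exact this
  · have : T (b i) = ‖T (b i)‖ • (‖T (b i)‖⁻¹ • T (b i)) := by
      rw [smul_smul, mul_inv_cancel₀ hl.ne', one_smul]
    exact congrArg Subtype.val this
  · have : T (‖T (b i)‖⁻¹ • T (b i)) = -‖T (b i)‖ • b i := by
      rw [map_smul, h1, hmu, smul_smul]
      congr 1
      field_simp
    exact congrArg Subtype.val this

/-- The normal form of a skew-symmetric operator. -/
lemma exists_skew_normal_form (hA : ∀ x y, ⟪A x, y⟫_ℝ = -⟪x, A y⟫_ℝ) (n : ℕ) :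
    ∀ U : Submodule ℝ F, Module.finrank ℝ U = n → (∀ x ∈ U, A x ∈ U) →
    ∃ (r q : ℕ) (v : Fin r → Fin 2 → F) (w : Fin q → F) (l : Fin r → ℝ),
      (∀ k a, v k a ∈ U) ∧ (∀ j, w j ∈ U) ∧
      (∀ k a k' a', ⟪v k a, v k' a'⟫_ℝ = if k = k' ∧ a = a' then 1 else 0) ∧
      (∀ k a j, ⟪v k a, w j⟫_ℝ = 0) ∧
      (∀ j j', ⟪w j, w j'⟫_ℝ = if j = j' then 1 else 0) ∧
      (∀ x ∈ U, ∑ k, ∑ a, ⟪x, v k a⟫_ℝ • v k a + ∑ j, ⟪x, w j⟫_ℝ • w j = x) ∧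
      (∀ k, 0 < l k ∧ A (v k 0) = l k • v k 1 ∧ A (v k 1) = -l k • v k 0) ∧
      (∀ j, A (w j) = 0) := by
  induction n using Nat.strong_induction_on with
  | _ n ih =>
  intro U hn hU
  by_cases h : ∃ x ∈ U, A x ≠ 0
  · obtain ⟨x, hx, y, hy, l₀, hl₀, hxx, hyy, hxy, hAx, hAy⟩ := exists_skew_pair hA U hU h
    have hyx : ⟪y, x⟫_ℝ = 0 := by rw [real_inner_comm, hxy]
    have hnx : ‖x‖ = 1 := by
      rwa [real_inner_self_eq_norm_sq, pow_eq_one_iff_of_nonneg (norm_nonneg x) two_ne_zero] at hxx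
    have hny : ‖y‖ = 1 := by
      rwa [real_inner_self_eq_norm_sq, pow_eq_one_iff_of_nonneg (norm_nonneg y) two_ne_zero] at hyy
    -- The orthogonal in `U` of the invariant plane is again invariant by skewness, and is smaller
    -- since it misses `x`.
    let U' : Submodule ℝ F := U ⊓ LinearMap.ker (innerₛₗ ℝ x) ⊓ LinearMap.ker (innerₛₗ ℝ y)
    have hU' : ∀ z, z ∈ U' ↔ z ∈ U ∧ ⟪x, z⟫_ℝ = 0 ∧ ⟪y, z⟫_ℝ = 0 := fun z => by
      simp [U', and_assoc]
    have hlt : Module.finrank ℝ U' < n := by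
      rw [← hn]
      refine Submodule.finrank_lt_finrank_of_lt (lt_of_le_of_ne ?_ ?_)
      · exact fun z hz => ((hU' z).1 hz).1
      · intro he
        have := (hU' x).1 (he ▸ hx)
        rw [hxx] at this
        exact one_ne_zero this.2.1
    obtain ⟨r, q, v, w, l, hv, hw, hvv, hvw, hww, hc, hl, hAw⟩ := ih _ hlt U' rfl (by
      intro z hz
      obtain ⟨h1, h2, h3⟩ := (hU' z).1 hz
      refine (hU' _).2 ⟨hU z h1, ?_, ?_⟩
      · have := hA x z
        rw [hAx, inner_smul_left, h3] at this
        simpa using this.symm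
      · have := hA y z
        rw [hAy, inner_smul_left, h2] at this
        simpa using this.symm)
    have hxv : ∀ k a, ⟪x, v k a⟫_ℝ = 0 := fun k a => ((hU' _).1 (hv k a)).2.1
    have hyv : ∀ k a, ⟪y, v k a⟫_ℝ = 0 := fun k a => ((hU' _).1 (hv k a)).2.2
    have hxw : ∀ j, ⟪x, w j⟫_ℝ = 0 := fun j => ((hU' _).1 (hw j)).2.1
    have hyw : ∀ j, ⟪y, w j⟫_ℝ = 0 := fun j => ((hU' _).1 (hw j)).2.2
    have hvx : ∀ k a, ⟪v k a, x⟫_ℝ = 0 := fun k a => by rw [real_inner_comm, hxv]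
    have hvy : ∀ k a, ⟪v k a, y⟫_ℝ = 0 := fun k a => by rw [real_inner_comm, hyv]
    refine ⟨r + 1, q, Fin.cons ![x, y] v, w, Fin.cons l₀ l, ?_, ?_, ?_, ?_, hww, ?_, ?_, hAw⟩
    · refine Fin.cases ?_ fun k a => ?_
      · intro a
        fin_cases a
        · exact hx
        · exact hy
      · exact ((hU' _).1 (hv k a)).1
    · exact fun j => ((hU' _).1 (hw j)).1
    · refine Fin.cases (fun a => ?_) fun k a => ?_
      · refine Fin.cases (fun a' => ?_) fun k' a' => ?_
        · fin_cases a <;> fin_cases a' <;> simp [hnx, hny, hxy, hyx]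
        · fin_cases a <;> simp [hxv, hyv, (Fin.succ_ne_zero k').symm]
      · refine Fin.cases (fun a' => ?_) fun k' a' => ?_
        · fin_cases a' <;> simp [hvx, hvy, Fin.succ_ne_zero k]
        · simpa using hvv k a k' a'
    · refine Fin.cases (fun a j => ?_) fun k a j => ?_
      · fin_cases a <;> simp [hxw, hyw]
      · exact hvw k a j
    · intro z hz
      have hz' : z - ⟪z, x⟫_ℝ • x - ⟪z, y⟫_ℝ • y ∈ U' := by
        refine (hU' _).2 ⟨U.sub_mem (U.sub_mem hz (U.smul_mem _ hx)) (U.smul_mem _ hy), ?_, ?_⟩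
        · rw [inner_sub_right, inner_sub_right, inner_smul_right, inner_smul_right, hxx, hxy,
            real_inner_comm]
          ring
        · rw [inner_sub_right, inner_sub_right, inner_smul_right, inner_smul_right, hyy, hyx,
            real_inner_comm]
          ring
      have h1 := hc _ hz'
      simp only [inner_sub_left, inner_smul_left, hxv, hyv, hxw, hyw, mul_zero, sub_zero] at h1
      rw [Fin.sum_univ_succ]
      simp only [Fin.cons_zero, Fin.cons_succ, Fin.sum_univ_two (M := F),
        Matrix.cons_val_zero, Matrix.cons_val_one] at h1 ⊢
      rw [add_assoc, h1]
      abel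
    · refine Fin.cases ?_ fun k => ?_
      · exact ⟨hl₀, hAx, hAy⟩
      · exact hl k
  · push Not at h
    let b := stdOrthonormalBasis ℝ U
    refine ⟨0, _, Fin.elim0, fun j => (b j : F), Fin.elim0, fun k => k.elim0, fun j => (b j).2,
      fun k => k.elim0, fun k => k.elim0, ?_, ?_, fun k => k.elim0, fun j => h _ (b j).2⟩
    · intro j j'
      exact orthonormal_iff_ite.1 b.orthonormal j j'
    · intro x hx
      have h1 := congrArg Subtype.val (b.sum_repr ⟨x, hx⟩)
      rw [AddSubmonoidClass.coe_finsetSum] at h1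
      simp only [Finset.univ_eq_empty, Finset.sum_empty, zero_add]
      conv_rhs => rw [← show ((⟨x, hx⟩ : U) : F) = x from rfl, ← h1]
      refine Finset.sum_congr rfl fun j _ => ?_
      rw [b.repr_apply_apply, Submodule.coe_smul, real_inner_comm]
      rfl

end Skew


section SkewBasis

open scoped InnerProductSpace

variable {V : Type*} [AddCommGroup V] [Module ℝ V] {B : V →ₗ[ℝ] V →ₗ[ℝ] ℝ}

/-- The normal form of a skew-symmetric bilinear form on a positive definite subspace. -/
lemma exists_skew_basis [FiniteDimensional ℝ V] (hs : ∀ u v, B u v = B v u)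
    (U : Submodule ℝ V) (hU : ∀ x ∈ U, x ≠ 0 → 0 < B x x) (om : V →ₗ[ℝ] V →ₗ[ℝ] ℝ)
    (hom : ∀ x y, om x y = -om y x) :
    ∃ (r q : ℕ) (v : Fin r × Fin 2 → V) (w : Fin q → V) (l : Fin r → ℝ),
      (∀ k, 0 < l k) ∧ Monotone l ∧ IsOrthonormalFamily B U (Sum.elim v w) ∧
      ∀ x ∈ U, (∀ k, om (v (k, 0)) x = l k * B (v (k, 1)) x) ∧
        (∀ k, om (v (k, 1)) x = -(l k * B (v (k, 0)) x)) ∧ ∀ j, om (w j) x = 0 := by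
  obtain ⟨n, c, hc⟩ := exists_isOrthonormalFamily hs U hU
  let f : EuclideanSpace ℝ (Fin n) →ₗ[ℝ] V :=
    Fintype.linearCombination ℝ c ∘ₗ (WithLp.linearEquiv 2 ℝ (Fin n → ℝ)).toLinearMap
  have hf : ∀ x, f x = ∑ i, x i • c i := fun x => rfl
  -- The operator that represents `om` in the orthonormal coordinates given by `c`.
  let A : EuclideanSpace ℝ (Fin n) →ₗ[ℝ] EuclideanSpace ℝ (Fin n) :=
    (WithLp.linearEquiv 2 ℝ (Fin n → ℝ)).symm.toLinearMap ∘ₗ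
      LinearMap.pi fun i => (om.flip (c i)) ∘ₗ f
  have hA' : ∀ x i, A x i = om (f x) (c i) := fun x i => rfl
  have hfi : ∀ x y, B (f x) (f y) = ⟪x, y⟫_ℝ := by
    intro x y
    rw [hf, hf]
    simp [hc.orthonormal, PiLp.inner_apply, mul_comm]
  have hAi : ∀ x y, ⟪A x, y⟫_ℝ = om (f x) (f y) := by
    intro x y
    rw [hf y]
    simp [PiLp.inner_apply, hA']
  have hmem : ∀ x, f x ∈ U := fun x => by
    rw [hf]
    exact U.sum_mem fun i _ => U.smul_mem _ (hc.mem i)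
  have hsurj : ∀ x ∈ U, ∃ y, f y = x := fun x hx =>
    ⟨WithLp.toLp 2 fun i => B x (c i), by rw [hf]; exact hc.sum_smul x hx⟩
  obtain ⟨r, q, v, w, l, -, -, hvv, hvw, hww, hcomp, hl, hw⟩ :=
    exists_skew_normal_form (A := A) (fun x y => by
      rw [hAi, real_inner_comm, hAi, hom]) _ ⊤ rfl (fun _ _ => Submodule.mem_top)
  -- The planes are reordered so that the `l k` increase.
  let σ := Tuple.sort l
  refine ⟨r, q, fun i => f (v (σ i.1) i.2), fun j => f (w j), l ∘ σ, fun k => (hl _).1,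
    Tuple.monotone_sort l, ⟨?_, ?_, ?_⟩, ?_⟩
  · rintro (i | j)
    · exact hmem _
    · exact hmem _
  · rintro (⟨k, a⟩ | j) (⟨k', a'⟩ | j')
    · simp [hfi, hvv]
    · simp [hfi, hvw]
    · simp only [Sum.elim_inl, Sum.elim_inr, hfi, reduceCtorEq, if_false]
      rw [real_inner_comm, hvw]
    · simp [hfi, hww]
  · intro x hx
    obtain ⟨y, rfl⟩ := hsurj x hx
    conv_rhs => rw [← hcomp y Submodule.mem_top]
    rw [Fintype.sum_sum_type, Fintype.sum_prod_type, map_add, map_sum, map_sum]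
    simp only [Sum.elim_inl, Sum.elim_inr, hfi, map_sum, map_smul]
    congr 1
    exact Equiv.sum_comp σ fun k => ∑ a, ⟪y, v k a⟫_ℝ • f (v k a)
  · intro x hx
    obtain ⟨y, rfl⟩ := hsurj x hx
    refine ⟨fun k => ?_, fun k => ?_, fun j => ?_⟩
    · rw [← hAi, (hl _).2.1, hfi, inner_smul_left]; rfl
    · rw [← hAi, (hl _).2.2, hfi, inner_smul_left]; simp
    · rw [← hAi, hw, inner_zero_left]

end SkewBasis

/-! ### The Ricci form in a decomposition adapted to a null central vector. -/

section Adapted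

variable {V : Type*} [AddCommGroup V] [Module ℝ V]
  {B : V →ₗ[ℝ] V →ₗ[ℝ] ℝ} {br pr : V →ₗ[ℝ] V →ₗ[ℝ] V}
  {ρ κ : Type*} [Fintype ρ] [Fintype κ] {e e' : V} {z : ρ → V} {c : κ → V}

/-- A decomposition of a metric 2-step nilpotent Lie algebra: `e`, `e'` are null vectors which span
a hyperbolic plane, and `z`, `c` form an orthonormal basis of the orthogonal of this plane, such
that `e` and `z` span the center modulo `c`, and contain the derived ideal. -/
structure IsAdapted (B : V →ₗ[ℝ] V →ₗ[ℝ] ℝ) (br : V →ₗ[ℝ] V →ₗ[ℝ] V) (e e' : V) (z : ρ → V)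
    (c : κ → V) : Prop where
  decomp (x y : V) : B x y = B x e' * B e y + B x e * B e' y + ∑ l, B x (z l) * B (z l) y
    + ∑ i, B x (c i) * B (c i) y
  central_e (x : V) : br e x = 0
  central_z (l : ρ) (x : V) : br (z l) x = 0
  orth_e (x y : V) : B (br x y) e = 0
  orth_c (x y : V) (i : κ) : B (br x y) (c i) = 0

lemma IsAdapted.isDual (h : IsAdapted B br e e' z c) :
    IsDual B (Sum.elim (fun t : Bool => if t then e else e') (Sum.elim z c))
      (Sum.elim (fun t : Bool => if t then e' else e) (Sum.elim z c)) := by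
  intro x y
  rw [h.decomp x y]
  simp [Fintype.sum_sum_type]
  ring

lemma IsAdapted.eq_sum (hB : IsScalarProduct B) (h : IsAdapted B br e e' z c) (x : V) :
    x = B x e' • e + B x e • e' + ∑ l, B x (z l) • z l + ∑ i, B x (c i) • c i := by
  refine hB.eq_of_forall fun y => ?_
  rw [h.decomp x y]
  simp

/-- Each dual pair containing e' also contains the central vector e, and the z are central, so only
the spacelike vectors `c` contribute. -/
lemma IsAdapted.trace_curv [FiniteDimensional ℝ V] (hB : IsScalarProduct B)
    (h : IsAdapted B br e e' z c) (hbr : ∀ u v, br u v = -br v u)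
    (h2 : ∀ u v w, br (br u v) w = 0) (hpr : IsKoszul B br pr) (u v : V) :
    LinearMap.trace ℝ V (curv br pr u v) =
      -(1 / 2) * ∑ i, B (br u (c i)) (br v (c i)) +
      (1 / 4) * ∑ i, ∑ k, B (br (c i) (c k)) v * B (br (c i) (c k)) u := by
  have he : ∀ x, br x e = 0 := fun x => by rw [hbr, h.central_e, neg_zero]
  have hz : ∀ x l, br x (z l) = 0 := fun x l => by rw [hbr, h.central_z, neg_zero]
  rw [h.isDual.trace_curv hB hbr h2 hpr]
  simp [Fintype.sum_sum_type, he, hz, h.central_e, h.central_z]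

/-- Brackets of the `c` now lie in ℝe, and e is orthogonal to all brackets. Hence `u` and `v` enter
only through their e'-components B(u,e), B(v,e), and the form has rank at most one. -/
lemma IsAdapted.trace_curv_of_isotropic [FiniteDimensional ℝ V] (hB : IsScalarProduct B)
    (h : IsAdapted B br e e' z c) (hbr : ∀ u v, br u v = -br v u)
    (h2 : ∀ u v w, br (br u v) w = 0) (hpr : IsKoszul B br pr)
    (hcc : ∀ i k l, B (br (c i) (c k)) (z l) = 0) (u v : V) :
    LinearMap.trace ℝ V (curv br pr u v) = B u e * B v e *
      ((1 / 4) * ∑ i, ∑ k, B (br (c i) (c k)) e' ^ 2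
        - (1 / 2) * ∑ i, ∑ l, B (br e' (c i)) (z l) ^ 2) := by
  have e1 : ∀ u i l, B (br u (c i)) (z l) = B u e * B (br e' (c i)) (z l) := by
    intro u i l
    conv_lhs => rw [h.eq_sum hB u]
    simp [h.central_e, h.central_z, hcc]
  have e2 : ∀ i, B (br u (c i)) (br v (c i)) =
      B u e * B v e * ∑ l, B (br e' (c i)) (z l) ^ 2 := by
    intro i
    rw [h.decomp, h.orth_e, hB.symm e, h.orth_e, Finset.mul_sum]
    simp only [h.orth_c, zero_mul, mul_zero, Finset.sum_const_zero, zero_add, add_zero]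
    refine Finset.sum_congr rfl fun l _ => ?_
    rw [hB.symm (z l), e1 u, e1 v]
    ring
  have e3 : ∀ i k w, B (br (c i) (c k)) w = B w e * B (br (c i) (c k)) e' := by
    intro i k w
    rw [h.decomp, h.orth_e, hB.symm e]
    simp only [h.orth_c, hcc, zero_mul, Finset.sum_const_zero, add_zero]
    ring
  rw [h.trace_curv hB hbr h2 hpr]
  simp only [e2, e3 _ _ u, e3 _ _ v]
  rw [← Finset.mul_sum]
  have e4 : ∑ i, ∑ k, B v e * B (br (c i) (c k)) e' * (B u e * B (br (c i) (c k)) e') =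
      B u e * B v e * ∑ i, ∑ k, B (br (c i) (c k)) e' ^ 2 := by
    simp only [Finset.mul_sum]
    exact Finset.sum_congr rfl fun i _ => Finset.sum_congr rfl fun k _ => by ring
  rw [e4]
  ring

end Adapted


/-! ### Ricci flatness forces the center to be degenerate. -/

section NullVector

variable {V : Type*} [AddCommGroup V] [Module ℝ V]
  {B : V →ₗ[ℝ] V →ₗ[ℝ] ℝ} {br pr : V →ₗ[ℝ] V →ₗ[ℝ] V}

lemma IsLorentzian.exists_isDual (hL : IsLorentzian fun u v => B u v) :
    ∃ (m : ℕ) (b d : Fin m → V), IsDual B b d := by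
  obtain ⟨m, b, hb⟩ := hL
  replace hb : ∀ i j, B (b i) (b j) = if i = j then (if i = 0 then -1 else 1) else 0 := hb
  refine ⟨m + 1, b, fun i => (if i = 0 then (-1 : ℝ) else 1) • b i, fun x y => ?_⟩
  have h1 : ∀ x i, B x (b i) = (if i = 0 then (-1 : ℝ) else 1) * b.repr x i := by
    intro x i
    conv_lhs => rw [← b.sum_repr x]
    simp [hb, -Module.Basis.sum_repr]
  have h2 : ∀ y i, B (b i) y = (if i = 0 then (-1 : ℝ) else 1) * b.repr y i := by
    intro x i
    conv_lhs => rw [← b.sum_repr x]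
    simp [hb, -Module.Basis.sum_repr]
  rw [bilin_eq_of_orthonormal b hb, Fin.sum_univ_succ]
  simp [h1, h2, Fin.succ_ne_zero]

lemma isDual_of_orthogonal {ι : Type*} [Fintype ι] [DecidableEq ι] (hs : ∀ u v, B u v = B v u)
    {v₀ : V} (hv₀ : B v₀ v₀ ≠ 0) {c : ι → V}
    (hc : IsOrthonormalFamily B (LinearMap.ker (B v₀)) c) :
    IsDual B (Sum.elim (fun _ : Unit => v₀) c)
      (Sum.elim (fun _ : Unit => (B v₀ v₀)⁻¹ • v₀) c) := by
  intro x y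
  have hx : x - (B v₀ x * (B v₀ v₀)⁻¹) • v₀ ∈ LinearMap.ker (B v₀) := by
    rw [LinearMap.mem_ker, map_sub, map_smul, smul_eq_mul, mul_assoc, inv_mul_cancel₀ hv₀, mul_one,
      sub_self]
  have h1 := hc.sum_smul _ hx
  have h2 : ∀ i, B v₀ (c i) = 0 := fun i => hc.mem i
  have h3 := congrArg (fun u => B u y) h1
  simp only [map_sub, map_smul, LinearMap.sub_apply, LinearMap.smul_apply, h2, map_sum,
    LinearMap.sum_apply, smul_eq_mul, mul_zero, sub_zero] at h3
  simp [Fintype.sum_sum_type, h3, hs x v₀]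
  ring

variable [FiniteDimensional ℝ V]

/-- If the Ricci form vanishes, then the orthogonal of the center contains no timelike vector. -/
lemma nonneg_of_orthogonal_center (hL : IsLorentzian fun u v => B u v) (hB : IsScalarProduct B)
    (hbr : ∀ u v, br u v = -br v u) (h2 : ∀ u v w, br (br u v) w = 0) (hpr : IsKoszul B br pr)
    (hR : ∀ u v, LinearMap.trace ℝ V (curv br pr u v) = 0) {v₀ : V}
    (hv₀ : ∀ z, (∀ x, br z x = 0) → B v₀ z = 0) : 0 ≤ B v₀ v₀ := by
  by_contra! hneg
  obtain ⟨n, c, hc⟩ := exists_isOrthonormalFamily hB.symm (LinearMap.ker (B v₀))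
    fun x hx hx0 => hL.pos_of_timelike hneg hx hx0
  have hself : br v₀ v₀ = 0 := by
    have h := hbr v₀ v₀
    rwa [eq_neg_iff_add_eq_zero, ← two_smul ℝ, smul_eq_zero_iff_right two_ne_zero] at h
  -- Brackets are central, hence orthogonal to `v₀`. The second Ricci term thus vanishes at `v₀`,
  -- and the first is a sum of squares in the positive definite space orthogonal to `v₀`.
  have horth : ∀ x y, B v₀ (br x y) = 0 := fun x y => hv₀ _ (h2 x y)
  have h := hR v₀ v₀
  rw [(isDual_of_orthogonal hB.symm hneg.ne hc).trace_curv hB hbr h2 hpr] at h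
  simp only [hB.symm _ v₀, horth] at h
  simp only [Fintype.sum_sum_type, Sum.elim_inl, Sum.elim_inr, hself, map_zero,
    LinearMap.zero_apply, Finset.sum_const_zero, mul_zero, add_zero, zero_add, mul_eq_zero] at h
  have h' : ∑ i, B (br v₀ (c i)) (br v₀ (c i)) = 0 := by
    rcases h with h | h
    · norm_num at h
    · exact h
  have hnn : ∀ x y, br x y ≠ 0 → 0 < B (br x y) (br x y) := fun x y hxy =>
    hL.pos_of_timelike hneg (horth x y) hxy
  have hci : ∀ i, br v₀ (c i) = 0 := by
    intro i
    by_contra hi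
    have h3 : ∀ j ∈ Finset.univ, 0 ≤ B (br v₀ (c j)) (br v₀ (c j)) := fun j _ => by
      by_cases hj : br v₀ (c j) = 0
      · simp [hj]
      · exact (hnn _ _ hj).le
    exact (hnn _ _ hi).ne' ((Finset.sum_eq_zero_iff_of_nonneg h3).1 h' i (Finset.mem_univ i))
  have hcentral : ∀ x, br v₀ x = 0 := by
    intro x
    have hx := ((isDual_of_orthogonal hB.symm hneg.ne hc).symm hB).sum_smul hB x
    rw [← hx, map_sum]
    simp [Fintype.sum_sum_type, hself, hci]
  exact hneg.ne (hv₀ v₀ hcentral)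

omit [FiniteDimensional ℝ V] in
-- Reduces a contraction over a basis of the Lorentzian space to an orthonormal family of the
-- orthogonal of the center, where sums of squares appear.
lemma IsDual.sum_mul_of_expansion (hB : IsScalarProduct B) {ι κ : Type*} [Fintype ι] [Fintype κ]
    {b d : ι → V} {c : κ → V} (h : IsDual B b d) {f g : V →ₗ[ℝ] ℝ}
    (hf : ∀ x, f x = ∑ j, B x (c j) * f (c j)) :
    ∑ i, f (b i) * g (d i) = ∑ j, f (c j) * g (c j) := by
  have h1 : ∀ i, f (b i) * g (d i) = ∑ j, f (c j) * (B (c j) (b i) * g (d i)) := fun i => by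
    rw [hf (b i), Finset.sum_mul]
    refine Finset.sum_congr rfl fun j _ => ?_
    rw [hB.symm (c j)]
    ring
  simp only [h1]
  rw [Finset.sum_comm]
  refine Finset.sum_congr rfl fun j _ => ?_
  rw [← Finset.mul_sum, h.sum_mul hB]

/-- If the Ricci form vanishes, then the center is degenerate. -/
lemma exists_null_central (hL : IsLorentzian fun u v => B u v) (hB : IsScalarProduct B)
    (hbr : ∀ u v, br u v = -br v u) (h2 : ∀ u v w, br (br u v) w = 0) (hne : ∃ u v, br u v ≠ 0)
    (hpr : IsKoszul B br pr) (hR : ∀ u v, LinearMap.trace ℝ V (curv br pr u v) = 0) :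
    ∃ e, e ≠ 0 ∧ (∀ x, br e x = 0) ∧ ∀ z, (∀ x, br z x = 0) → B e z = 0 := by
  by_contra! hcon
  have hcon' : ∀ e, (∀ x, br e x = 0) → (∀ z, (∀ x, br z x = 0) → B e z = 0) → e = 0 := by
    intro e h3 h4
    by_contra h5
    obtain ⟨z, hz, hz'⟩ := hcon e h5 h3
    exact hz' (h4 z hz)
  let K : Submodule ℝ V := LinearMap.ker br
  have hK : ∀ z, z ∈ K ↔ ∀ x, br z x = 0 := fun z => by
    rw [LinearMap.mem_ker]
    exact ⟨fun h x => by rw [h, LinearMap.zero_apply], fun h => LinearMap.ext h⟩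
  let K' : Submodule ℝ V := LinearMap.BilinForm.orthogonal B K
  have hK' : ∀ y, y ∈ K' ↔ ∀ z ∈ K, B z y = 0 := fun y => LinearMap.BilinForm.mem_orthogonal_iff
  have hKK : LinearMap.BilinForm.orthogonal B K' = K := by
    refine LinearMap.BilinForm.orthogonal_orthogonal ⟨hB.nondegenerate, fun y h => ?_⟩ ?_ K
    · exact hB.nondegenerate y fun v => by rw [hB.symm, h]
    · intro x y h
      rw [hB.symm, h]
  have hmemK : ∀ x, (∀ y ∈ K', B x y = 0) → x ∈ K := fun x h => by
    rw [← hKK, LinearMap.BilinForm.mem_orthogonal_iff]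
    exact fun y hy => by rw [hB.symm, h y hy]
  have hnn : ∀ y ∈ K', 0 ≤ B y y := fun y hy =>
    nonneg_of_orthogonal_center hL hB hbr h2 hpr hR fun z hz => by
      rw [hB.symm]; exact (hK' y).1 hy z ((hK z).2 hz)
  -- A null vector of the semidefinite space `K'` is orthogonal to all of `K'`, so it lies in `K ⊓
  -- K'`, which is zero by `hcon'`.
  have hpos : ∀ y ∈ K', y ≠ 0 → 0 < B y y := by
    intro y hy hy0
    rcases (hnn y hy).lt_or_eq with h | h
    · exact h
    · exfalso
      apply hy0
      refine hcon' y ((hK y).1 (hmemK y fun w hw => ?_)) fun z hz => by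
        rw [hB.symm]; exact (hK' y).1 hy z ((hK z).2 hz)
      have hq : ∀ t : ℝ, 0 ≤ 2 * t * B y w + t ^ 2 * B w w := by
        intro t
        have h3 := hnn (y + t • w) (K'.add_mem hy (K'.smul_mem t hw))
        simp only [map_add, map_smul, LinearMap.add_apply, LinearMap.smul_apply, smul_eq_mul,
          ← h, hB.symm w y] at h3
        linarith
      by_contra hyw
      have hw1 : 0 < B w w + 1 := by linarith [hnn w hw]
      -- Near the minimum of the quadratic; the added 1 keeps the denominator positive when `w` is
      -- null.
      have h4 := hq (-(B y w) / (B w w + 1))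
      have h5 : 2 * (-(B y w) / (B w w + 1)) * B y w + (-(B y w) / (B w w + 1)) ^ 2 * B w w =
          -((B y w) ^ 2 * (B w w + 2)) / (B w w + 1) ^ 2 := by
        field_simp
        ring
      rw [h5] at h4
      have h6 : 0 < (B y w) ^ 2 * (B w w + 2) := mul_pos (by positivity) (by linarith)
      have h7 : -((B y w) ^ 2 * (B w w + 2)) / (B w w + 1) ^ 2 < 0 :=
        div_neg_of_neg_of_pos (by linarith) (by positivity)
      linarith
  obtain ⟨n, c, hc⟩ := exists_isOrthonormalFamily hB.symm K' hpos
  -- The remainder of `x` after projection on the `c j` is orthogonal to `K'`, hence central.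
  have hres : ∀ x y, br x y = ∑ j, B x (c j) • br (c j) y := by
    intro x y
    have h3 : x - ∑ j, B x (c j) • c j ∈ K := hmemK _ fun w hw => by
      conv_lhs => rw [← hc.sum_smul w hw]
      simp only [map_sub, LinearMap.sub_apply, map_sum, map_smul, LinearMap.sum_apply,
        LinearMap.smul_apply, smul_eq_mul, hc.orthonormal, mul_ite, mul_one, mul_zero,
        Finset.sum_ite_eq', Finset.mem_univ, if_true]
      simp [mul_comm]
    have h4 := (hK _).1 h3 y
    rw [map_sub, LinearMap.sub_apply, sub_eq_zero] at h4
    rw [h4]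
    simp
  -- For central `z` only the second Ricci term survives, as a sum of squares of B([c_i,c_j],z). So
  -- [c_i,c_j] is central and orthogonal to the center.
  have hcc : ∀ i j, br (c i) (c j) = 0 := by
    intro i j
    refine hcon' _ (h2 _ _) fun z hz => ?_
    obtain ⟨m, b, d, hbd⟩ := hL.exists_isDual
    have h3 := hR z z
    rw [hbd.trace_curv hB hbr h2 hpr] at h3
    simp only [hz, map_zero, Finset.sum_const_zero, mul_zero, zero_add, mul_eq_zero] at h3
    have h4 : ∑ i, ∑ k, B (br (b i) (b k)) z * B (br (d i) (d k)) z = 0 := by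
      rcases h3 with h3 | h3
      · norm_num at h3
      · exact h3
    have hexp : ∀ x y, B (br x y) z = ∑ j, B x (c j) * B (br (c j) y) z := fun x y => by
      conv_lhs => rw [hres]
      simp
    have hexp' : ∀ x y, B (br y x) z = ∑ j, B x (c j) * B (br y (c j)) z := fun x y => by
      rw [hbr, map_neg, LinearMap.neg_apply, hexp, ← Finset.sum_neg_distrib]
      refine Finset.sum_congr rfl fun j _ => ?_
      rw [hbr (c j)]
      simp
    have h5 : ∀ k, ∑ i, B (br (b i) (b k)) z * B (br (d i) (d k)) z =
        ∑ j, B (br (c j) (b k)) z * B (br (c j) (d k)) z := fun k =>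
      hbd.sum_mul_of_expansion hB (f := B.flip z ∘ₗ br.flip (b k))
        (g := B.flip z ∘ₗ br.flip (d k)) fun x => hexp x (b k)
    have h6 : ∀ j, ∑ k, B (br (c j) (b k)) z * B (br (c j) (d k)) z =
        ∑ k, B (br (c j) (c k)) z * B (br (c j) (c k)) z := fun j =>
      hbd.sum_mul_of_expansion hB (f := B.flip z ∘ₗ br (c j))
        (g := B.flip z ∘ₗ br (c j)) fun x => hexp' x (c j)
    rw [Finset.sum_comm] at h4
    simp only [h5] at h4
    rw [Finset.sum_comm] at h4
    simp only [h6] at h4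
    have h7 := (Finset.sum_eq_zero_iff_of_nonneg fun i _ =>
      Finset.sum_nonneg fun k _ => mul_self_nonneg _).1 h4 i (Finset.mem_univ i)
    have h8 := (Finset.sum_eq_zero_iff_of_nonneg fun k _ => mul_self_nonneg _).1 h7 j
      (Finset.mem_univ j)
    exact mul_self_eq_zero.1 h8
  obtain ⟨u, v, huv⟩ := hne
  apply huv
  have h3 : ∀ j, br (c j) v = 0 := fun j => by
    rw [hbr, hres, neg_eq_zero]
    exact Finset.sum_eq_zero fun k _ => by rw [hcc, smul_zero]
  rw [hres]
  exact Finset.sum_eq_zero fun k _ => by rw [h3, smul_zero]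

end NullVector


/-! ### Existence of an adapted basis. -/

section AdaptedBasis

variable {V : Type*} [AddCommGroup V] [Module ℝ V]
  {B : V →ₗ[ℝ] V →ₗ[ℝ] ℝ} {br pr : V →ₗ[ℝ] V →ₗ[ℝ] V} {p r q : ℕ}

/-- A basis `e, e', z, v, w` of a metric 2-step nilpotent Lie algebra which is adapted to its
structure: `e, e'` is a hyperbolic pair whose orthogonal has the orthonormal basis `z, v, w`, and
the bracket, restricted to the span of `v, w`, has values in the line spanned by `e` and is in
normal form. -/
structure IsAdaptedBasis (B : V →ₗ[ℝ] V →ₗ[ℝ] ℝ) (br : V →ₗ[ℝ] V →ₗ[ℝ] V) (e e' : V)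
    (z : Fin p → V) (v : Fin r × Fin 2 → V) (w : Fin q → V) (lam : Fin r → ℝ) : Prop extends
    IsAdapted B br e e' z (Sum.elim v w) where
  ee : B e e = 0
  ee' : B e e' = 1
  e'e' : B e' e' = 0
  ez (l : Fin p) : B e (z l) = 0
  e'z (l : Fin p) : B e' (z l) = 0
  ec (i : (Fin r × Fin 2) ⊕ Fin q) : B e (Sum.elim v w i) = 0
  e'c (i : (Fin r × Fin 2) ⊕ Fin q) : B e' (Sum.elim v w i) = 0
  zz (l l' : Fin p) : B (z l) (z l') = if l = l' then 1 else 0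
  zc (l : Fin p) (i : (Fin r × Fin 2) ⊕ Fin q) : B (z l) (Sum.elim v w i) = 0
  cc (i j : (Fin r × Fin 2) ⊕ Fin q) :
    B (Sum.elim v w i) (Sum.elim v w j) = if i = j then 1 else 0
  isotropic (i j : (Fin r × Fin 2) ⊕ Fin q) (l : Fin p) :
    B (br (Sum.elim v w i) (Sum.elim v w j)) (z l) = 0
  br_v0 (k : Fin r) (i : (Fin r × Fin 2) ⊕ Fin q) :
    B (br (v (k, 0)) (Sum.elim v w i)) e' = lam k * B (v (k, 1)) (Sum.elim v w i)
  br_v1 (k : Fin r) (i : (Fin r × Fin 2) ⊕ Fin q) :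
    B (br (v (k, 1)) (Sum.elim v w i)) e' = -(lam k * B (v (k, 0)) (Sum.elim v w i))
  br_w (j : Fin q) (i : (Fin r × Fin 2) ⊕ Fin q) : B (br (w j) (Sum.elim v w i)) e' = 0

/-- The null central vector is completed to a hyperbolic pair, and the positive definite orthogonal
is split into its central part and the rest. The last clause, that `z` exhausts the central part, is
what later gives the span condition. -/
theorem exists_isAdaptedBasis [FiniteDimensional ℝ V]
    (hL : IsLorentzian fun u v => B u v) (hB : IsScalarProduct B)
    (hbr : ∀ u v, br u v = -br v u) (h2 : ∀ u v w, br (br u v) w = 0) (hne : ∃ u v, br u v ≠ 0)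
    (hpr : IsKoszul B br pr) (hR : ∀ u v, LinearMap.trace ℝ V (curv br pr u v) = 0) :
    ∃ (p r q : ℕ) (e e' : V) (z : Fin p → V) (v : Fin r × Fin 2 → V) (w : Fin q → V)
      (lam : Fin r → ℝ), IsAdaptedBasis B br e e' z v w lam ∧ (∀ k, 0 < lam k) ∧ Monotone lam ∧
      ∀ x, B x e = 0 → B x e' = 0 → (∀ l, B x (z l) = 0) → (∀ y, br x y = 0) → x = 0 := by
  obtain ⟨e, he0, hec, he⟩ := exists_null_central hL hB hbr h2 hne hpr hR
  have hee : B e e = 0 := he e hec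
  obtain ⟨y₀, hy₀⟩ : ∃ y, B e y ≠ 0 := by
    by_contra! h
    exact he0 (hB.nondegenerate e h)
  obtain ⟨e', hee', he'e'⟩ : ∃ e', B e e' = 1 ∧ B e' e' = 0 := by
    let y := (B e y₀)⁻¹ • y₀
    have hy : B e y = 1 := by simp [y, hy₀]
    -- Moving along the null vector `e` keeps the pairing with `e` and removes the square of `y`.
    refine ⟨y - (1 / 2 * B y y) • e, by simp [hee, hy], ?_⟩
    simp only [map_sub, map_smul, LinearMap.sub_apply, LinearMap.smul_apply, smul_eq_mul, hee,
      hB.symm y e, hy]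
    ring
  have he'e : B e' e = 1 := by rw [hB.symm, hee']
  let S : Submodule ℝ V := LinearMap.ker (B e) ⊓ LinearMap.ker (B e')
  have hS : ∀ x, x ∈ S ↔ B e x = 0 ∧ B e' x = 0 := fun x => by
    simp [S]
  have hSpos : ∀ x ∈ S, x ≠ 0 → 0 < B x x := by
    intro x hx hx0
    -- The square of `e - e'` is -2, so its orthogonal is positive definite.
    refine hL.pos_of_timelike (x := e - e') ?_ ?_ hx0
    · simp [hee, hee', he'e', he'e]
    · rw [map_sub, LinearMap.sub_apply, ((hS x).1 hx).1, ((hS x).1 hx).2, sub_zero]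
  let Z : Submodule ℝ V := S ⊓ LinearMap.ker br
  have hZ : ∀ x, x ∈ Z ↔ x ∈ S ∧ ∀ y, br x y = 0 := fun x => by
    simp only [Z, Submodule.mem_inf, LinearMap.mem_ker]
    exact and_congr Iff.rfl
      ⟨fun h y => by rw [h, LinearMap.zero_apply], fun h => LinearMap.ext h⟩
  obtain ⟨p, z, hz⟩ := exists_isOrthonormalFamily hB.symm Z fun x hx => hSpos x ((hZ x).1 hx).1
  let C : Submodule ℝ V := S ⊓ ⨅ l, LinearMap.ker (B (z l))
  have hC : ∀ x, x ∈ C ↔ x ∈ S ∧ ∀ l, B (z l) x = 0 := fun x => by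
    simp [C]
  obtain ⟨r, q, v, w, lam, hlam, hmono, hc, hom⟩ := exists_skew_basis hB.symm C
    (fun x hx => hSpos x ((hC x).1 hx).1) (br.compr₂ (B.flip e')) (fun x y => by
      simp only [LinearMap.compr₂_apply, LinearMap.flip_apply]
      rw [hbr]; simp)
  simp only [LinearMap.compr₂_apply, LinearMap.flip_apply] at hom
  have hez : ∀ l, B e (z l) = 0 := fun l => ((hS _).1 ((hZ _).1 (hz.mem l)).1).1
  have he'z : ∀ l, B e' (z l) = 0 := fun l => ((hS _).1 ((hZ _).1 (hz.mem l)).1).2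
  have hecc : ∀ i, B e (Sum.elim v w i) = 0 := fun i => ((hS _).1 ((hC _).1 (hc.mem i)).1).1
  have he'c : ∀ i, B e' (Sum.elim v w i) = 0 := fun i => ((hS _).1 ((hC _).1 (hc.mem i)).1).2
  have hzc : ∀ l i, B (z l) (Sum.elim v w i) = 0 := fun l i => ((hC _).1 (hc.mem i)).2 l
  have hsum : ∀ x, x = B x e' • e + B x e • e' + ∑ l, B x (z l) • z l
      + ∑ i, B x (Sum.elim v w i) • Sum.elim v w i := by
    intro x
    let s := x - B x e' • e - B x e • e'
    have hs : s ∈ S := (hS s).2 ⟨by simp [s, hee, hee', hB.symm e x],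
      by simp [s, he'e', he'e, hB.symm e' x]⟩
    have hsz : ∀ l, B s (z l) = B x (z l) := fun l => by simp [s, hez, he'z]
    have hsc : ∀ i, B s (Sum.elim v w i) = B x (Sum.elim v w i) := fun i => by
      simp only [s, map_sub, map_smul, LinearMap.sub_apply, LinearMap.smul_apply, hecc, he'c,
        smul_zero, sub_zero]
    let t := s - ∑ l, B s (z l) • z l
    have ht : t ∈ C := by
      refine (hC t).2 ⟨S.sub_mem hs (S.sum_mem fun l _ => S.smul_mem _ ((hZ _).1 (hz.mem l)).1),
        fun l => ?_⟩
      simp [t, hz.orthonormal, hB.symm (z l) s]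
    have htc : ∀ i, B t (Sum.elim v w i) = B s (Sum.elim v w i) := fun i => by
      simp only [t, map_sub, map_sum, map_smul, LinearMap.sub_apply, LinearMap.sum_apply,
        LinearMap.smul_apply, hzc, smul_zero, Finset.sum_const_zero, sub_zero]
    have h1 := hc.sum_smul t ht
    simp only [htc, hsc] at h1
    rw [h1]
    simp only [t, hsz, s]
    abel
  have hadapted : IsAdapted B br e e' z (Sum.elim v w) := by
    refine ⟨fun x y => ?_, hec, fun l => ((hZ _).1 (hz.mem l)).2, fun x y => ?_, fun x y i => ?_⟩
    · conv_lhs => rw [hsum x]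
      simp only [map_add, map_sum, map_smul, LinearMap.add_apply, LinearMap.sum_apply,
        LinearMap.smul_apply, smul_eq_mul]
    · rw [hB.symm, he _ (h2 x y)]
    -- A bracket minus its `e`-component is central and orthogonal to the pair, hence a combination
    -- of the `z l`, which are orthogonal to `v` and `w`.
    · have h1 : br x y - B (br x y) e' • e ∈ Z := by
        refine (hZ _).2 ⟨(hS _).2 ⟨?_, ?_⟩, fun u => ?_⟩
        · simp [he _ (h2 x y), hee]
        · simp [he'e, hB.symm e' (br x y)]
        · rw [map_sub, map_smul, LinearMap.sub_apply, LinearMap.smul_apply, h2, hec, smul_zero,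
            sub_zero]
      have h3 := congrArg (fun u => B u (Sum.elim v w i)) (hz.sum_smul _ h1)
      simp only [map_sub, map_sum, map_smul, LinearMap.sub_apply, LinearMap.sum_apply,
        LinearMap.smul_apply, hzc, hecc, smul_zero, Finset.sum_const_zero, sub_zero] at h3
      exact h3.symm
  refine ⟨p, r, q, e, e', z, v, w, lam, ⟨hadapted, hee, hee', he'e', hez, he'z, hecc, he'c,
    hz.orthonormal, hzc, hc.orthonormal, fun i j l => ?_, fun k i => (hom _ (hc.mem i)).1 k,
    fun k i => (hom _ (hc.mem i)).2.1 k, fun j i => (hom _ (hc.mem i)).2.2 j⟩, hlam, hmono,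
    fun x h3 h4 h5 h6 => ?_⟩
  -- At the central vector `z l` the Ricci form is a sum of squares, and these are the components to
  -- be killed.
  · have h3 := hR (z l) (z l)
    rw [hadapted.trace_curv hB hbr h2 hpr] at h3
    simp only [hadapted.central_z, map_zero, Finset.sum_const_zero, mul_zero, zero_add,
      mul_eq_zero] at h3
    rcases h3 with h3 | h3
    · norm_num at h3
    · have h7 := (Finset.sum_eq_zero_iff_of_nonneg fun i _ =>
        Finset.sum_nonneg fun k _ => mul_self_nonneg _).1 h3 i (Finset.mem_univ i)
      have h8 := (Finset.sum_eq_zero_iff_of_nonneg fun k _ => mul_self_nonneg _).1 h7 j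
        (Finset.mem_univ j)
      exact mul_self_eq_zero.1 h8
  · have hx : x ∈ Z := (hZ x).2 ⟨(hS x).2 ⟨by rw [hB.symm, h3], by rw [hB.symm, h4]⟩, h6⟩
    rw [← hz.sum_smul x hx]
    simp [h5]

end AdaptedBasis


/-! ### The Lie algebra of the model and its left-invariant metric. -/

namespace Params

variable {p r q : ℕ} (D : Params p r q)

/-- The linear form `A · V + B · W`. -/
def lin (x : Space p r q) : ℝ := D.A ⬝ᵥ x.v + D.B ⬝ᵥ x.w

/-- The alternating form in the first component of the group law. -/
def alt (x y : Space p r q) : ℝ :=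
  ∑ k, D.lam k * (x.v (k, 0) * y.v (k, 1) - y.v (k, 0) * x.v (k, 1))

lemma lin_add (x y : Space p r q) : D.lin (x + y) = D.lin x + D.lin y := by
  simp only [lin, Space.v, Space.w, Prod.snd_add, Prod.fst_add, dotProduct_add]
  ring

lemma lin_smul (a : ℝ) (x : Space p r q) : D.lin (a • x) = a * D.lin x := by
  simp only [lin, Space.v, Space.w, Prod.smul_snd, Prod.smul_fst, dotProduct_smul, smul_eq_mul]
  ring

lemma colDot_add (x y : Space p r q) (l : Fin p) :
    D.colDot (x + y) l = D.colDot x l + D.colDot y l := by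
  simp only [colDot, Space.v, Space.w, Prod.snd_add, Prod.fst_add, dotProduct_add]
  ring

lemma colDot_smul (a : ℝ) (x : Space p r q) (l : Fin p) :
    D.colDot (a • x) l = a * D.colDot x l := by
  simp only [colDot, Space.v, Space.w, Prod.smul_snd, Prod.smul_fst, dotProduct_smul, smul_eq_mul]
  ring

lemma alt_swap (x y : Space p r q) : D.alt x y = -D.alt y x := by
  rw [alt, alt, ← Finset.sum_neg_distrib]
  exact Finset.sum_congr rfl fun k _ => by ring

lemma alt_add_left (x x' y : Space p r q) : D.alt (x + x') y = D.alt x y + D.alt x' y := by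
  rw [alt, alt, alt, ← Finset.sum_add_distrib]
  refine Finset.sum_congr rfl fun k _ => ?_
  simp only [Space.v, Prod.snd_add, Prod.fst_add, Pi.add_apply]
  ring

lemma alt_smul_left (a : ℝ) (x y : Space p r q) : D.alt (a • x) y = a * D.alt x y := by
  rw [alt, alt, Finset.mul_sum]
  refine Finset.sum_congr rfl fun k _ => ?_
  simp only [Space.v, Prod.smul_snd, Prod.smul_fst, Pi.smul_apply, smul_eq_mul]
  ring

/-- The Lie bracket on `ℝ² × ℝ^p × ℝ^(2r) × ℝ^q`, as a function. -/
def brFun (x y : Space p r q) : Space p r q :=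
  (D.alt x y + (x.tb * D.lin y - y.tb * D.lin x), 0,
    fun l => x.tb * D.colDot y l - y.tb * D.colDot x l, 0, 0)

lemma brFun_swap (x y : Space p r q) : D.brFun x y = -D.brFun y x := by
  simp only [brFun, D.alt_swap x y, Prod.neg_mk, neg_zero]
  refine Prod.ext (by ring) (Prod.ext rfl (Prod.ext ?_ rfl))
  funext l
  simp

lemma brFun_add_left (x x' y : Space p r q) :
    D.brFun (x + x') y = D.brFun x y + D.brFun x' y := by
  simp only [brFun, alt_add_left, lin_add, colDot_add, Prod.mk_add_mk, add_zero]
  refine Prod.ext ?_ (Prod.ext rfl (Prod.ext ?_ rfl))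
  · simp only [Space.tb, Prod.snd_add, Prod.fst_add]
    ring
  · funext l
    simp only [Space.tb, Prod.snd_add, Prod.fst_add, Pi.add_apply]
    ring

lemma brFun_smul_left (a : ℝ) (x y : Space p r q) : D.brFun (a • x) y = a • D.brFun x y := by
  simp only [brFun, alt_smul_left, lin_smul, colDot_smul, Prod.smul_mk, smul_zero]
  refine Prod.ext ?_ (Prod.ext rfl (Prod.ext ?_ rfl))
  · simp only [Space.tb, Prod.smul_snd, Prod.smul_fst, smul_eq_mul]
    ring
  · funext l
    simp only [Space.tb, Prod.smul_snd, Prod.smul_fst, Pi.smul_apply, smul_eq_mul]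
    ring

/-- The Lie bracket on `ℝ² × ℝ^p × ℝ^(2r) × ℝ^q`. -/
def br : Space p r q →ₗ[ℝ] Space p r q →ₗ[ℝ] Space p r q :=
  LinearMap.mk₂ ℝ D.brFun D.brFun_add_left D.brFun_smul_left
    (fun x y y' => by
      rw [D.brFun_swap, brFun_add_left, D.brFun_swap x, D.brFun_swap x y', neg_add])
    (fun a x y => by rw [D.brFun_swap, brFun_smul_left, D.brFun_swap x, smul_neg])

lemma br_apply (x y : Space p r q) : D.br x y =
  (D.alt x y + (x.tb * D.lin y - y.tb * D.lin x), 0,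
    fun l => x.tb * D.colDot y l - y.tb * D.colDot x l, 0, 0) := rfl

lemma br_swap (x y : Space p r q) : D.br x y = -D.br y x := D.brFun_swap x y

lemma sum_mul_sub {ι : Type*} [Fintype ι] (f g h : ι → ℝ) (a b : ℝ) :
    ∑ i, f i * (a * g i - b * h i) = a * (f ⬝ᵥ g) - b * (f ⬝ᵥ h) := by
  simp only [dotProduct, Finset.mul_sum, ← Finset.sum_sub_distrib]
  exact Finset.sum_congr rfl fun i _ => by ring

lemma mul_eq (x y : Space p r q) : D.mul x y = x + y + (2⁻¹ : ℝ) • D.br x y := by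
  rw [br_apply, mul]
  refine Prod.ext ?_ (Prod.ext ?_ (Prod.ext ?_ (Prod.ext ?_ ?_)))
  · simp only [sum_mul_sub, lin, alt, Prod.fst_add, Prod.smul_fst, smul_eq_mul]
    ring
  · simp [Space.tb]
  · funext l
    have h₁ := sum_mul_sub (D.M₁.col l) y.v x.v x.tb y.tb
    have h₂ := sum_mul_sub (D.M₂.col l) y.w x.w x.tb y.tb
    simp only [Matrix.col_apply] at h₁ h₂
    simp only [h₁, h₂, colDot, Prod.fst_add, Prod.snd_add, Prod.smul_fst, Prod.smul_snd,
      smul_eq_mul, Pi.add_apply, Pi.smul_apply]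
    ring
  · simp [Space.v]
    rfl
  · simp [Space.w]
    rfl

/-- The scalar product with `⟨∂_t, ∂_t̄⟩ = ⟨∂_u_l, ∂_u_l⟩ = ⟨∂_v_i, ∂_v_i⟩ = ⟨∂_w_j, ∂_w_j⟩ = 1`
whose other coefficients are zero. -/
def form (x y : Space p r q) : ℝ :=
  x.t * y.tb + x.tb * y.t + x.u ⬝ᵥ y.u + x.v ⬝ᵥ y.v + x.w ⬝ᵥ y.w

lemma colDot_eq_sum (x : Space p r q) (l : Fin p) :
    D.colDot x l = ∑ i, D.M₁ i l * x.v i + ∑ j, D.M₂ j l * x.w j := rfl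

lemma rowComb_apply (x : Space p r q) (l : Fin p) : D.rowComb x l = D.colDot x l := by
  simp [rowComb, colDot_eq_sum, mul_comm]

lemma sum_gUV_add_sum_gUW (x ξ η : Space p r q) (l : Fin p) :
    ∑ i, D.gUV x l i * (ξ.u l * η.v i + ξ.v i * η.u l)
      + ∑ j, D.gUW x l j * (ξ.u l * η.w j + ξ.w j * η.u l)
      = -(x.tb / 2) * (ξ.u l * D.colDot η l + η.u l * D.colDot ξ l) := by
  simp only [colDot_eq_sum, gUV, gUW, mul_add, Finset.mul_sum, Finset.sum_add_distrib]
  have e : ∀ a b c d a' b' c' d' : ℝ, a = a' → b = b' → c = c' → d = d' →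
      a + b + (c + d) = a' + c' + (b' + d') := by
    rintro a b c d _ _ _ _ rfl rfl rfl rfl
    ring
  refine e _ _ _ _ _ _ _ _ ?_ ?_ ?_ ?_ <;> exact Finset.sum_congr rfl fun i _ => by ring

lemma sum_gTbV_add_sum_gTbW (x ζ : Space p r q) :
    ∑ i, D.gTbV x i * ζ.v i + ∑ j, D.gTbW x j * ζ.w j
      = -(1 / 2) * D.alt x ζ - 1 / 2 * x.tb * D.lin ζ
        - x.tb / 4 * ∑ l, D.colDot x l * D.colDot ζ l := by
  have h₁ : ∑ i, D.gTbV x i * ζ.v i = -(1 / 2) * D.alt x ζ - 1 / 2 * x.tb * (D.A ⬝ᵥ ζ.v)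
      - x.tb / 4 * ∑ l, D.colDot x l * ∑ i, D.M₁ i l * ζ.v i := by
    have e : D.alt x ζ = ∑ i, (-1) ^ ((i.2 : ℕ) + 1) * D.lam i.1 * x.v (i.1, 1 - i.2) * ζ.v i := by
      rw [alt, Fintype.sum_prod_type]
      refine Finset.sum_congr rfl fun k _ => ?_
      simp
      ring
    simp only [e, gTbV, dotProduct, rowComb_apply, Finset.mul_sum, ← Finset.sum_sub_distrib]
    rw [Finset.sum_comm, ← Finset.sum_sub_distrib]
    refine Finset.sum_congr rfl fun i _ => ?_
    rw [sub_mul, Finset.sum_mul]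
    congr 1
    · ring
    · exact Finset.sum_congr rfl fun l _ => by rw [Matrix.row_apply]; ring
  have h₂ : ∑ j, D.gTbW x j * ζ.w j = - 1 / 2 * x.tb * (D.B ⬝ᵥ ζ.w)
      - x.tb / 4 * ∑ l, D.colDot x l * ∑ j, D.M₂ j l * ζ.w j := by
    simp only [gTbW, dotProduct, rowComb_apply, Finset.mul_sum]
    rw [Finset.sum_comm, ← Finset.sum_sub_distrib]
    refine Finset.sum_congr rfl fun i _ => ?_
    rw [sub_mul, Finset.sum_mul]
    congr 1
    · ring
    · exact Finset.sum_congr rfl fun l _ => by rw [Matrix.row_apply]; ring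
  rw [h₁, h₂, lin]
  simp only [D.colDot_eq_sum ζ, mul_add, Finset.sum_add_distrib]
  ring

lemma sum_gVV_add_sum_gVW_add_sum_gWW (x ξ η : Space p r q) :
    ∑ i, ∑ j, D.gVV x i j * (ξ.v i * η.v j)
      + ∑ i, ∑ j, D.gVW x i j * (ξ.v i * η.w j + ξ.w j * η.v i)
      + ∑ i, ∑ j, D.gWW x i j * (ξ.w i * η.w j)
      = ξ.v ⬝ᵥ η.v + ξ.w ⬝ᵥ η.w + x.tb ^ 2 / 4 * ∑ l, D.colDot ξ l * D.colDot η l := by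
  have key : ∀ {ι κ : Type} [Fintype ι] [Fintype κ] (M : ι → Fin p → ℝ) (M' : κ → Fin p → ℝ)
      (f : ι → ℝ) (g : κ → ℝ), ∑ i, ∑ j, (M i ⬝ᵥ M' j) * (f i * g j)
        = ∑ l, (∑ i, M i l * f i) * ∑ j, M' j l * g j := by
    intro ι κ _ _ M M' f g
    calc ∑ i, ∑ j, (M i ⬝ᵥ M' j) * (f i * g j)
        = ∑ i, ∑ l, ∑ j, M i l * f i * (M' j l * g j) := by
          refine Finset.sum_congr rfl fun i _ => ?_
          rw [Finset.sum_comm]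
          refine Finset.sum_congr rfl fun j _ => ?_
          rw [dotProduct, Finset.sum_mul]
          exact Finset.sum_congr rfl fun l _ => by ring
      _ = _ := by
          rw [Finset.sum_comm]
          exact Finset.sum_congr rfl fun l _ => (Finset.sum_mul_sum _ _ _ _).symm
  have h₁ : ∑ i, ∑ j, D.gVV x i j * (ξ.v i * η.v j) = ξ.v ⬝ᵥ η.v + x.tb ^ 2 / 4 *
      ∑ l, (∑ i, D.M₁ i l * ξ.v i) * ∑ j, D.M₁ j l * η.v j := by
    rw [← key D.M₁ D.M₁, dotProduct, Finset.mul_sum, ← Finset.sum_add_distrib]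
    refine Finset.sum_congr rfl fun i _ => ?_
    simp only [gVV, add_mul, Finset.sum_add_distrib, Finset.mul_sum, Matrix.row, ite_mul, one_mul,
      zero_mul, Finset.sum_ite_eq, Finset.mem_univ, if_true, mul_assoc]
  have h₂ : ∑ i, ∑ j, D.gWW x i j * (ξ.w i * η.w j) = ξ.w ⬝ᵥ η.w + x.tb ^ 2 / 4 *
      ∑ l, (∑ i, D.M₂ i l * ξ.w i) * ∑ j, D.M₂ j l * η.w j := by
    rw [← key D.M₂ D.M₂, dotProduct, Finset.mul_sum, ← Finset.sum_add_distrib]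
    refine Finset.sum_congr rfl fun i _ => ?_
    simp only [gWW, add_mul, Finset.sum_add_distrib, Finset.mul_sum, Matrix.row, ite_mul, one_mul,
      zero_mul, Finset.sum_ite_eq, Finset.mem_univ, if_true, mul_assoc]
  have h₃ : ∑ i, ∑ j, D.gVW x i j * (ξ.v i * η.w j + ξ.w j * η.v i) = x.tb ^ 2 / 4 *
      (∑ l, (∑ i, D.M₁ i l * ξ.v i) * ∑ j, D.M₂ j l * η.w j +
        ∑ l, (∑ i, D.M₁ i l * η.v i) * ∑ j, D.M₂ j l * ξ.w j) := by
    rw [← key D.M₁ D.M₂, ← key D.M₁ D.M₂, ← Finset.sum_add_distrib, Finset.mul_sum]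
    refine Finset.sum_congr rfl fun i _ => ?_
    rw [← Finset.sum_add_distrib, Finset.mul_sum]
    refine Finset.sum_congr rfl fun j _ => ?_
    simp only [gVW, Matrix.row]
    ring
  rw [h₁, h₂, h₃]
  simp only [colDot_eq_sum, add_mul, mul_add, Finset.sum_add_distrib]
  have e : ∑ l, (∑ i, D.M₁ i l * η.v i) * ∑ j, D.M₂ j l * ξ.w j
      = ∑ l, (∑ j, D.M₂ j l * ξ.w j) * ∑ i, D.M₁ i l * η.v i :=
    Finset.sum_congr rfl fun l _ => mul_comm _ _
  rw [e]
  ring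

/-- The map ξ ↦ ξ - ½[x,ξ] carries a tangent vector at `x` back to 0 by left translation. The many
coefficients of the metric are the expansion of the constant form composed with it. -/
lemma metric_eq_form (x ξ η : Space p r q) : D.metric x ξ η =
    form (ξ - (2⁻¹ : ℝ) • D.br x ξ) (η - (2⁻¹ : ℝ) • D.br x η) := by
  have h₁ : ∑ i, D.gTbV x i * (ξ.tb * η.v i + ξ.v i * η.tb)
      + ∑ j, D.gTbW x j * (ξ.tb * η.w j + ξ.w j * η.tb)
      = ξ.tb * (∑ i, D.gTbV x i * η.v i + ∑ j, D.gTbW x j * η.w j)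
        + η.tb * (∑ i, D.gTbV x i * ξ.v i + ∑ j, D.gTbW x j * ξ.w j) := by
    simp only [mul_add, Finset.sum_add_distrib, Finset.mul_sum]
    have e : ∀ a b c d a' b' c' d' : ℝ, a = a' → b = b' → c = c' → d = d' →
        a + b + (c + d) = a' + c' + (b' + d') := by
      rintro a b c d _ _ _ _ rfl rfl rfl rfl
      ring
    refine e _ _ _ _ _ _ _ _ ?_ ?_ ?_ ?_ <;> exact Finset.sum_congr rfl fun i _ => by ring
  rw [sum_gTbV_add_sum_gTbW, sum_gTbV_add_sum_gTbW] at h₁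
  have h₂ := D.sum_gVV_add_sum_gVW_add_sum_gWW x ξ η
  have h₃ : ∑ l, ∑ i, D.gUV x l i * (ξ.u l * η.v i + ξ.v i * η.u l)
      + ∑ l, ∑ j, D.gUW x l j * (ξ.u l * η.w j + ξ.w j * η.u l)
      = ∑ l, -(x.tb / 2) * (ξ.u l * D.colDot η l + η.u l * D.colDot ξ l) := by
    rw [← Finset.sum_add_distrib]
    exact Finset.sum_congr rfl fun l _ => D.sum_gUV_add_sum_gUW x ξ η l
  have h₄ : form (ξ - (2⁻¹ : ℝ) • D.br x ξ) (η - (2⁻¹ : ℝ) • D.br x η)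
      = (ξ.t - 1 / 2 * (D.alt x ξ + (x.tb * D.lin ξ - ξ.tb * D.lin x))) * η.tb
        + ξ.tb * (η.t - 1 / 2 * (D.alt x η + (x.tb * D.lin η - η.tb * D.lin x)))
        + ∑ l, (ξ.u l - 1 / 2 * (x.tb * D.colDot ξ l - ξ.tb * D.colDot x l))
          * (η.u l - 1 / 2 * (x.tb * D.colDot η l - η.tb * D.colDot x l))
        + ξ.v ⬝ᵥ η.v + ξ.w ⬝ᵥ η.w := by
    simp [form, br_apply, Space.t, Space.tb, Space.u, Space.v, Space.w, dotProduct]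
  have h₅ : ∑ l, (ξ.u l - 1 / 2 * (x.tb * D.colDot ξ l - ξ.tb * D.colDot x l))
          * (η.u l - 1 / 2 * (x.tb * D.colDot η l - η.tb * D.colDot x l))
      = ∑ l, ξ.u l * η.u l
        + ∑ l, -(x.tb / 2) * (ξ.u l * D.colDot η l + η.u l * D.colDot ξ l)
        + ∑ l, D.gTbU x l * (ξ.tb * η.u l + ξ.u l * η.tb)
        + x.tb ^ 2 / 4 * ∑ l, D.colDot ξ l * D.colDot η l
        - x.tb / 4 * ξ.tb * ∑ l, D.colDot x l * D.colDot η l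
        - x.tb / 4 * η.tb * ∑ l, D.colDot x l * D.colDot ξ l
        + 1 / 4 * (ξ.tb * η.tb) * ∑ l, D.colDot x l ^ 2 := by
    simp only [Finset.mul_sum, ← Finset.sum_add_distrib, ← Finset.sum_sub_distrib]
    exact Finset.sum_congr rfl fun l _ => by rw [gTbU]; ring
  rw [h₄, h₅, metric, gTbTb]
  have e : D.lin x = D.A ⬝ᵥ x.v + D.B ⬝ᵥ x.w := rfl
  rw [e]
  linear_combination h₁ + h₂ + h₃

end Params


/-! ### The Ricci form in terms of the parameters. -/

section Normal

variable {V : Type*} [AddCommGroup V] [Module ℝ V]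
  {B : V →ₗ[ℝ] V →ₗ[ℝ] ℝ} {br pr : V →ₗ[ℝ] V →ₗ[ℝ] V} {p r q : ℕ}
  {e e' : V} {z : Fin p → V} {v : Fin r × Fin 2 → V} {w : Fin q → V} {lam : Fin r → ℝ}

/-- Each plane contributes λ_k² once for either order of its two basis vectors, hence the factor 2.
-/
lemma IsAdaptedBasis.sum_sq (h : IsAdaptedBasis B br e e' z v w lam) :
    ∑ i, ∑ k, B (br (Sum.elim v w i) (Sum.elim v w k)) e' ^ 2 = 2 * ∑ k, lam k ^ 2 := by
  have h0 : ∀ k, ∑ i, B (br (v (k, 0)) (Sum.elim v w i)) e' ^ 2 = lam k ^ 2 := fun k => by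
    simp only [h.br_v0, fun i => h.cc (Sum.inl (k, 1)) i, ← Sum.elim_inl v w (k, 1)]
    simp
  have h1 : ∀ k, ∑ i, B (br (v (k, 1)) (Sum.elim v w i)) e' ^ 2 = lam k ^ 2 := fun k => by
    simp only [h.br_v1, fun i => h.cc (Sum.inl (k, 0)) i, ← Sum.elim_inl v w (k, 0)]
    simp
  rw [Fintype.sum_sum_type, Fintype.sum_prod_type]
  simp only [Sum.elim_inl, Sum.elim_inr, Fin.sum_univ_two, h0, h1, h.br_w]
  simp [two_mul, Finset.sum_add_distrib]

lemma IsAdaptedBasis.trace_curv_eq [FiniteDimensional ℝ V] (hB : IsScalarProduct B)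
    (h : IsAdaptedBasis B br e e' z v w lam) (hbr : ∀ u v, br u v = -br v u)
    (h2 : ∀ u v w, br (br u v) w = 0) (hpr : IsKoszul B br pr) (x y : V) :
    LinearMap.trace ℝ V (curv br pr x y) = 1 / 2 * (B x e * B y e) *
      (∑ k, lam k ^ 2 - (∑ i, ∑ l, B (br e' (v i)) (z l) ^ 2
        + ∑ j, ∑ l, B (br e' (w j)) (z l) ^ 2)) := by
  rw [h.toIsAdapted.trace_curv_of_isotropic hB hbr h2 hpr h.isotropic, h.sum_sq,
    Fintype.sum_sum_type]
  simp only [Sum.elim_inl, Sum.elim_inr]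
  ring

namespace Params

variable (D : Params p r q)

lemma trace_mul_transpose {ι κ : Type*} [Fintype ι] [Fintype κ] (M : Matrix ι κ ℝ) :
    (M * Mᵀ).trace = ∑ i, ∑ l, M i l ^ 2 := by
  simp [Matrix.trace, Matrix.mul_apply, sq]

/-- The canonical basis of `ℝ² × ℝ^p × ℝ^(2r) × ℝ^q` is adapted. -/
lemma isAdaptedBasis (T : V ≃ₗ[ℝ] Space p r q) (hT : ∀ x y, T (br x y) = D.br (T x) (T y))
    (hB : ∀ x y, B x y = form (T x) (T y)) :
    IsAdaptedBasis B br (T.symm (1, 0, 0, 0, 0)) (T.symm (0, 1, 0, 0, 0))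
      (fun l => T.symm (0, 0, Pi.single l 1, 0, 0)) (fun i => T.symm (0, 0, 0, Pi.single i 1, 0))
      (fun j => T.symm (0, 0, 0, 0, Pi.single j 1)) D.lam where
  decomp x y := by
    simp [hB, form, Space.t, Space.tb, Space.u, Space.v, Space.w]
    simp [dotProduct]
    ring
  central_e x := T.injective (by simp [hT, br_apply, Space.tb, Space.v, Space.w, lin, colDot, alt]; rfl)
  central_z l x := T.injective (by simp [hT, br_apply, Space.tb, Space.v, Space.w, lin, colDot, alt]; rfl)
  orth_e x y := by simp [hB, hT, form, br_apply, Space.t, Space.tb, Space.u, Space.v, Space.w, lin, colDot, alt]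
  orth_c x y i := by rcases i with i | i <;> simp [hB, hT, form, br_apply, Space.t, Space.tb, Space.u, Space.v, Space.w, lin, colDot, alt]
  ee := by simp [hB, form, Space.t, Space.tb, Space.u, Space.v, Space.w]
  ee' := by simp [hB, form, Space.t, Space.tb, Space.u, Space.v, Space.w]
  e'e' := by simp [hB, form, Space.t, Space.tb, Space.u, Space.v, Space.w]
  ez l := by simp [hB, form, Space.t, Space.tb, Space.u, Space.v, Space.w]
  e'z l := by simp [hB, form, Space.t, Space.tb, Space.u, Space.v, Space.w]
  ec i := by rcases i with i | i <;> simp [hB, form, Space.t, Space.tb, Space.u, Space.v, Space.w]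
  e'c i := by rcases i with i | i <;> simp [hB, form, Space.t, Space.tb, Space.u, Space.v, Space.w]
  zz l l' := by simp [hB, form, Space.t, Space.tb, Space.u, Space.v, Space.w, Pi.single_apply, eq_comm]
  zc l i := by rcases i with i | i <;> simp [hB, form, Space.t, Space.tb, Space.u, Space.v, Space.w]
  cc i j := by rcases i with i | i <;> rcases j with j | j <;> simp [hB, form, Space.t, Space.tb, Space.u, Space.v, Space.w, Pi.single_apply, eq_comm]
  isotropic i j l := by
    rcases i with i | i <;> rcases j with j | j <;> simp [hB, hT, form, br_apply, Space.t, Space.tb, Space.u, Space.v, Space.w, lin, colDot, alt]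
  br_v0 k i := by
    rcases i with i | i <;> simp [hB, hT, form, br_apply, Space.t, Space.tb, Space.u, Space.v, Space.w, lin, colDot, alt, Pi.single_apply]
    rw [Finset.sum_eq_single k (fun b _ hb => by simp [hb]) (by simp)]
    simp [eq_comm]
  br_v1 k i := by
    rcases i with i | i <;> simp [hB, hT, form, br_apply, Space.t, Space.tb, Space.u, Space.v, Space.w, lin, colDot, alt, Pi.single_apply]
    simp [eq_comm]
  br_w j i := by
    rcases i with i | i <;> simp [hB, hT, form, br_apply, Space.t, Space.tb, Space.u, Space.v, Space.w, lin, colDot, alt]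

end Params

end Normal


/-! ### From an adapted basis to admissible parameters. -/

section Coordinates

variable {V : Type*} [AddCommGroup V] [Module ℝ V]
  {B : V →ₗ[ℝ] V →ₗ[ℝ] ℝ} {br pr : V →ₗ[ℝ] V →ₗ[ℝ] V} {p r q : ℕ}
  {e e' : V} {z : Fin p → V} {v : Fin r × Fin 2 → V} {w : Fin q → V} {lam : Fin r → ℝ}

/-- Since e and the z are central, the bracket is determined by ad e' on the `c` and by the brackets
of the `c` among themselves. -/
lemma IsAdapted.br_eq {ρ κ : Type*} [Fintype ρ] [Fintype κ] {z : ρ → V} {c : κ → V}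
    (hB : IsScalarProduct B) (hbr : ∀ u v, br u v = -br v u)
    (h : IsAdapted B br e e' z c) (x y : V) :
    br x y = B x e • ∑ i, B y (c i) • br e' (c i) - B y e • ∑ i, B x (c i) • br e' (c i)
      + ∑ i, ∑ k, (B x (c i) * B y (c k)) • br (c i) (c k) := by
  have he'e' : br e' e' = 0 := by
    have h0 : (2 : ℝ) • br e' e' = 0 := by
      rw [two_smul]
      nth_rewrite 1 [hbr e' e']
      exact neg_add_cancel _
    simpa using h0
  have h1 : ∀ u, br u e = 0 := fun u => by rw [hbr, h.central_e, neg_zero]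
  have h2 : ∀ u l, br u (z l) = 0 := fun u l => by rw [hbr, h.central_z, neg_zero]
  have h3 : ∀ u, br u y = B y e • br u e' + ∑ i, B y (c i) • br u (c i) := fun u => by
    conv_lhs => rw [h.eq_sum hB y]
    simp [h1, h2]
  have h4 : br x y = B x e • br e' y + ∑ i, B x (c i) • br (c i) y := by
    conv_lhs => rw [h.eq_sum hB x]
    simp [h.central_e, h.central_z]
  rw [h4, h3 e', he'e']
  simp only [h3, fun i => hbr (c i) e', smul_add, Finset.sum_add_distrib, Finset.smul_sum,
    smul_smul, smul_zero, zero_add, smul_neg, Finset.sum_neg_distrib]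
  rw [sub_eq_add_neg, add_assoc]
  congr 3
  exact Finset.sum_congr rfl fun i _ => by rw [mul_comm]

variable (B br e e' z v w lam) in
/-- The structure constants of a metric Lie algebra with respect to an adapted basis. -/
def adaptedParams : Params p r q where
  M₁ := fun i l => B (br e' (v i)) (z l)
  M₂ := fun j l => B (br e' (w j)) (z l)
  lam := lam
  A := fun i => B (br e' (v i)) e'
  B := fun j => B (br e' (w j)) e'

variable (B e e' z v w) in
/-- The coordinates with respect to an adapted basis. -/
def adaptedCoord : V →ₗ[ℝ] Space p r q :=
  -- In a hyperbolic pair the coefficient of `e` is read by pairing with `e'`, and conversely.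
  (B.flip e').prod ((B.flip e).prod ((LinearMap.pi fun l => B.flip (z l)).prod
    ((LinearMap.pi fun i => B.flip (v i)).prod (LinearMap.pi fun j => B.flip (w j)))))

lemma adaptedCoord_apply (x : V) : adaptedCoord B e e' z v w x =
    (B x e', B x e, fun l => B x (z l), fun i => B x (v i), fun j => B x (w j)) := rfl

lemma IsAdaptedBasis.form_adaptedCoord (hB : IsScalarProduct B)
    (h : IsAdaptedBasis B br e e' z v w lam) (x y : V) :
    B x y = Params.form (adaptedCoord B e e' z v w x) (adaptedCoord B e e' z v w y) := by
  rw [h.decomp x y, Fintype.sum_sum_type, hB.symm e y, hB.symm e' y]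
  simp only [fun l => hB.symm (z l) y, fun i => hB.symm (v i) y, fun j => hB.symm (w j) y,
    Sum.elim_inl, Sum.elim_inr]
  simp only [Params.form, adaptedCoord_apply, dotProduct, add_assoc]

lemma IsAdaptedBasis.adaptedCoord_br (hB : IsScalarProduct B) (hbr : ∀ u v, br u v = -br v u)
    (h : IsAdaptedBasis B br e e' z v w lam) (x y : V) :
    adaptedCoord B e e' z v w (br x y) = (adaptedParams B br e' z v w lam).br
      (adaptedCoord B e e' z v w x) (adaptedCoord B e e' z v w y) := by
  have hx := h.br_eq hB hbr x y
  rw [adaptedCoord_apply (br x y), Params.br_apply]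
  refine Prod.ext ?_ (Prod.ext ?_ (Prod.ext ?_ (Prod.ext ?_ ?_)))
  · have h0 : ∀ k, ∑ i, B x (v (k, 0)) * B y (Sum.elim v w i)
        * B (br (v (k, 0)) (Sum.elim v w i)) e' = lam k * (B x (v (k, 0)) * B y (v (k, 1))) :=
      fun k => by
        simp only [h.br_v0, fun i => h.cc (Sum.inl (k, 1)) i, ← Sum.elim_inl v w (k, 1)]
        simp
        ring
    have h1 : ∀ k, ∑ i, B x (v (k, 1)) * B y (Sum.elim v w i)
        * B (br (v (k, 1)) (Sum.elim v w i)) e' = -(lam k * (B x (v (k, 1)) * B y (v (k, 0)))) :=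
      fun k => by
        simp only [h.br_v1, fun i => h.cc (Sum.inl (k, 0)) i, ← Sum.elim_inl v w (k, 0)]
        simp
        ring
    have hs : ∑ i, ∑ k, B x (Sum.elim v w i) * B y (Sum.elim v w k)
        * B (br (Sum.elim v w i) (Sum.elim v w k)) e'
        = ∑ k, lam k * (B x (v (k, 0)) * B y (v (k, 1)) - B y (v (k, 0)) * B x (v (k, 1))) := by
      rw [Fintype.sum_sum_type, Fintype.sum_prod_type]
      simp only [Sum.elim_inl, Sum.elim_inr, Fin.sum_univ_two, h0, h1, h.br_w]
      simp only [mul_zero, Finset.sum_const_zero, add_zero]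
      exact Finset.sum_congr rfl fun k _ => by ring
    have hl : ∀ u, ∑ i, B u (Sum.elim v w i) * B (br e' (Sum.elim v w i)) e'
        = (adaptedParams B br e' z v w lam).lin (adaptedCoord B e e' z v w u) := fun u => by
      rw [Fintype.sum_sum_type]
      simp only [Sum.elim_inl, Sum.elim_inr, Params.lin, adaptedParams, adaptedCoord_apply,
        dotProduct, mul_comm]
    rw [← hl, ← hl]
    change B (br x y) e' = ∑ k, lam k * (B x (v (k, 0)) * B y (v (k, 1))
      - B y (v (k, 0)) * B x (v (k, 1))) + (B x e * _ - B y e * _)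
    rw [← hs, hx]
    simp only [map_add, map_sub, map_smul, map_sum, LinearMap.add_apply, LinearMap.sub_apply,
      LinearMap.smul_apply, LinearMap.sum_apply, smul_eq_mul]
    ring
  · exact h.orth_e x y
  · funext l
    have hl : ∀ u, ∑ i, B u (Sum.elim v w i) * B (br e' (Sum.elim v w i)) (z l)
        = (adaptedParams B br e' z v w lam).colDot (adaptedCoord B e e' z v w u) l := fun u => by
      rw [Fintype.sum_sum_type]
      simp only [Sum.elim_inl, Sum.elim_inr, Params.colDot_eq_sum, adaptedParams,
        adaptedCoord_apply, mul_comm]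
    simp only [← hl]
    change B (br x y) (z l) = (B x e * _ - B y e * _)
    rw [hx]
    simp only [map_add, map_sub, map_smul, map_sum, LinearMap.add_apply, LinearMap.sub_apply,
      LinearMap.smul_apply, LinearMap.sum_apply, smul_eq_mul, h.isotropic, mul_zero,
      Finset.sum_const_zero, add_zero]
  · funext i
    exact h.orth_c x y (Sum.inl i)
  · funext j
    exact h.orth_c x y (Sum.inr j)

lemma IsAdaptedBasis.bijective_adaptedCoord (hB : IsScalarProduct B)
    (h : IsAdaptedBasis B br e e' z v w lam) :
    Function.Bijective (adaptedCoord B e e' z v w) := by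
  constructor
  · rw [injective_iff_map_eq_zero]
    intro x hx
    refine hB.nondegenerate x fun y => ?_
    rw [h.form_adaptedCoord hB, hx]
    simp [Params.form, Space.t, Space.tb, Space.u, Space.v, Space.w]
  · intro s
    have e1 := fun i => h.ec (Sum.inl i)
    have e2 := fun i => h.ec (Sum.inr i)
    have e3 := fun i => h.e'c (Sum.inl i)
    have e4 := fun i => h.e'c (Sum.inr i)
    have e5 := fun l i => h.zc l (Sum.inl i)
    have e6 := fun l i => h.zc l (Sum.inr i)
    have e7 := fun i j => h.cc (Sum.inl i) (Sum.inl j)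
    have e8 := fun i j => h.cc (Sum.inl i) (Sum.inr j)
    have e9 := fun i j => h.cc (Sum.inr i) (Sum.inr j)
    simp only [Sum.elim_inl, Sum.elim_inr, Sum.inl.injEq, Sum.inr.injEq, reduceCtorEq,
      if_false] at e1 e2 e3 e4 e5 e6 e7 e8 e9
    refine ⟨s.t • e + s.tb • e' + ∑ l, s.u l • z l + ∑ i, s.v i • v i + ∑ j, s.w j • w j, ?_⟩
    rw [adaptedCoord_apply]
    refine Prod.ext ?_ (Prod.ext ?_ (Prod.ext ?_ (Prod.ext ?_ ?_)))
    · simp [fun l => hB.symm (z l) e', fun i => hB.symm (v i) e',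
        fun j => hB.symm (w j) e', h.ee', h.e'e', h.e'z, e3, e4]
    · simp [hB.symm e' e, fun l => hB.symm (z l) e, fun i => hB.symm (v i) e,
        fun j => hB.symm (w j) e, h.ee, h.ee', h.ez, e1, e2]
    · funext l
      simp [h.ez, h.e'z, h.zz, fun i => hB.symm (v i) (z l), fun j => hB.symm (w j) (z l), e5, e6]
    · funext i
      simp [e1, e3, e5, e7, fun j => hB.symm (w j) (v i), e8]
    · funext j
      simp [e2, e4, e6, e8, e9]

/-- The trace equation is the vanishing of Ric(e',e'). If the span condition failed, a nonzero
linear form killing B and the columns of M₂ would supply a nonzero central combination of the `w`,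
contrary to `hz`. -/
lemma IsAdaptedBasis.admissible [FiniteDimensional ℝ V] (hB : IsScalarProduct B)
    (h : IsAdaptedBasis B br e e' z v w lam) (hbr : ∀ u v, br u v = -br v u)
    (h2 : ∀ u v w, br (br u v) w = 0) (hpr : IsKoszul B br pr)
    (hR : ∀ u v, LinearMap.trace ℝ V (curv br pr u v) = 0)
    (hpos : ∀ k, 0 < lam k) (hmono : Monotone lam)
    (hz : ∀ x, B x e = 0 → B x e' = 0 → (∀ l, B x (z l) = 0) → (∀ y, br x y = 0) → x = 0) :
    (adaptedParams B br e' z v w lam).Admissible where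
  lam_pos := hpos
  lam_mono := hmono
  trace_eq := by
    have := h.trace_curv_eq hB hbr h2 hpr e' e'
    rw [hR, hB.symm e' e, h.ee'] at this
    rw [Params.trace_mul_transpose, Params.trace_mul_transpose]
    change ∑ i, ∑ l, B (br e' (v i)) (z l) ^ 2 + ∑ j, ∑ l, B (br e' (w j)) (z l) ^ 2
      = ∑ k, lam k ^ 2
    linarith
  span_eq := by
    by_contra hne
    obtain ⟨f, hf0, hf⟩ := Submodule.exists_le_ker_of_lt_top _ (lt_top_iff_ne_top.2 hne)
    let a : Fin q → ℝ := fun j => f (Pi.single j 1)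
    have hfa : ∀ y : Fin q → ℝ, f y = ∑ j, y j * a j := fun y => by
      conv_lhs => rw [pi_eq_sum_univ' y]
      simp [a]
    have hf1 : ∀ y ∈ insert (adaptedParams B br e' z v w lam).B
        (Set.range (adaptedParams B br e' z v w lam).M₂.col), ∑ j, y j * a j = 0 := fun y hy => by
      rw [← hfa]
      exact hf (Submodule.subset_span hy)
    have hB0 : ∑ j, B (br e' (w j)) e' * a j = 0 := hf1 _ (Set.mem_insert _ _)
    have hM0 : ∀ l, ∑ j, B (br e' (w j)) (z l) * a j = 0 := fun l =>
      hf1 _ (Set.mem_insert_of_mem _ ⟨l, rfl⟩)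
    let s : Space p r q := (0, 0, 0, 0, a)
    obtain ⟨x, hx⟩ := (h.bijective_adaptedCoord hB).2 s
    have hx' := hx
    rw [adaptedCoord_apply] at hx'
    simp only [s, Prod.mk.injEq] at hx'
    obtain ⟨hx1, hx2, hx3, hx4, hx5⟩ := hx'
    have hx0 : x = 0 := by
      refine hz x hx2 hx1 (fun l => congrFun hx3 l) fun y => ?_
      refine (h.bijective_adaptedCoord hB).1 ?_
      rw [h.adaptedCoord_br hB hbr, hx, map_zero, Params.br_apply]
      have hl : (adaptedParams B br e' z v w lam).lin s = 0 := by
        simpa [Params.lin, dotProduct, s, Space.v, Space.w, adaptedParams] using hB0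
      have hc : ∀ l, (adaptedParams B br e' z v w lam).colDot s l = 0 := fun l => by
        simpa [Params.colDot_eq_sum, s, Space.v, Space.w, adaptedParams] using hM0 l
      simp only [hl, hc]
      simp [s, Params.alt, Space.v, Space.tb]
      rfl
    refine hf0 (LinearMap.ext fun y => ?_)
    rw [hfa, ← hx5, hx0]
    simp

end Coordinates


namespace Params

variable {p r q : ℕ} (D : Params p r q)

lemma br_br (x y y' : Space p r q) : D.br y' (D.br x y) = 0 := by
  rw [D.br_apply x y, br_apply]
  simp [lin, alt, colDot, Space.v, Space.w, Space.tb]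
  rfl

lemma br_self (x : Space p r q) : D.br x x = 0 := by
  have h0 : (2 : ℝ) • D.br x x = 0 := by
    rw [two_smul]
    nth_rewrite 1 [D.br_swap x x]
    exact neg_add_cancel _
  exact (smul_eq_zero_iff_right two_ne_zero).1 h0

lemma metric_add_br (x ξ η : Space p r q) :
    D.metric x (ξ + (2⁻¹ : ℝ) • D.br x ξ) (η + (2⁻¹ : ℝ) • D.br x η) = form ξ η := by
  rw [metric_eq_form]
  simp only [map_add, map_smul, br_br, smul_zero, add_zero, add_sub_cancel_right]

lemma metric_zero (ξ η : Space p r q) : D.metric 0 ξ η = form ξ η := by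
  simp [metric_eq_form]

end Params

/-! ### Integration of isomorphisms and the two implications. -/

section Main

variable {E : Type*} [NormedAddCommGroup E] [NormedSpace ℝ E] [FiniteDimensional ℝ E]
  {N : Type*} [TopologicalSpace N] [ChartedSpace E N] [Group N] [LieGroup 𝓘(ℝ, E) ∞ N]
  {p r q : ℕ}

lemma lieBr_lieBr (hN : IsTwoStepNilpotent (GroupLieAlgebra 𝓘(ℝ, E) N)) (u v w : E) :
    lieBr E N (lieBr E N u v) w = 0 := hN.2 u v w

lemma exists_lieBr_ne_zero (hN : IsTwoStepNilpotent (GroupLieAlgebra 𝓘(ℝ, E) N)) :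
    ∃ u v : E, lieBr E N u v ≠ 0 := hN.1

lemma metricAtOne_lorentzian (g : LorentzianMetric E N) :
    IsLorentzian fun u v : E => metricAtOne g u v := g.lorentzian 1

/-- An isomorphism of metric Lie algebras integrates to an isometric isomorphism of groups. -/
theorem isIsomorphic_of_linearEquiv [T2Space N] [SimplyConnectedSpace N]
    (h2 : ∀ u v w : E, lieBr E N (lieBr E N u v) w = 0)
    {g : LorentzianMetric E N} (hg : IsLeftInvariant g) (D : Params p r q)
    (T : E ≃ₗ[ℝ] Space p r q) (hbr : ∀ x y, T (lieBr E N x y) = D.br (T x) (T y))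
    (hB : ∀ x y, metricAtOne g x y = Params.form (T x) (T y)) : D.IsIsomorphic g := by
  obtain ⟨F, hmul, hd⟩ := exists_bch_diffeomorph (N := N) h2
  let Tc : E ≃L[ℝ] Space p r q := T.toContinuousLinearEquiv
  -- The differential equation of the logarithm, carried by `T`, has the form required by
  -- `Params.metric_add_br`.
  have hTd : ∀ x v, tder (E := E) (fun y => Tc (F y)) x v = T (maurerCartan x v)
      + (2⁻¹ : ℝ) • D.br (T (F x)) (T (maurerCartan x v)) := fun x v => by
    have hF : MDifferentiableAt 𝓘(ℝ, E) 𝓘(ℝ, E) F x := F.mdifferentiable (by simp) x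
    have h1 := tder_clm_comp (Tc : E →L[ℝ] Space p r q) hF
    have h3 : tder (E := E) (fun y => Tc (F y)) x v = T (tder F x v) :=
      congrArg (fun L : E →L[ℝ] Space p r q => L v) h1
    rw [h3, hd, map_add, map_smul, hbr]
  refine ⟨F.trans Tc.toDiffeomorph, fun x y => ?_, fun x ξ η => ?_⟩
  · change T (F (x * y)) = D.mul (T (F x)) (T (F y))
    rw [hmul, map_add, map_add, map_smul, hbr, D.mul_eq]
  · have h1 : ∀ a b : E, innerVF g x a b = D.metric (T (F x))
        (tder (E := E) (fun y => Tc (F y)) x a) (tder (E := E) (fun y => Tc (F y)) x b) :=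
      fun a b => by rw [hTd, hTd, D.metric_add_br, inner_eq_metricAtOne hg, hB]
    exact h1 ξ η

/-- The derivative at the identity of an isometric isomorphism of groups is an isomorphism of
metric Lie algebras. -/
theorem exists_linearEquiv_of_isIsomorphic {g : LorentzianMetric E N} {D : Params p r q}
    (h : D.IsIsomorphic g) : ∃ T : E ≃ₗ[ℝ] Space p r q,
      (∀ x y, T (lieBr E N x y) = D.br (T x) (T y)) ∧
      ∀ x y, metricAtOne g x y = Params.form (T x) (T y) := by
  obtain ⟨φ, hmul, hiso⟩ := h
  have h1 : φ 1 = 0 := by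
    have h := hmul 1 1
    rw [mul_one, D.mul_eq, D.br_self, smul_zero, add_zero] at h
    exact left_eq_add.1 h
  let T : E ≃L[ℝ] Space p r q := φ.mfderivToContinuousLinearEquiv (by simp) 1
  have hT : ∀ v, tder φ 1 v = T v := fun v => rfl
  have hφd : ∀ x, MDifferentiableAt 𝓘(ℝ, E) 𝓘(ℝ, Space p r q) φ x :=
    φ.mdifferentiable (by simp)
  -- Obtained by differentiating φ(xy) = φ(x) + φ(y) + ½[φ(x),φ(y)] in y at 1.
  have hfr : ∀ x v, tder φ x (frame x v) = T v + (2⁻¹ : ℝ) • D.br (φ x) (T v) := fun x v => by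
    let L : Space p r q →L[ℝ] Space p r q := ContinuousLinearMap.id ℝ _
      + (2⁻¹ : ℝ) • LinearMap.toContinuousLinearMap (D.br (φ x))
    have h3 := tder_comp_mul_left φ.contMDiff x 1 v
    have h4 : (fun y => φ (x * y)) = fun y => φ x + L (φ y) := by
      funext y
      rw [hmul, D.mul_eq, add_assoc]
      rfl
    rw [mul_one, h4] at h3
    have h5 : tder (E := E) (fun y => φ x + L (φ y)) 1 = L ∘SL tder φ 1 := by
      rw [tder_add (mdifferentiableAt_const) (mdifferentiableAt_clm_comp L (hφd 1)), tder_const,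
        tder_clm_comp L (hφd 1), zero_add]
    rw [h5] at h3
    exact h3.symm
  refine ⟨T.toLinearEquiv, fun v w => ?_, fun v w => ?_⟩
  -- The iterated derivative along two left-invariant fields is half the model bracket;
  -- antisymmetrising it gives the image of the Lie bracket.
  · have h2 : ∀ a b : E, tder (E := E) (fun y : N => tder φ y (frame y b)) 1 a
        = (2⁻¹ : ℝ) • D.br (T a) (T b) := fun a b => by
      let L : Space p r q →L[ℝ] Space p r q :=
        (2⁻¹ : ℝ) • LinearMap.toContinuousLinearMap (D.br.flip (T b))
      have h5 : (fun y : N => tder φ y (frame y b)) = fun y => T b + L (φ y) :=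
        funext fun y => hfr y b
      rw [h5, tder_add (mdifferentiableAt_const) (mdifferentiableAt_clm_comp L (hφd 1)),
        tder_const, tder_clm_comp L (hφd 1), zero_add]
      rfl
    have h3 := tder_vfBracket (φ.contMDiff.contMDiffAt.of_le (by norm_cast))
      (vfDiffAt_frame_const (N := N) v 1) (vfDiffAt_frame_const w 1)
    rw [vfBracket_frame_const, frame_one, frame_one, frame_one, h2, h2, D.br_swap (T w), smul_neg, sub_neg_eq_add,
      ← add_smul] at h3
    norm_num at h3
    exact h3
  · have h3 : metricAtOne g v w = D.metric (φ 1) (T v) (T w) := hiso 1 v w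
    rwa [h1, D.metric_zero] at h3

/-- The canonical basis, carried to the Lie algebra by the derivative at 1, is adapted; the scalar
factor of its Ricci form vanishes by the trace equation. -/
theorem isRicciFlat_of_isIsomorphic (hN : IsTwoStepNilpotent (GroupLieAlgebra 𝓘(ℝ, E) N))
    {g : LorentzianMetric E N} (hg : IsLeftInvariant g) {D : Params p r q} (hD : D.Admissible)
    (h : D.IsIsomorphic g) : IsRicciFlat g := by
  have hB := metricAtOne_isScalarProduct g
  obtain ⟨pr, hpr⟩ := exists_isKoszul hB (lieBr E N)
  obtain ⟨T, hbr, hT⟩ := exists_linearEquiv_of_isIsomorphic h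
  rw [isRicciFlat_iff hg hpr]
  intro u v
  have h3 := hD.trace_eq
  rw [Params.trace_mul_transpose, Params.trace_mul_transpose] at h3
  rw [(D.isAdaptedBasis T hbr hT).trace_curv_eq hB lieBr_swap (lieBr_lieBr hN) hpr, ← h3]
  simp [hT, hbr, Params.form, Params.br_apply, Params.colDot, Space.t, Space.tb, Space.u,
    Space.v, Space.w]

theorem exists_isIsomorphic [T2Space N] [SimplyConnectedSpace N]
    (hN : IsTwoStepNilpotent (GroupLieAlgebra 𝓘(ℝ, E) N))
    {g : LorentzianMetric E N} (hg : IsLeftInvariant g) (hR : IsRicciFlat g) :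
    ∃ (p r q : ℕ) (D : Params p r q), D.Admissible ∧ D.IsIsomorphic g := by
  have hB := metricAtOne_isScalarProduct g
  have h2 := lieBr_lieBr hN
  obtain ⟨pr, hpr⟩ := exists_isKoszul hB (lieBr E N)
  rw [isRicciFlat_iff hg hpr] at hR
  obtain ⟨p, r, q, e, e', z, v, w, lam, hA, hpos, hmono, hz⟩ := exists_isAdaptedBasis
    (metricAtOne_lorentzian g) hB lieBr_swap h2 (exists_lieBr_ne_zero hN) hpr hR
  exact ⟨p, r, q, _, hA.admissible hB lieBr_swap h2 hpr hR hpos hmono hz,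
    isIsomorphic_of_linearEquiv h2 hg _
      (LinearEquiv.ofBijective _ (hA.bijective_adaptedCoord hB))
      (hA.adaptedCoord_br hB lieBr_swap) (hA.form_adaptedCoord hB)⟩

end Main

end RicciFlatLorentz

end

theorem mainTheorem3 {E : Type*} [NormedAddCommGroup E] [NormedSpace ℝ E] [FiniteDimensional ℝ E]
    {N : Type*} [TopologicalSpace N] [T2Space N] [ChartedSpace E N] [Group N]
    [LieGroup 𝓘(ℝ, E) ∞ N] [SimplyConnectedSpace N]
    (hN : RicciFlatLorentz.IsTwoStepNilpotent (GroupLieAlgebra 𝓘(ℝ, E) N))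
    (g : RicciFlatLorentz.LorentzianMetric E N)
    (hg : RicciFlatLorentz.IsLeftInvariant g) :
    RicciFlatLorentz.IsRicciFlat g ↔
      ∃ (p r q : ℕ) (D : RicciFlatLorentz.Params p r q), D.Admissible ∧ D.IsIsomorphic g :=
  ⟨RicciFlatLorentz.exists_isIsomorphic hN hg, fun ⟨_, _, _, _, hD, h⟩ =>
    RicciFlatLorentz.isRicciFlat_of_isIsomorphic hN hg hD h⟩
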